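/- **Setting.** An instance consists of $n$ agents, $m$ indivisible goods and non-negative integers $v_{i,j}$ (the value of good $j$ for agent $i$), extended additively by $v_i(S)=\sum_{j\in S}v_{i,j}$; every good has a positive value for at least one agent. Let $v_{\max}=\max_{i,j}v_{i,j}$. An allocation is an ordered partition $x=(x_1,\dots,x_n)$ of the goods. For $\delta>0$, $x$ is $\delta$-EF1 if for all agents $i,k$ either $x_k=\emptyset$ or there is $j\in x_k$ with $(1+\delta)v_i(x_i)\ge v_i(x_k\setminus\{j\})$; it is $\delta$-PO if there is no allocation $y$ with $v_k(y_k)\ge(1+\delta)v_k(x_k)$ for all $k$ and $v_i(y_i)>(1+\delta)v_i(x_i)$ for some $i$. For $\varepsilon>0$ the $\varepsilon$-rounded instance has values $v'_{i,j}=(1+\varepsilon)^{\lceil\log_{1+\varepsilon}v_{i,j}\rceil}$ if $v_{i,j}>0$ and $v'_{i,j}=0$ otherwise. **The algorithm ALG** (input: values $w_{i,j}\ge 0$ that are $0$ or powers of $1+\varepsilon$, and $\varepsilon$). *Preprocessing.* Compute a maximum matching of the bipartite graph $\{(i,j): w_{i,j}>0\}$ and keep only the set $A$ of matched agents; the others get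 nothing. *Phase 1.* Give each good $j$ to an agent of $A$ with the highest value for it, and let its price $p_j$ be that value. For a set $S$ of goods let $p(S)=\sum_{j\in S}p_j$. Call $(x,p)$ $\delta$-pEF1 if for all $i,k\in A$ either $x_k=\emptyset$ or $(1+\delta)p(x_i)\ge p(x_k\setminus\{j\})$ for some $j\in x_k$. Let $\alpha_h=\max_j w_{h,j}/p_j$ and $\mathrm{MBB}_h=\{j: w_{h,j}/p_j=\alpha_h\}$. Repeat the following. (a) If $(x,p)$ is $3\varepsilon$-pEF1, return $x$. Otherwise let $i\in A$ be the agent with the least spending $p(x_i)$ (ties go to the first agent), and let $H$ be the set of agents reachable from $i$, with their breadth-first levels, by steps $h\to h'$ such that $h'$ owns a good of $\mathrm{MBB}_h$. (b) *Phase 2.* Suppose that there are an agent $h$ at some level $\ell$ and a good $j\in\mathrm{MBB}_h$ whose owner $h'$ is at level $\ell+1$ with $p(x_{h'}\setminus\{j\})>(1+\varepsilon)p(x_i)$. Then choose such a pair with $\ell$ minimal and move $j$ from $h'$ to $h$. (c) *Phase 3.* Otherwise let $x_H$ be the set of goods owned by agents of $H$ and set $$\alpha_1=\min_{h\in H,\;j\notin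 x_H,\;w_{h,j}>0}\frac{\alpha_h}{w_{h,j}/p_j},\qquad \alpha_2=\frac{1}{p(x_i)}\max_{k\in A\setminus H}\ \min_{j\in x_k}p(x_k\setminus\{j\}),$$ and let $\alpha_3$ be the smallest integer power of $1+\varepsilon$ greater than $\min_{k\in A\setminus H}p(x_k)/p(x_i)$, where $\alpha_2=\alpha_3=\infty$ if $p(x_i)=0$. Multiply the prices of the goods in $x_H$ by $\alpha=\min(\alpha_1,\alpha_2,\alpha_3)$, and return $x$ if $\alpha=\alpha_2$. Time is the number of elementary operations in the unit-cost model: arithmetic operations and comparisons of real numbers, operations on indices and flags, and reads and writes of array cells. **Statement.** (1) There is a polynomial $P$ such that for every instance and every $0<\varepsilon\le1$, ALG with parameter $\varepsilon$, run on the $\varepsilon$-rounded instance, halts within time $P(m,n,\tfrac1\varepsilon,\ln v_{\max})$, however the free choices in Phases 1 and 2 are made, and every allocation that it returns is $7\varepsilon$-EF1 and $\varepsilon$-PO for the original instance. (2) Consequently, there is a polynomial $Q$ such that for every instance and every $\varepsilon>0$, computing the $\delta$-rounded instance with $\delta=\min(\varepsilon/7,1)$ and running ALG with parameter $\delta$ on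 it takes time at most $Q(m,n,\tfrac1\varepsilon,\ln v_{\max})$, and every allocation returned is $\varepsilon$-EF1 and $\varepsilon$-PO for the original instance. No bound on the valuations is assumed. (For an instance without agents or without goods, $v_{\max}=0$ and $\ln v_{\max}$ is read as $0$.) -/

import Mathlib

noncomputable section

namespace FairDivision

/-! ## Fair division with additive valuations

Agents are `Fin n`, goods are `Fin m`. An additive valuation profile is given by the values `w i j`
of single goods. An (integral) allocation, that is an ordered `n`-partition of the goods, is given
by the owner `x j` of every good `j`. -/

/-- The bundle `x_i` of agent `i`. -/
def bundle {n m : ℕ} (x : Fin m → Fin n) (i : Fin n) : Finset (Fin m) :=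
  Finset.univ.filter fun j => x j = i

/-- The additive value `v_i(S)` of a set of goods. -/
def value {n m : ℕ} (w : Fin n → Fin m → ℝ) (i : Fin n) (S : Finset (Fin m)) : ℝ :=
  ∑ j ∈ S, w i j

/-- `δ`-approximate envy-freeness up to one good. An empty bundle is never envied. -/
def ApproxEF1 {n m : ℕ} (δ : ℝ) (w : Fin n → Fin m → ℝ) (x : Fin m → Fin n) : Prop :=
  ∀ i k : Fin n, bundle x k = ∅ ∨
    ∃ j ∈ bundle x k, value w i (bundle x k \ {j}) ≤ (1 + δ) * value w i (bundle x i)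

/-- `y` `δ`-Pareto dominates `x`. -/
def ApproxDominates {n m : ℕ} (δ : ℝ) (w : Fin n → Fin m → ℝ) (y x : Fin m → Fin n) : Prop :=
  (∀ k, (1 + δ) * value w k (bundle x k) ≤ value w k (bundle y k)) ∧
    ∃ i, (1 + δ) * value w i (bundle x i) < value w i (bundle y i)

/-- `δ`-Pareto efficiency. -/
def ApproxPO {n m : ℕ} (δ : ℝ) (w : Fin n → Fin m → ℝ) (x : Fin m → Fin n) : Prop :=
  ¬ ∃ y : Fin m → Fin n, ApproxDominates δ w y x

/-- The integral valuations seen as real numbers. -/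
def realVal {n m : ℕ} (v : Fin n → Fin m → ℕ) : Fin n → Fin m → ℝ := fun i j => (v i j : ℝ)

/-- The largest value of a single good. -/
def vmax {n m : ℕ} (v : Fin n → Fin m → ℕ) : ℕ :=
  Finset.univ.sup fun i => Finset.univ.sup fun j => v i j

/-- The `ε`-rounded version of an instance: nonzero values are rounded up to the nearest integer
power of `1 + ε`. -/
def rounded {n m : ℕ} (ε : ℝ) (v : Fin n → Fin m → ℕ) : Fin n → Fin m → ℝ := fun i j =>
  if 0 < v i j then (1 + ε) ^ ⌈Real.logb (1 + ε) (v i j : ℝ)⌉ else 0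

/-! ## Computations with a step count

The cost model is the unit-cost random access machine over the reals: an arithmetic operation or
comparison of real numbers, an operation on indices, counters or flags, and a read or write of a
single array cell each cost one unit. A program is a term of the monad `Timed`; every elementary
operation in it is wrapped in `op`, which charges the unit. -/

/-- A result together with the number of elementary operations spent on it. -/
structure Timed (α : Type) where
  val : α
  time : ℕ

instance : Monad Timed where
  pure a := ⟨a, 0⟩
  bind c f := ⟨(f c.val).val, c.time + (f c.val).time⟩

/-- One elementary operation. -/
def op {α : Type} (a : α) : Timed α := ⟨a, 1⟩

/-- Fill an array indexed by `ι`: compute every entry and write it (one unit per write). -/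
def tabulate {ι β : Type} [Fintype ι] (f : ι → Timed β) : Timed (ι → β) :=
  ⟨fun i => (f i).val, ∑ i, ((f i).time + 1)⟩

/-- The loop that runs through `b ^ 0, b ^ 1, b ^ 2, …` and stops at the first power that passes
`test`: one comparison for every power visited, and one multiplication to get from one power to
the next. -/
def powSearch (b : ℝ) (test : ℝ → Prop) : Timed ℝ :=
  ⟨b ^ sInf {s : ℕ | test (b ^ s)}, 2 * sInf {s : ℕ | test (b ^ s)} + 1⟩

/-- Minimum of two elements of `ℝ ∪ {∞}`, where `none` stands for `∞`. -/
def minOpt (a b : Option ℝ) : Timed (Option ℝ) :=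
  match a, b with
  | none, b => op b
  | a, none => op a
  | some r, some s => do
      if (← op (decide (s < r))) then pure (some s) else pure (some r)

/-- Maximum of two reals. -/
def maxReal (a b : ℝ) : Timed ℝ := do
  if (← op (decide (a < b))) then pure b else pure a

/-! ## Restriction to the agents of a maximum matching

In the bipartite graph that joins agent `k` to good `j` when `w k j > 0`, a maximum matching is
computed by augmenting paths. A matching is stored as the array of partners of the goods. -/

/-- Breadth-first search along alternating paths from the unmatched agent `i`. The entry of a good
`j` that is reached is the agent from which it is reached. -/
def searchTree {n m : ℕ} (w : Fin n → Fin m → ℝ) (μ : Fin m → Option (Fin n)) (i : Fin n) :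
    Timed (Fin m → Option (Fin n)) := do
  let start ← tabulate fun _ : Fin m => op (none : Option (Fin n))
  (List.range m).foldlM (fun par _ => tabulate fun j => do
    match (← op (par j)) with
    | some k => pure (some k)
    | none => (List.finRange n).foldlM (fun (r : Option (Fin n)) k => do
        let isRoot ← op (decide (k = i))
        let reached ← (List.finRange m).foldlM (fun (b : Bool) j' => do
          let q ← op (par j')
          let o ← op (μ j')
          let e ← op (decide (o = some k))
          op (b || (q.isSome && e))) isRoot
        let a ← op (w k j)
        let pos ← op (decide (0 < a))
        if (← op (r.isNone && reached && pos)) then op (some k) else pure r) none) start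

/-- Exchange matched and unmatched edges along the search path that ends in good `j`. -/
def flipPath {n m : ℕ} (par : Fin m → Option (Fin n)) :
    ℕ → (Fin m → Option (Fin n)) → Fin m → Timed (Fin m → Option (Fin n))
  | 0, μ, _ => pure μ
  | fuel + 1, μ, j => do
      match (← op (par j)) with
      | none => pure μ
      | some k => do
          let prev ← (List.finRange m).foldlM (fun (r : Option (Fin m)) j' => do
            let o ← op (μ j')
            if (← op (decide (o = some k))) then op (some j') else pure r) none
          let μ' ← op (Function.update μ j (some k))
          match prev with
          | none => pure μ'
          | some j' => flipPath par fuel μ' j'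

/-- Match the unmatched agent `i` too, if there is an augmenting path from `i`. -/
def augment {n m : ℕ} (w : Fin n → Fin m → ℝ) (μ : Fin m → Option (Fin n)) (i : Fin n) :
    Timed (Fin m → Option (Fin n)) := do
  let par ← searchTree w μ i
  let free ← (List.finRange m).foldlM (fun (r : Option (Fin m)) j => do
    let o ← op (μ j)
    let q ← op (par j)
    if (← op (o.isNone && q.isSome)) then op (some j) else pure r) none
  match free with
  | none => pure μ
  | some j => flipPath par m μ j

/-- A maximum matching. -/
def maxMatching {n m : ℕ} (w : Fin n → Fin m → ℝ) : Timed (Fin m → Option (Fin n)) := do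
  let start ← tabulate fun _ : Fin m => op (none : Option (Fin n))
  (List.finRange n).foldlM (fun μ i => augment w μ i) start

/-- The agents covered by a maximum matching, in increasing order. -/
def matchedAgents {n m : ℕ} (w : Fin n → Fin m → ℝ) : Timed (List (Fin n)) := do
  let μ ← maxMatching w
  (List.finRange n).reverse.foldlM (fun (acc : List (Fin n)) k => do
    let hit ← (List.finRange m).foldlM (fun (b : Bool) j => do
      let o ← op (μ j)
      let e ← op (decide (o = some k))
      op (b || e)) false
    if (← op hit) then op (k :: acc) else pure acc) []

/-! ## The algorithm

`A` is the list of participating agents, `x` the current allocation, `p` the current prices. -/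

/-- The spending `p(x_k)`. -/
def spending {n m : ℕ} (x : Fin m → Fin n) (p : Fin m → ℝ) (k : Fin n) : Timed ℝ :=
  (List.finRange m).foldlM (fun (s : ℝ) j => do
    let o ← op (x j)
    if (← op (decide (o = k))) then
      let pj ← op (p j)
      op (s + pj)
    else pure s) 0

/-- Is `(x, p)` `δ`-price-envy-free up to one good? -/
def isPEF1 {n m : ℕ} (δ : ℝ) (A : List (Fin n)) (x : Fin m → Fin n) (p : Fin m → ℝ) :
    Timed Bool := do
  let c ← op (1 + δ)
  A.foldlM (fun (ok : Bool) i => do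
    let si ← spending x p i
    let bound ← op (c * si)
    A.foldlM (fun (ok : Bool) k => do
      let sk ← spending x p k
      let r ← (List.finRange m).foldlM (fun (r : Bool × Bool) j => do
        let o ← op (x j)
        if (← op (decide (o = k))) then
          let pj ← op (p j)
          let rest ← op (sk - pj)
          let good ← op (decide (rest ≤ bound))
          op (true, r.2 || good)
        else pure r) (false, false)
      op (ok && (!r.1 || r.2))) ok) true

/-- The least spender and its spending; ties go to the first agent in the list. -/
def leastSpender {n m : ℕ} (A : List (Fin n)) (x : Fin m → Fin n) (p : Fin m → ℝ) :
    Timed (Option (Fin n × ℝ)) :=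
  A.foldlM (fun (r : Option (Fin n × ℝ)) k => do
    let sk ← spending x p k
    match r with
    | none => op (some (k, sk))
    | some (i, si) => do
        if (← op (decide (sk < si))) then op (some (k, sk)) else pure (some (i, si))) none

/-- The maximum bang per buck ratios `α_h = max_j w h j / p j`. -/
def mbbRatios {n m : ℕ} (w : Fin n → Fin m → ℝ) (p : Fin m → ℝ) : Timed (Fin n → ℝ) :=
  tabulate fun h => (List.finRange m).foldlM (fun (a : ℝ) j => do
    let c ← op (w h j)
    let pj ← op (p j)
    let r ← op (c / pj)
    maxReal a r) 0

/-- The table of MBB edges. -/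
def mbbTable {n m : ℕ} (w : Fin n → Fin m → ℝ) (p : Fin m → ℝ) (ratio : Fin n → ℝ) :
    Timed (Fin n → Fin m → Bool) :=
  tabulate fun h => tabulate fun j => do
    let a ← op (ratio h)
    let c ← op (w h j)
    let pj ← op (p j)
    let r ← op (c / pj)
    op (decide (r = a))

/-- The hierarchy of agent `i`, as the array of levels (`none`: not reachable). In round `ℓ` the
agents outside the hierarchy that own an MBB good of an agent at level `ℓ` get level `ℓ + 1`. -/
def buildHierarchy {n m : ℕ} (A : List (Fin n)) (x : Fin m → Fin n) (mbb : Fin n → Fin m → Bool)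
    (i : Fin n) : Timed (Fin n → Option ℕ) := do
  let start ← tabulate fun k => do
    if (← op (decide (k = i))) then op (some 0) else op (none : Option ℕ)
  (List.range n).foldlM (fun lev ℓ => tabulate fun k => do
    match (← op (lev k)) with
    | some l => pure (some l)
    | none => do
        let hit ← (List.finRange m).foldlM (fun (b : Bool) j => do
          let o ← op (x j)
          let own ← op (decide (o = k))
          A.foldlM (fun (b : Bool) h => do
            let lh ← op (lev h)
            let c ← op (decide (lh = some ℓ))
            let e ← op (mbb h j)
            op (b || (own && c && e))) b) false
        if (← op hit) then op (some (ℓ + 1)) else pure none) start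

/-- The swaps available between levels `ℓ` and `ℓ + 1`. An entry `(h, j)` stands for the transfer
of good `j` to agent `h` at level `ℓ`, where `j` is an MBB good of `h` whose owner `o` is at level
`ℓ + 1` and is an `ε`-path-violator along the path through `h` and `j`. -/
def swapsAt {n m : ℕ} (ε : ℝ) (A : List (Fin n)) (x : Fin m → Fin n) (p : Fin m → ℝ)
    (mbb : Fin n → Fin m → Bool) (lev : Fin n → Option ℕ) (si : ℝ) (ℓ : ℕ) :
    Timed (List (Fin n × Fin m)) := do
  let c ← op (1 + ε)
  let bound ← op (c * si)
  let next ← op (ℓ + 1)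
  A.foldlM (fun (acc : List (Fin n × Fin m)) h =>
    (List.finRange m).foldlM (fun (acc : List (Fin n × Fin m)) j => do
      let lh ← op (lev h)
      let atLevel ← op (decide (lh = some ℓ))
      let e ← op (mbb h j)
      let o ← op (x j)
      let lo ← op (lev o)
      let above ← op (decide (lo = some next))
      let so ← spending x p o
      let pj ← op (p j)
      let rest ← op (so - pj)
      let viol ← op (decide (bound < rest))
      if (← op (atLevel && e && above && viol)) then op ((h, j) :: acc) else pure acc) acc) []

/-- The swaps available at the lowest level that has an `ε`-path-violator. -/
def firstSwaps {n m : ℕ} (ε : ℝ) (A : List (Fin n)) (x : Fin m → Fin n) (p : Fin m → ℝ)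
    (mbb : Fin n → Fin m → Bool) (lev : Fin n → Option ℕ) (si : ℝ) :
    Timed (List (Fin n × Fin m)) :=
  (List.range n).foldlM (fun (acc : List (Fin n × Fin m)) ℓ => do
    if (← op acc.isEmpty) then swapsAt ε A x p mbb lev si ℓ else pure acc) []

/-- What the algorithm does next: return the current allocation with the given prices, perform one
of the listed swaps, or go on with new prices. -/
inductive Action (n m : ℕ) where
  | finish (q : Fin m → ℝ)
  | swap (candidates : List (Fin n × Fin m))
  | raise (q : Fin m → ℝ)

/-- `α₁`: the factor at which a new MBB edge leaves the hierarchy. Goods of value zero never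
produce such an edge. -/
def alphaOne {n m : ℕ} (w : Fin n → Fin m → ℝ) (A : List (Fin n)) (x : Fin m → Fin n)
    (p : Fin m → ℝ) (ratio : Fin n → ℝ) (lev : Fin n → Option ℕ) : Timed (Option ℝ) :=
  A.foldlM (fun (acc : Option ℝ) h =>
    (List.finRange m).foldlM (fun (acc : Option ℝ) j => do
      let lh ← op (lev h)
      let o ← op (x j)
      let lo ← op (lev o)
      let c ← op (w h j)
      let pos ← op (decide (0 < c))
      if (← op (lh.isSome && lo.isNone && pos)) then
        let pj ← op (p j)
        let q ← op (c / pj)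
        let a ← op (ratio h)
        let r ← op (a / q)
        minOpt acc (some r)
      else pure acc) acc) none

/-- `α₂`: the factor at which agents outside the hierarchy stop being price-envied up to one good
by the least spender. It is `∞` when the least spender spends nothing. -/
def alphaTwo {n m : ℕ} (A : List (Fin n)) (x : Fin m → Fin n) (p : Fin m → ℝ)
    (lev : Fin n → Option ℕ) (si : ℝ) : Timed (Option ℝ) := do
  let top ← A.foldlM (fun (acc : ℝ) k => do
    let lk ← op (lev k)
    if (← op lk.isNone) then
      let sk ← spending x p k
      let least ← (List.finRange m).foldlM (fun (b : Option ℝ) j => do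
        let o ← op (x j)
        if (← op (decide (o = k))) then
          let pj ← op (p j)
          let rest ← op (sk - pj)
          minOpt b (some rest)
        else pure b) none
      match least with
      | none => pure acc
      | some r => maxReal acc r
    else pure acc) 0
  if (← op (decide (si = 0))) then pure none
  else
    let r ← op (top / si)
    pure (some r)

/-- `α₃`: the least power of `1 + ε` above `p(x_h) / p(x_i)`, where `i` is the least spender and `h`
is a least spender outside the hierarchy. It is `∞` when the least spender spends nothing. -/
def alphaThree {n m : ℕ} (ε : ℝ) (A : List (Fin n)) (x : Fin m → Fin n) (p : Fin m → ℝ)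
    (lev : Fin n → Option ℕ) (si : ℝ) : Timed (Option ℝ) := do
  let out ← A.foldlM (fun (acc : Option ℝ) k => do
    let lk ← op (lev k)
    if (← op lk.isNone) then
      let sk ← spending x p k
      minOpt acc (some sk)
    else pure acc) none
  if (← op (decide (si = 0))) then pure none
  else
    match out with
    | none => pure none
    | some s => do
        let r ← op (s / si)
        let b ← op (1 + ε)
        let a ← powSearch b (fun y => r < y)
        pure (some a)

/-- Phase 3: raise the prices of the goods owned by the hierarchy by `α = min (α₁, α₂, α₃)`, and
stop if `α = α₂`. -/
def priceRise {n m : ℕ} (w : Fin n → Fin m → ℝ) (ε : ℝ) (A : List (Fin n)) (x : Fin m → Fin n)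
    (p : Fin m → ℝ) (ratio : Fin n → ℝ) (lev : Fin n → Option ℕ) (si : ℝ) :
    Timed (Action n m) := do
  let a1 ← alphaOne w A x p ratio lev
  let a2 ← alphaTwo A x p lev si
  let a3 ← alphaThree ε A x p lev si
  let a12 ← minOpt a1 a2
  let a123 ← minOpt a12 a3
  match a123 with
  | none => pure (Action.finish p)
  | some α => do
      let q ← tabulate fun j => do
        let o ← op (x j)
        let lo ← op (lev o)
        let pj ← op (p j)
        if (← op lo.isSome) then op (α * pj) else pure pj
      if (← op (decide (a2 = some α))) then pure (Action.finish q) else pure (Action.raise q)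

/-- One pass through the main loop: stop if `(x, p)` is `3ε`-pEF1; otherwise do a Phase 2 swap
if there is an `ε`-path-violator in the hierarchy of the least spender, and a Phase 3 price-rise if
there is none. -/
def pass {n m : ℕ} (w : Fin n → Fin m → ℝ) (ε : ℝ) (A : List (Fin n)) (x : Fin m → Fin n)
    (p : Fin m → ℝ) : Timed (Action n m) := do
  let δ ← op (3 * ε)
  let done ← isPEF1 δ A x p
  let least ← leastSpender A x p
  match done, least with
  | true, _ => pure (Action.finish p)
  | false, none => pure (Action.finish p)
  | false, some (i, si) => do
      let ratio ← mbbRatios w p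
      let mbb ← mbbTable w p ratio
      let lev ← buildHierarchy A x mbb i
      let swaps ← firstSwaps ε A x p mbb lev si
      if (← op swaps.isEmpty) then priceRise w ε A x p ratio lev si
      else pure (Action.swap swaps)

/-- Phase 1, for one good: the agents in `A` with the highest value for it. -/
def maximizers {n m : ℕ} (w : Fin n → Fin m → ℝ) (A : List (Fin n)) (j : Fin m) :
    Timed (List (Fin n)) := do
  let top ← A.foldlM (fun (a : ℝ) k => do
    let c ← op (w k j)
    maxReal a c) 0
  A.foldlM (fun (acc : List (Fin n)) k => do
    let c ← op (w k j)
    if (← op (decide (c = top))) then op (k :: acc) else pure acc) []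

/-- The data with which the main loop starts. -/
structure Setup (n m : ℕ) where
  val : Fin n → Fin m → ℝ
  agents : List (Fin n)
  best : Fin m → List (Fin n)

/-- Obtain the input, restrict to the agents of a maximum matching, find the admissible owners of
every good in Phase 1. -/
def setup {n m : ℕ} (input : Timed (Fin n → Fin m → ℝ)) : Timed (Setup n m) := do
  let w ← input
  let A ← matchedAgents w
  let best ← tabulate fun j => maximizers w A j
  pure ⟨w, A, best⟩

/-- The prices at the end of Phase 1. -/
def initPrices {n m : ℕ} (w : Fin n → Fin m → ℝ) (x : Fin m → Fin n) : Timed (Fin m → ℝ) :=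
  tabulate fun j => do
    let o ← op (x j)
    op (w o j)

/-- Configurations of the algorithm. -/
inductive Config (n m : ℕ) where
  | running (x : Fin m → Fin n) (p : Fin m → ℝ)
  | halted (x : Fin m → Fin n) (p : Fin m → ℝ)

/-- `Step w ε A c c' t`: the algorithm can go from `c` to `c'` in one pass through the main loop,
in time `t ≥ 1`. The choice among the `ε`-path-violators and alternating paths at the lowest level
is free. -/
inductive Step {n m : ℕ} (w : Fin n → Fin m → ℝ) (ε : ℝ) (A : List (Fin n)) :
    Config n m → Config n m → ℕ → Prop
  | finish (x : Fin m → Fin n) (p q : Fin m → ℝ)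
      (h : (pass w ε A x p).val = Action.finish q) :
      Step w ε A (Config.running x p) (Config.halted x q) ((pass w ε A x p).time)
  | swap (x : Fin m → Fin n) (p : Fin m → ℝ) (l : List (Fin n × Fin m)) (k : Fin n) (j : Fin m)
      (h : (pass w ε A x p).val = Action.swap l) (hl : (k, j) ∈ l) :
      Step w ε A (Config.running x p) (Config.running (Function.update x j k) p)
        ((pass w ε A x p).time + 1)
  | raise (x : Fin m → Fin n) (p q : Fin m → ℝ)
      (h : (pass w ε A x p).val = Action.raise q) :
      Step w ε A (Config.running x p) (Config.running x q) ((pass w ε A x p).time)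

/-- `Exec ε input c t`: some execution of the algorithm with parameter `ε` on the given input is in
configuration `c` after time `t`. In Phase 1 the choice among the agents with the highest value
for a good is free. -/
inductive Exec {n m : ℕ} (ε : ℝ) (input : Timed (Fin n → Fin m → ℝ)) : Config n m → ℕ → Prop
  | start (x : Fin m → Fin n) (h : ∀ j, x j ∈ (setup input).val.best j) :
      Exec ε input (Config.running x (initPrices (setup input).val.val x).val)
        ((setup input).time + m + (initPrices (setup input).val.val x).time)
  | step (c c' : Config n m) (t t' : ℕ) (h : Exec ε input c t)
      (hs : Step (setup input).val.val ε (setup input).val.agents c c' t') :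
      Exec ε input c' (t + t')

/-- The algorithm, with parameter `ε` and on the given input, always halts within time `T`, and
every allocation that it can return satisfies `good`: an execution exists, no execution ever uses
more time than `T`, no execution gets stuck before it halts, and what is returned is good. Since
every step takes time at least one, the time bound excludes infinite executions. -/
def AlgFinds {n m : ℕ} (ε : ℝ) (input : Timed (Fin n → Fin m → ℝ)) (T : ℝ)
    (good : (Fin m → Fin n) → Prop) : Prop :=
  (∃ c t, Exec ε input c t) ∧
  (∀ c t, Exec ε input c t → (t : ℝ) ≤ T) ∧
  (∀ x p t, Exec ε input (Config.running x p) t →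
    ∃ c' t', Step (setup input).val.val ε (setup input).val.agents (Config.running x p) c' t') ∧
  (∀ x p t, Exec ε input (Config.halted x p) t → good x)

/-- The computation of the `ε`-rounded version from the original instance. -/
def roundInstance {n m : ℕ} (ε : ℝ) (v : Fin n → Fin m → ℕ) : Timed (Fin n → Fin m → ℝ) := do
  let b ← op (1 + ε)
  tabulate fun i => tabulate fun j => do
    let a ← op (realVal v i j)
    if (← op (decide (0 < a))) then powSearch b (fun y => a ≤ y) else op 0

/-- The value of a four-variable polynomial at `(m, n, 1/ε, ln v_max)`. -/
def boundAt {n m : ℕ} (P : MvPolynomial (Fin 4) ℝ) (ε : ℝ) (v : Fin n → Fin m → ℕ) : ℝ :=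
  MvPolynomial.eval ![(m : ℝ), (n : ℝ), 1 / ε, Real.log (vmax v : ℝ)] P

end FairDivision

end

noncomputable section

namespace FairDivision

/-! ## Values and running times of timed programs -/

/-! Quality of the result. Throughout the run every good has maximum bang per buck for its owner. So
for a matched agent the rounded values are a fixed multiple of the prices on its own bundle and at
most that multiple elsewhere (`IsFinal.ratio`). Price-envy bounds thus become envy bounds. A
dominating allocation would have to cost more than the total price of all goods
(`IsFinal.approxPO`). Rounding loses one factor `1 + ε`, and `(1 + 3ε)(1 + ε) ≤ 1 + 7ε`. An
unmatched agent lies in a set of agents that value together no more goods than the set has matched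
agents. This forces it to value at most one good of each final bundle (`IsFinal.unmatched`).

Bounding the least spending. Let `N` be such that `(1 + ε) ^ N` bounds both the values and `m`. Call
an agent fresh if its goods still have prices at most `(1 + ε) ^ N`, and tame if its spending
without some good is at most `(1 + ε) ^ 2` times the least spending. Every agent is fresh or tame,
with at most one exception (`Inv`). The exception is an agent that has just received a good in Phase
2; the next transfer takes a good from it and makes it tame again (`Inv.swap`). A price-rise touches
only the hierarchy, whose agents are tame because no transfer is possible, and the choice of `α₃`
keeps them tame (`IsRise.inv_raised`). While the loop continues with no exceptional agent, some
agent violates `3ε`-pEF1. It is not tame since `(1 + ε) ^ 2 ≤ 1 + 3ε`, so it is fresh and spends at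
most `m (1 + ε) ^ N`. Hence the least spending never exceeds `(1 + ε) ^ (2N)` during the loop
(`Inv.least_le`), however large the prices of other bundles become.

Termination. For positive least spending `s`, three quantities decrease lexicographically: the
number of powers of `1 + ε` between `s` and its bound, the number of goods that agents below the
next power may still receive, and a potential made of breadth-first levels. A transfer to another
agent than the least spender lowers the last one: levels never fall, and if they all stay, a good
moves one level down. A transfer to the least spender, or a price-rise, lowers one of the first two.
The price-rise does so because its factor is an integer power of `1 + ε` above `1` unless the
algorithm stops (`IsRise.factor_eq_pow`). For `s = 0` the number of empty bundles comes first;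
between two decreases the hierarchy grows, and then a chain of transfers brings a good to the least
spender. Some factor is always finite, by Hall's condition for the matched agents
(`IsRise.factors_ne_none`).

Time. Each pass costs polynomially many operations in `n`, `m`, `N`; the search for `α₃` visits at
most `2N + 2` powers. Since `log (1 + ε) ≥ ε / 2`, an `N` quadratic in `m + n + 1/ε + ln v_max`
suffices (`natCast_le_pow`). -/

@[simp] theorem Timed.val_pure {α : Type} (a : α) : (pure a : Timed α).val = a := (rfl)

@[simp] theorem Timed.time_pure {α : Type} (a : α) : (pure a : Timed α).time = 0 := (rfl)

@[simp] theorem Timed.val_bind {α β : Type} (c : Timed α) (f : α → Timed β) :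
    (c >>= f).val = (f c.val).val := (rfl)

@[simp] theorem Timed.time_bind {α β : Type} (c : Timed α) (f : α → Timed β) :
    (c >>= f).time = c.time + (f c.val).time := (rfl)

@[simp] theorem Timed.val_ite {α : Type} (c : Prop) [Decidable c] (a b : Timed α) :
    (if c then a else b).val = if c then a.val else b.val := apply_ite _ _ _ _

@[simp] theorem Timed.time_ite {α : Type} (c : Prop) [Decidable c] (a b : Timed α) :
    (if c then a else b).time = if c then a.time else b.time := apply_ite _ _ _ _

@[simp] theorem op_val {α : Type} (a : α) : (op a).val = a := (rfl)

@[simp] theorem op_time {α : Type} (a : α) : (op a).time = 1 := (rfl)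

@[simp] theorem tabulate_val {ι β : Type} [Fintype ι] (f : ι → Timed β) :
    (tabulate f).val = fun i => (f i).val := (rfl)

theorem tabulate_time_le {ι β : Type} [Fintype ι] (f : ι → Timed β) (C : ℕ)
    (h : ∀ i, (f i).time ≤ C) : (tabulate f).time ≤ Fintype.card ι * (C + 1) := by
  have : ∑ i, ((f i).time + 1) ≤ ∑ _i : ι, (C + 1) :=
    Finset.sum_le_sum fun i _ => Nat.succ_le_succ (h i)
  simpa [tabulate] using this

@[simp] theorem foldlM_val {α β : Type} (f : β → α → Timed β) (l : List α) (b : β) :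
    (l.foldlM f b).val = l.foldl (fun s a => (f s a).val) b := by
  induction l generalizing b with
  | nil => rfl
  | cons a l ih => simp [List.foldlM_cons, ih]

theorem foldlM_time_le {α β : Type} (f : β → α → Timed β) (l : List α) (b : β) (C : ℕ)
    (h : ∀ s a, (f s a).time ≤ C) : (l.foldlM f b).time ≤ l.length * C := by
  induction l generalizing b with
  | nil => simp
  | cons a l ih =>
    have h1 := h b a
    have h2 := ih (f b a).val
    simp only [List.foldlM_cons, Timed.time_bind, List.length_cons, Nat.succ_mul]
    omega

theorem foldlM_finRange_time_le {β : Type} {m : ℕ} (f : β → Fin m → Timed β) (b : β) (C : ℕ)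
    (h : ∀ s a, (f s a).time ≤ C) : ((List.finRange m).foldlM f b).time ≤ m * C := by
  simpa using foldlM_time_le f (List.finRange m) b C h

theorem foldlM_agents_time_le {n : ℕ} {β : Type} (A : List (Fin n)) (hA : A.length ≤ n)
    (f : β → Fin n → Timed β) (b : β) (C : ℕ)
    (h : ∀ s a, (f s a).time ≤ C) : (A.foldlM f b).time ≤ n * C :=
  (foldlM_time_le f A b C h).trans (Nat.mul_le_mul_right _ hA)

theorem minOpt_time_le (a b : Option ℝ) : (minOpt a b).time ≤ 1 := by
  rcases a with _ | a <;> rcases b with _ | b <;> simp [minOpt]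

theorem maxReal_time_le (a b : ℝ) : (maxReal a b).time ≤ 1 := by
  simp only [maxReal, Timed.time_bind, op_time, op_val, Timed.time_ite, Timed.time_pure]
  split_ifs <;> omega

@[simp] theorem maxReal_val (a b : ℝ) : (maxReal a b).val = max a b := by
  simp only [maxReal, Timed.val_bind, op_val, decide_eq_true_eq, Timed.val_ite, Timed.val_pure]
  split_ifs with h
  · simp [max_eq_right h.le]
  · simp [max_eq_left (not_lt.mp h)]

/-! ### Running time of the matching -/

theorem searchTree_time_le {n m : ℕ} (w : Fin n → Fin m → ℝ) (μ : Fin m → Option (Fin n))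
    (i : Fin n) :
    (searchTree w μ i).time ≤ m * 2 + m * (m * (1 + n * (4 * m + 5) + 1)) := by
  unfold searchTree
  rw [Timed.time_bind]
  refine Nat.add_le_add ((tabulate_time_le _ 1 fun _ => le_rfl).trans (by simp)) ?_
  refine (foldlM_time_le _ _ _ (m * (1 + n * (4 * m + 5) + 1)) ?_).trans (by simp)
  intro par _
  refine (tabulate_time_le _ (1 + n * (4 * m + 5)) ?_).trans (by simp)
  intro j
  rw [Timed.time_bind]
  refine Nat.add_le_add le_rfl ?_
  split
  · simp
  refine foldlM_finRange_time_le _ _ _ ?_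
  intro r k
  have h := foldlM_finRange_time_le (m := m) (fun (b : Bool) j' => do
          let q ← op (par j')
          let o ← op (μ j')
          let e ← op (decide (o = some k))
          op (b || (q.isSome && e))) (decide (k = i)) 4 (by intro s a; simp)
  simp only [Timed.time_bind, op_time, op_val, Timed.time_ite, Timed.time_pure] at h ⊢
  split_ifs <;> omega

theorem flipPath_time_le {n m : ℕ} (par : Fin m → Option (Fin n)) (fuel : ℕ)
    (μ : Fin m → Option (Fin n)) (j : Fin m) :
    (flipPath par fuel μ j).time ≤ fuel * (m * 3 + 2) := by
  induction fuel generalizing μ j with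
  | zero => simp [flipPath]
  | succ fuel ih =>
    rw [flipPath, Timed.time_bind, op_val, op_time]
    rcases par j with _ | k
    · simp [Nat.succ_mul]; omega
    · simp only [Timed.time_bind, op_time, op_val]
      have h := foldlM_finRange_time_le (m := m) (fun (r : Option (Fin m)) j' => do
            let o ← op (μ j')
            if (← op (decide (o = some k))) then op (some j') else pure r) none 3 (by
              intro s a; simp only [Timed.time_bind, op_time, op_val, Timed.time_ite, Timed.time_pure]; split_ifs <;> omega)
      rw [Nat.succ_mul]
      split
      · simp; omega
      · next j' _ =>
        have := ih (Function.update μ j (some k)) j'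
        omega

theorem augment_time_le {n m : ℕ} (w : Fin n → Fin m → ℝ) (μ : Fin m → Option (Fin n))
    (i : Fin n) :
    (augment w μ i).time ≤
      (m * 2 + m * (m * (1 + n * (4 * m + 5) + 1))) + (m * 4 + m * (m * 3 + 2)) := by
  unfold augment
  rw [Timed.time_bind]
  refine Nat.add_le_add (searchTree_time_le w μ i) ?_
  rw [Timed.time_bind]
  refine Nat.add_le_add (foldlM_finRange_time_le _ _ _ ?_) ?_
  · intro s a; simp only [Timed.time_bind, op_time, op_val, Timed.time_ite, Timed.time_pure]; split_ifs <;> omega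
  · split
    · simp
    · exact flipPath_time_le _ _ _ _

theorem matchedAgents_time_le {n m : ℕ} (w : Fin n → Fin m → ℝ) :
    (matchedAgents w).time ≤ (m * 2 +
      n * ((m * 2 + m * (m * (1 + n * (4 * m + 5) + 1))) + (m * 4 + m * (m * 3 + 2)))) +
      n * (m * 3 + 2) := by
  unfold matchedAgents
  rw [Timed.time_bind]
  refine Nat.add_le_add ?_ ?_
  · unfold maxMatching
    rw [Timed.time_bind]
    exact Nat.add_le_add ((tabulate_time_le _ 1 fun _ => le_rfl).trans (by simp))
      (foldlM_finRange_time_le _ _ _ fun s a => augment_time_le w s a)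
  · refine (foldlM_time_le _ _ _ (m * 3 + 2) ?_).trans (by simp)
    intro s k
    rw [Timed.time_bind]
    refine Nat.add_le_add (foldlM_finRange_time_le _ _ _ fun s a => by simp) ?_
    simp only [Timed.time_bind, op_time, op_val, Timed.time_ite, Timed.time_pure]; split_ifs <;> omega

/-! ### Running time of one pass -/

section

variable {n m : ℕ} (w : Fin n → Fin m → ℝ) (ε : ℝ) (A : List (Fin n)) (x : Fin m → Fin n)
  (p : Fin m → ℝ)

theorem spending_time_le (k : Fin n) : (spending x p k).time ≤ m * 4 := by
  refine foldlM_finRange_time_le _ _ _ ?_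
  intro s j
  simp only [Timed.time_bind, op_time, op_val, Timed.time_ite, Timed.time_pure]
  split_ifs <;> omega

theorem isPEF1_time_le (hA : A.length ≤ n) (δ : ℝ) :
    (isPEF1 δ A x p).time ≤ 1 + n * (m * 4 + (1 + n * (m * 4 + (m * 6 + 1)))) := by
  unfold isPEF1
  rw [Timed.time_bind]
  refine Nat.add_le_add le_rfl (foldlM_agents_time_le A hA _ _ _ fun ok i => ?_)
  rw [Timed.time_bind]
  refine Nat.add_le_add (spending_time_le x p i) ?_
  rw [Timed.time_bind]
  refine Nat.add_le_add le_rfl (foldlM_agents_time_le A hA _ _ _ fun ok k => ?_)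
  rw [Timed.time_bind]
  refine Nat.add_le_add (spending_time_le x p k) ?_
  rw [Timed.time_bind]
  refine Nat.add_le_add (foldlM_finRange_time_le _ _ _ ?_) le_rfl
  intro s j
  simp only [Timed.time_bind, op_time, op_val, Timed.time_ite, Timed.time_pure]
  split_ifs <;> omega

theorem leastSpender_time_le (hA : A.length ≤ n) :
    (leastSpender A x p).time ≤ n * (m * 4 + 2) := by
  refine foldlM_agents_time_le A hA _ _ _ fun r k => ?_
  rw [Timed.time_bind]
  refine Nat.add_le_add (spending_time_le x p k) ?_
  split
  · simp
  · simp only [Timed.time_bind, op_time, op_val, Timed.time_ite, Timed.time_pure]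
    split_ifs <;> omega

theorem mbbRatios_time_le : (mbbRatios w p).time ≤ n * (m * 4 + 1) := by
  refine (tabulate_time_le _ (m * 4) fun h => ?_).trans (by simp)
  refine foldlM_finRange_time_le _ _ _ fun s j => ?_
  have := maxReal_time_le s (w h j / p j)
  simp only [Timed.time_bind, op_time, op_val]
  omega

theorem mbbTable_time_le (ratio : Fin n → ℝ) : (mbbTable w p ratio).time ≤ n * (m * 6 + 1) := by
  refine (tabulate_time_le _ (m * 6) fun h => ?_).trans (by simp)
  refine (tabulate_time_le _ 5 fun j => ?_).trans (by simp)
  simp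

theorem buildHierarchy_time_le (hA : A.length ≤ n) (mbb : Fin n → Fin m → Bool) (i : Fin n) :
    (buildHierarchy A x mbb i).time ≤
      n * 3 + n * (n * (1 + (m * (2 + n * 4) + 2) + 1)) := by
  unfold buildHierarchy
  rw [Timed.time_bind]
  refine Nat.add_le_add ((tabulate_time_le _ 2 fun k => ?_).trans (by simp)) ?_
  · simp only [Timed.time_bind, op_time, op_val, Timed.time_ite]
    split_ifs <;> omega
  refine (foldlM_time_le _ _ _ (n * (1 + (m * (2 + n * 4) + 2) + 1)) fun lev ℓ => ?_).trans
    (by simp)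
  refine (tabulate_time_le _ (1 + (m * (2 + n * 4) + 2)) fun k => ?_).trans (by simp)
  rw [Timed.time_bind]
  refine Nat.add_le_add le_rfl ?_
  split
  · simp
  rw [Timed.time_bind]
  refine Nat.add_le_add (foldlM_finRange_time_le _ _ _ fun s j => ?_) ?_
  · rw [Timed.time_bind, Timed.time_bind, ← add_assoc]
    exact Nat.add_le_add le_rfl (foldlM_agents_time_le A hA _ _ _ fun s k => by simp)
  · simp only [Timed.time_bind, op_time, op_val, Timed.time_ite, Timed.time_pure]
    split_ifs <;> omega

theorem swapsAt_time_le (hA : A.length ≤ n) (mbb : Fin n → Fin m → Bool) (lev : Fin n → Option ℕ)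
    (si : ℝ) (ℓ : ℕ) : (swapsAt ε A x p mbb lev si ℓ).time ≤ 3 + n * (m * (m * 4 + 11)) := by
  have : (3 : ℕ) + n * (m * (m * 4 + 11)) = 1 + (1 + (1 + n * (m * (m * 4 + 11)))) := by ring
  unfold swapsAt
  rw [this, Timed.time_bind]
  refine Nat.add_le_add le_rfl ?_
  rw [Timed.time_bind]
  refine Nat.add_le_add le_rfl ?_
  rw [Timed.time_bind]
  refine Nat.add_le_add le_rfl ?_
  refine foldlM_agents_time_le A hA _ _ _ fun s k => ?_
  refine foldlM_finRange_time_le _ _ _ fun s j => ?_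
  have := spending_time_le x p (x j)
  simp only [Timed.time_bind, op_time, op_val, Timed.time_ite, Timed.time_pure]
  split_ifs <;> omega

theorem firstSwaps_time_le (hA : A.length ≤ n) (mbb : Fin n → Fin m → Bool)
    (lev : Fin n → Option ℕ) (si : ℝ) :
    (firstSwaps ε A x p mbb lev si).time ≤ n * (1 + (3 + n * (m * (m * 4 + 11)))) := by
  refine (foldlM_time_le _ _ _ (1 + (3 + n * (m * (m * 4 + 11)))) fun acc ℓ => ?_).trans
    (by simp)
  rw [Timed.time_bind]
  refine Nat.add_le_add le_rfl ?_
  split_ifs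
  · exact swapsAt_time_le ε A x p hA mbb lev si ℓ
  · simp

theorem alphaOne_time_le (hA : A.length ≤ n) (ratio : Fin n → ℝ) (lev : Fin n → Option ℕ) :
    (alphaOne w A x p ratio lev).time ≤ n * (m * 11) := by
  refine foldlM_agents_time_le A hA _ _ _ fun s k => ?_
  refine foldlM_finRange_time_le _ _ _ fun s j => ?_
  have := minOpt_time_le s (some (ratio k / (w k j / p j)))
  simp only [Timed.time_bind, op_time, op_val, Timed.time_ite, Timed.time_pure]
  split_ifs <;> omega

theorem alphaTwo_time_le (hA : A.length ≤ n) (lev : Fin n → Option ℕ) (si : ℝ) :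
    (alphaTwo A x p lev si).time ≤ n * (m * 4 + m * 5 + 3) + 2 := by
  unfold alphaTwo
  rw [Timed.time_bind]
  refine Nat.add_le_add (foldlM_agents_time_le A hA _ _ _ fun s k => ?_) ?_
  · rw [Timed.time_bind, Timed.time_bind]
    simp only [op_val, op_time, Timed.time_ite]
    split_ifs
    · rw [Timed.time_bind, Timed.time_bind]
      have h1 := spending_time_le x p k
      have h2 := foldlM_finRange_time_le (m := m) (fun (b : Option ℝ) j => do
        let o ← op (x j)
        if (← op (decide (o = k))) then
          let pj ← op (p j)
          let rest ← op ((spending x p k).val - pj)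
          minOpt b (some rest)
        else pure b) none 5 (by
          intro b j
          have := minOpt_time_le b (some ((spending x p k).val - p j))
          simp only [Timed.time_bind, op_time, op_val, Timed.time_ite, Timed.time_pure]
          split_ifs <;> omega)
      split
      · rw [Timed.time_pure]; omega
      · next r _ =>
        have h3 := maxReal_time_le s r
        omega
    · simp only [Timed.time_pure]; omega
  · simp only [Timed.time_bind, op_time, op_val, Timed.time_ite, Timed.time_pure]
    split_ifs <;> omega

theorem priceRise_time_le (hA : A.length ≤ n) (ratio : Fin n → ℝ) (lev : Fin n → Option ℕ)
    (si : ℝ) : (priceRise w ε A x p ratio lev si).time ≤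
      n * (m * 11) + (n * (m * 4 + m * 5 + 3) + 2) + (alphaThree ε A x p lev si).time
        + (2 + m * 6 + 1) := by
  have h1 := alphaOne_time_le w A x p hA ratio lev
  have h2 := alphaTwo_time_le A x p hA lev si
  have h3 := fun a b => minOpt_time_le a b
  unfold priceRise
  simp only [Timed.time_bind]
  have h4 := h3 (alphaOne w A x p ratio lev).val (alphaTwo A x p lev si).val
  have h5 := h3 (minOpt (alphaOne w A x p ratio lev).val (alphaTwo A x p lev si).val).val
    (alphaThree ε A x p lev si).val
  split
  · rw [Timed.time_pure]; omega
  · next α _ =>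
    rw [Timed.time_bind]
    have h6 := tabulate_time_le (fun j : Fin m => do
        let o ← op (x j)
        let lo ← op (lev o)
        let pj ← op (p j)
        if (← op lo.isSome) then op (α * pj) else pure pj) 5 (by
          intro j
          simp only [Timed.time_bind, op_time, op_val, Timed.time_ite, Timed.time_pure]
          split_ifs <;> omega)
    rw [Fintype.card_fin] at h6
    simp only [Timed.time_bind, op_time]
    split_ifs <;> simp only [Timed.time_pure] <;> omega

end

theorem setup_time_le {n m : ℕ} (input : Timed (Fin n → Fin m → ℝ))
    (hA : (matchedAgents input.val).val.length ≤ n) :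
    (setup input).time ≤ input.time + (matchedAgents input.val).time
      + m * (n * 2 + n * 3 + 1) := by
  unfold setup
  simp only [Timed.time_bind, Timed.time_pure]
  have := tabulate_time_le (fun j : Fin m => maximizers input.val (matchedAgents input.val).val j)
    (n * 2 + n * 3) (by
      intro j
      unfold maximizers
      rw [Timed.time_bind]
      refine Nat.add_le_add (foldlM_agents_time_le _ hA _ _ _ fun a k => ?_)
        (foldlM_agents_time_le _ hA _ _ _ fun a k => ?_)
      · have := maxReal_time_le a (input.val k j)
        simp only [Timed.time_bind, op_time, op_val]
        omega
      · simp only [Timed.time_bind, op_time, op_val, Timed.time_ite, Timed.time_pure]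
        split_ifs <;> omega)
  rw [Fintype.card_fin] at this
  omega

theorem initPrices_time {n m : ℕ} (w : Fin n → Fin m → ℝ) (x : Fin m → Fin n) :
    (initPrices w x).time ≤ m * 3 := by
  refine (tabulate_time_le _ 2 fun j => ?_).trans (by simp)
  simp

/-! ## Correctness of the matching -/

theorem foldl_or_eq_true {α : Type} (f : α → Bool) (l : List α) (b : Bool) :
    l.foldl (fun s a => s || f a) b = true ↔ b = true ∨ ∃ a ∈ l, f a = true := by
  induction l generalizing b with
  | nil => simp
  | cons a l ih => simp [ih, or_assoc]

/-- A loop that remembers elements with a property. -/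
theorem foldl_select {α : Type} (step : Option α → α → Option α) (P : α → Prop)
    (h₁ : ∀ r a, step r a = r ∨ step r a = some a ∧ P a)
    (h₂ : ∀ r a, (P a ∨ r.isSome) → (step r a).isSome) (l : List α) (r : Option α) :
    (l.foldl step r = r ∨ ∃ a ∈ l, l.foldl step r = some a ∧ P a) ∧
      ((r.isSome ∨ ∃ a ∈ l, P a) → (l.foldl step r).isSome) := by
  induction l generalizing r with
  | nil => simp
  | cons a l ih =>
    obtain ⟨i₁, i₂⟩ := ih (step r a)
    rw [List.foldl_cons]
    refine ⟨?_, ?_⟩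
    · rcases i₁ with e | ⟨c, hc, e, hP⟩
      · rcases h₁ r a with e' | ⟨e', hP⟩
        · exact Or.inl (e.trans e')
        · exact Or.inr ⟨a, by simp, e.trans e', hP⟩
      · exact Or.inr ⟨c, by simp [hc], e, hP⟩
    · rintro (h | ⟨c, hc, hP⟩)
      · exact i₂ (Or.inl (h₂ r a (Or.inr h)))
      · rcases List.mem_cons.mp hc with rfl | hc
        · exact i₂ (Or.inl (h₂ r c (Or.inl hP)))
        · exact i₂ (Or.inr ⟨c, hc, hP⟩)

/-! ### Breadth-first search, augmenting paths and tight sets of agents. -/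

section

variable {n m : ℕ} {w : Fin n → Fin m → ℝ}

/-- The agents that the search from `i` has reached. -/
def Reached (μ : Fin m → Option (Fin n)) (i : Fin n) (par : Fin m → Option (Fin n))
    (k : Fin n) : Prop :=
  k = i ∨ ∃ j, (par j).isSome ∧ μ j = some k

/-- One round of the search. -/
def searchRound (w : Fin n → Fin m → ℝ) (μ : Fin m → Option (Fin n)) (i : Fin n)
    (par : Fin m → Option (Fin n)) (j : Fin m) : Option (Fin n) :=
  match par j with
  | some k => some k
  | none => (List.finRange n).foldl (fun (r : Option (Fin n)) k =>
      if (r.isNone && (List.finRange m).foldl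
        (fun b j' => b || ((par j').isSome && decide (μ j' = some k))) (decide (k = i)) &&
        decide (0 < w k j)) = true then some k else r) none

theorem searchTree_val (μ : Fin m → Option (Fin n)) (i : Fin n) :
    (searchTree w μ i).val = (searchRound w μ i)^[m] fun _ => none := by
  have : ∀ (l : List ℕ) (par : Fin m → Option (Fin n)),
      l.foldl (fun par _ => searchRound w μ i par) par = (searchRound w μ i)^[l.length] par := by
    intro l
    induction l with
    | nil => simp
    | cons a l ih => intro par; simp [ih]
  have h := this (List.range m) fun _ => none
  rw [List.length_range] at h
  rw [← h]
  unfold searchTree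
  simp only [Timed.val_bind, foldlM_val, tabulate_val, op_val]
  congr 1
  funext par _ j
  unfold searchRound
  rcases par j with _ | k
  · simp only [foldlM_val, Timed.val_bind, op_val, Timed.val_ite, Timed.val_pure]
  · rfl

theorem searchRound_of_some {μ : Fin m → Option (Fin n)} {i : Fin n}
    {par : Fin m → Option (Fin n)} {j : Fin m} {k : Fin n} (h : par j = some k) :
    searchRound w μ i par j = some k := by
  simp [searchRound, h]

theorem searchRound_of_none {μ : Fin m → Option (Fin n)} {i : Fin n}
    {par : Fin m → Option (Fin n)} {j : Fin m} (h : par j = none) :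
    (∀ k, searchRound w μ i par j = some k → Reached μ i par k ∧ 0 < w k j) ∧
      (searchRound w μ i par j = none → ∀ k, Reached μ i par k → ¬ 0 < w k j) := by
  have hr : ∀ k, (List.finRange m).foldl
        (fun b j' => b || ((par j').isSome && decide (μ j' = some k))) (decide (k = i)) = true ↔
      Reached μ i par k := by
    intro k
    rw [foldl_or_eq_true]
    simp [Reached]
  have hs := foldl_select (fun (r : Option (Fin n)) k =>
      if (r.isNone && (List.finRange m).foldl
        (fun b j' => b || ((par j').isSome && decide (μ j' = some k))) (decide (k = i)) &&
        decide (0 < w k j)) = true then some k else r) (fun k => Reached μ i par k ∧ 0 < w k j)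
      (by
        intro r k
        split_ifs with hc
        · right
          rw [Bool.and_eq_true, Bool.and_eq_true, hr, decide_eq_true_eq] at hc
          exact ⟨rfl, hc.1.2, hc.2⟩
        · left; rfl)
      (by
        intro r k hk
        split_ifs with hc
        · rfl
        · rcases hk with hk | hk
          · rw [Bool.and_eq_true, Bool.and_eq_true, hr, decide_eq_true_eq] at hc
            rcases r with _ | r
            · exact absurd ⟨⟨rfl, hk.1⟩, hk.2⟩ hc
            · rfl
          · exact hk) (List.finRange n) none
  have he : searchRound w μ i par j = (List.finRange n).foldl (fun (r : Option (Fin n)) k =>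
      if (r.isNone && (List.finRange m).foldl
        (fun b j' => b || ((par j').isSome && decide (μ j' = some k))) (decide (k = i)) &&
        decide (0 < w k j)) = true then some k else r) none := by
    simp [searchRound, h]
  rw [← he] at hs
  refine ⟨fun k hk => ?_, fun hn k hk hw => ?_⟩
  · rcases hs.1 with e | ⟨a, _, e, ha⟩
    · rw [hk] at e; cases e
    · rw [hk] at e; cases e; exact ha
  · have := hs.2 (Or.inr ⟨k, List.mem_finRange k, hk, hw⟩)
    rw [hn] at this
    cases this

/-- The search tree is well-founded: its entries are ranked by the round that found them. -/
theorem searchTree_rank (μ : Fin m → Option (Fin n)) (i : Fin n) :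
    ∃ rank : Fin m → ℕ, ∀ j k, (searchTree w μ i).val j = some k →
      rank j ≤ m ∧ 1 ≤ rank j ∧ 0 < w k j ∧
        (k = i ∨ ∃ b, rank b < rank j ∧ ((searchTree w μ i).val b).isSome ∧ μ b = some k) := by
  rw [searchTree_val]
  have : ∀ r : ℕ, ∃ rank : Fin m → ℕ, ∀ j k, (searchRound w μ i)^[r] (fun _ => none) j = some k →
      rank j ≤ r ∧ 1 ≤ rank j ∧ 0 < w k j ∧
        (k = i ∨ ∃ b, rank b < rank j ∧ ((searchRound w μ i)^[r] (fun _ => none) b).isSome ∧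
          μ b = some k) := by
    intro r
    induction r with
    | zero => exact ⟨fun _ => 0, by simp⟩
    | succ r ih =>
      obtain ⟨rank, hrank⟩ := ih
      rw [Function.iterate_succ_apply']
      set par := (searchRound w μ i)^[r] (fun _ => none) with hpar
      -- Goods found earlier keep their rank, and those found now get `r + 1`, above every earlier
      -- rank. The agent that a new good points to was reached by an earlier good.
      refine ⟨fun j => if (par j).isSome then rank j else r + 1, fun j k hjk => ?_⟩
      rcases hp : par j with _ | k'
      · obtain ⟨h1, h2⟩ := (searchRound_of_none (w := w) (μ := μ) (i := i) hp).1 k hjk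
        simp only [hp, Option.isSome_none, Bool.false_eq_true, if_false, le_refl, true_and]
        refine ⟨by omega, h2, ?_⟩
        rcases h1 with h1 | ⟨b, hb, e⟩
        · exact Or.inl h1
        · refine Or.inr ⟨b, ?_, ?_, e⟩
          · rw [if_pos hb]
            obtain ⟨c, hc⟩ := Option.isSome_iff_exists.mp hb
            have := (hrank b c hc).1
            omega
          · obtain ⟨c, hc⟩ := Option.isSome_iff_exists.mp hb
            rw [searchRound_of_some hc]; rfl
      · rw [searchRound_of_some hp] at hjk
        rw [hjk] at hp
        obtain ⟨h1, h2, h3, h4⟩ := hrank j k hp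
        simp only [hp, Option.isSome_some, if_true]
        refine ⟨by omega, h2, h3, ?_⟩
        rcases h4 with h4 | ⟨b, hb, hbs, e⟩
        · exact Or.inl h4
        · refine Or.inr ⟨b, ?_, ?_, e⟩
          · rw [if_pos hbs]; exact hb
          · obtain ⟨c, hc⟩ := Option.isSome_iff_exists.mp hbs
            rw [searchRound_of_some hc]; rfl
  exact this m

/-- The search stops only when no further good can be reached. -/
theorem searchTree_closed (μ : Fin m → Option (Fin n)) (i : Fin n) (j : Fin m) (k : Fin n)
    (hk : Reached μ i (searchTree w μ i).val k) (hw : 0 < w k j) :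
    ((searchTree w μ i).val j).isSome := by
  classical
  rw [searchTree_val] at hk ⊢
  -- Either the search has become stationary or each round has found a new good, so `m` rounds find
  -- everything or end closed.
  have key : ∀ r : ℕ, (∀ j, (searchRound w μ i)^[r] (fun _ => none) j = none →
        ∀ k, Reached μ i ((searchRound w μ i)^[r] (fun _ => none)) k → ¬ 0 < w k j) ∨
      r ≤ (Finset.univ.filter fun j =>
        ((searchRound w μ i)^[r] (fun _ => none) j).isSome).card := by
    intro r
    induction r with
    | zero => right; simp
    | succ r ih =>
      rw [Function.iterate_succ_apply']
      set par := (searchRound w μ i)^[r] (fun _ => none) with hpar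
      by_cases hcl : ∀ j, par j = none → ∀ k, Reached μ i par k → ¬ 0 < w k j
      · left
        have : searchRound w μ i par = par := by
          funext j
          rcases hp : par j with _ | k'
          · rcases hq : searchRound w μ i par j with _ | k''
            · rfl
            · obtain ⟨h1, h2⟩ := (searchRound_of_none hp).1 k'' hq
              exact absurd h2 (hcl j hp k'' h1)
          · exact searchRound_of_some hp
        rw [this]
        exact hcl
      · right
        have ih := ih.resolve_left hcl
        push Not at hcl
        obtain ⟨j₀, h0, k₀, hk₀, hw₀⟩ := hcl
        refine Nat.succ_le_of_lt (lt_of_le_of_lt ih (Finset.card_lt_card ?_))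
        rw [Finset.ssubset_iff_of_subset]
        · refine ⟨j₀, ?_, by simp [h0]⟩
          rw [Finset.mem_filter]
          refine ⟨Finset.mem_univ _, ?_⟩
          rcases hq : searchRound w μ i par j₀ with _ | k''
          · exact absurd hw₀ ((searchRound_of_none h0).2 hq k₀ hk₀)
          · rfl
        · intro a ha
          rw [Finset.mem_filter] at ha ⊢
          refine ⟨Finset.mem_univ _, ?_⟩
          obtain ⟨c, hc⟩ := Option.isSome_iff_exists.mp ha.2
          rw [searchRound_of_some hc]; rfl
  rcases key m with h | h
  · by_contra hn
    rw [Bool.not_eq_true, Option.isSome_eq_false_iff, Option.isNone_iff_eq_none] at hn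
    exact h j hn k hk hw
  · have : (Finset.univ.filter fun j =>
        ((searchRound w μ i)^[m] (fun _ => none) j).isSome) = Finset.univ := by
      apply Finset.eq_univ_of_card
      exact le_antisymm (Finset.card_le_univ _) (by simpa using h)
    have hj := Finset.mem_univ j
    rw [← this, Finset.mem_filter] at hj
    exact hj.2

/-- The partners in `μ` are distinct and joined by edges. -/
structure IsMatch (w : Fin n → Fin m → ℝ) (μ : Fin m → Option (Fin n)) : Prop where
  inj : ∀ a b k, μ a = some k → μ b = some k → a = b
  pos : ∀ a k, μ a = some k → 0 < w k a

/-- All goods that an agent of `R` values are matched to agents of `R`. -/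
def Tight (w : Fin n → Fin m → ℝ) (μ : Fin m → Option (Fin n)) (R : Fin n → Prop) : Prop :=
  ∀ a, (∃ k, R k ∧ 0 < w k a) → ∃ k, R k ∧ μ a = some k

/-- Induction along the path, towards lower ranks. In the middle of the flip agent `k` is matched
twice, to `j` and to its former good, so injectivity is only assumed away from the current good and,
separately, among goods of rank at most `rank j`. The path avoids the goods valued by a tight set
`R`: if no agent of `R` values `j`, then its new partner `k` is outside `R`, and the former good of
`k` cannot be valued in `R` either. -/
theorem flipPath_spec (i : Fin n) (par : Fin m → Option (Fin n)) (rank : Fin m → ℕ)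
    (hpar : ∀ a k, par a = some k → 0 < w k a ∧ 1 ≤ rank a) (fuel : ℕ) :
    ∀ (μ : Fin m → Option (Fin n)) (j : Fin m), rank j ≤ fuel → (par j).isSome →
      (∀ a k, par a = some k → rank a ≤ rank j →
        k = i ∨ ∃ b, rank b < rank a ∧ (par b).isSome ∧ μ b = some k) →
      (∀ a b k, a ≠ j → b ≠ j → μ a = some k → μ b = some k → a = b) →
      (∀ a b k, rank a ≤ rank j → rank b ≤ rank j → μ a = some k → μ b = some k → a = b) →
      (∀ a, μ a ≠ some i) → (∀ a k, μ a = some k → 0 < w k a) →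
      IsMatch w (flipPath par fuel μ j).val ∧
      (∀ k, (∃ a, (flipPath par fuel μ j).val a = some k) ↔
        k = i ∨ ∃ a, a ≠ j ∧ μ a = some k) ∧
      ∀ R : Fin n → Prop, (∀ a, (∃ k, R k ∧ 0 < w k a) → a ≠ j → ∃ k, R k ∧ μ a = some k) →
        (¬ ∃ k, R k ∧ 0 < w k j) →
        ∀ a, (∃ k, R k ∧ 0 < w k a) → (flipPath par fuel μ j).val a = μ a := by
  induction fuel with
  | zero =>
    intro μ j hr hj
    obtain ⟨k, hk⟩ := Option.isSome_iff_exists.mp hj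
    have := (hpar j k hk).2
    omega
  | succ fuel ih =>
    intro μ j hr hj htree hinj hlow hi hpos
    obtain ⟨k, hk⟩ := Option.isSome_iff_exists.mp hj
    have hs := foldl_select (fun (r : Option (Fin m)) j' =>
        if decide (μ j' = some k) = true then some j' else r) (fun j' => μ j' = some k)
        (by
          intro r a
          by_cases h : μ a = some k <;> simp [h])
        (by
          intro r a h
          by_cases h' : μ a = some k
          · simp [h']
          · simpa [h'] using h) (List.finRange m) none
    obtain ⟨prev, hprev⟩ : ∃ prev, prev = (List.finRange m).foldl
        (fun (r : Option (Fin m)) j' => if decide (μ j' = some k) = true then some j' else r)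
        none := ⟨_, rfl⟩
    rw [← hprev] at hs
    have hval : (flipPath par (fuel + 1) μ j).val =
        prev.elim (Function.update μ j (some k)) fun j' =>
          (flipPath par fuel (Function.update μ j (some k)) j').val := by
      rw [flipPath, Timed.val_bind, op_val, hk]
      simp only [Timed.val_bind, foldlM_val, op_val, Timed.val_ite, Timed.val_pure]
      rw [← hprev]
      rcases prev with _ | j' <;> rfl
    have hwk : 0 < w k j := (hpar j k hk).1
    have hpos' : ∀ a c, Function.update μ j (some k) a = some c → 0 < w c a := by
      intro a c h
      by_cases ha : a = j
      · subst ha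
        rw [Function.update_self] at h
        cases h
        exact hwk
      · rw [Function.update_of_ne ha] at h
        exact hpos a c h
    rcases hp : prev with _ | j'
    · rw [hp] at hval hs
      rw [hval, Option.elim]
      have hno : ∀ a, μ a ≠ some k := by
        intro a ha
        have := hs.2 (Or.inr ⟨a, List.mem_finRange a, ha⟩)
        cases this
      have hki : k = i := by
        rcases htree j k hk le_rfl with h | ⟨b, _, _, hb⟩
        · exact h
        · exact absurd hb (hno b)
      refine ⟨⟨?_, hpos'⟩, ?_, ?_⟩
      · intro a b c ha hb
        by_cases haj : a = j
        · by_cases hbj : b = j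
          · rw [haj, hbj]
          · rw [haj, Function.update_self] at ha
            rw [Function.update_of_ne hbj] at hb
            cases ha
            exact absurd hb (hno b)
        · rw [Function.update_of_ne haj] at ha
          by_cases hbj : b = j
          · rw [hbj, Function.update_self] at hb
            cases hb
            exact absurd ha (hno a)
          · rw [Function.update_of_ne hbj] at hb
            exact hinj a b c haj hbj ha hb
      · intro c
        constructor
        · rintro ⟨a, ha⟩
          by_cases haj : a = j
          · rw [haj, Function.update_self] at ha
            cases ha
            exact Or.inl hki
          · rw [Function.update_of_ne haj] at ha
            exact Or.inr ⟨a, haj, ha⟩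
        · rintro (rfl | ⟨a, haj, ha⟩)
          · exact ⟨j, by rw [Function.update_self, hki]⟩
          · exact ⟨a, by rw [Function.update_of_ne haj, ha]⟩
      · intro R _ hRj a ha
        exact Function.update_of_ne (by rintro rfl; exact hRj ha) _ _
    · rw [hp] at hval hs
      rw [hval, Option.elim]
      have hj' : μ j' = some k := by
        rcases hs.1 with h | ⟨a, _, h, ha⟩
        · cases h
        · cases h; exact ha
      have hki : k ≠ i := fun h => hi j' (h ▸ hj')
      obtain ⟨b, hbr, hbs, hb⟩ := (htree j k hk le_rfl).resolve_left hki
      have hbj : b ≠ j := fun h => by subst h; exact lt_irrefl _ hbr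
      -- Injectivity among low ranks is needed here: `j` itself could still carry the label `k` from
      -- the previous flip.
      have hj'j : j' ≠ j := by
        intro h
        have := hlow b j k hbr.le le_rfl hb (h ▸ hj')
        exact hbj this
      have hbj' : b = j' := hinj b j' k hbj hj'j hb hj'
      subst hbj'
      have hup : ∀ a, rank a ≤ rank b → Function.update μ j (some k) a = μ a := by
        intro a ha
        exact Function.update_of_ne (fun e => by subst e; omega) _ _
      obtain ⟨r1, r2, r3⟩ := ih (Function.update μ j (some k)) b (by omega) hbs
        (by
          intro a c hc hab
          rcases htree a c hc (by omega) with h | ⟨d, h1, h2, h3⟩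
          · exact Or.inl h
          · exact Or.inr ⟨d, h1, h2, by rw [hup d (by omega), h3]⟩)
        (by
          intro a d c hab hdb ha hd
          by_cases haj : a = j
          · by_cases hdj : d = j
            · rw [haj, hdj]
            · rw [haj, Function.update_self] at ha
              rw [Function.update_of_ne hdj] at hd
              cases ha
              exact absurd (hinj d b k hdj hbj hd hb) hdb
          · rw [Function.update_of_ne haj] at ha
            by_cases hdj : d = j
            · rw [hdj, Function.update_self] at hd
              cases hd
              exact absurd (hinj a b k haj hbj ha hb) hab
            · rw [Function.update_of_ne hdj] at hd
              exact hinj a d c haj hdj ha hd)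
        (by
          intro a d c har hdr ha hd
          rw [hup a har] at ha
          rw [hup d hdr] at hd
          exact hlow a d c (by omega) (by omega) ha hd)
        (by
          intro a ha
          by_cases haj : a = j
          · rw [haj, Function.update_self] at ha
            cases ha
            exact hki rfl
          · rw [Function.update_of_ne haj] at ha
            exact hi a ha)
        hpos'
      refine ⟨r1, ?_, ?_⟩
      · intro c
        rw [r2 c]
        refine or_congr_right ⟨?_, ?_⟩
        · rintro ⟨a, hab, ha⟩
          by_cases haj : a = j
          · rw [haj, Function.update_self] at ha
            cases ha
            exact ⟨b, hbj, hb⟩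
          · rw [Function.update_of_ne haj] at ha
            exact ⟨a, haj, ha⟩
        · rintro ⟨a, haj, ha⟩
          by_cases hab : a = b
          · subst hab
            rw [hb] at ha
            cases ha
            exact ⟨j, hbj.symm, Function.update_self _ _ _⟩
          · exact ⟨a, hab, by rw [Function.update_of_ne haj, ha]⟩
      · intro R hR hRj a ha
        have hRk : ¬ R k := fun h => hRj ⟨k, h, hwk⟩
        have hRb : ¬ ∃ k, R k ∧ 0 < w k b := by
          intro h
          obtain ⟨c, hc, e⟩ := hR b h hbj
          rw [hb] at e
          cases e
          exact hRk hc
        rw [r3 R ?_ hRb a ha]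
        · exact Function.update_of_ne (by rintro rfl; exact hRj ha) _ _
        · intro d hd _
          have hdj : d ≠ j := fun e => hRj (e ▸ hd)
          rw [Function.update_of_ne hdj]
          exact hR d hd hdj

/-- If the search from `i` meets no free good, the set of reached agents is tight and certifies that
`i` stays unmatched. Otherwise the flip covers `i`, keeps all covered agents covered, and leaves the
goods of every tight set alone, so earlier certificates survive. -/
theorem augment_spec {μ : Fin m → Option (Fin n)} (hμ : IsMatch w μ) {i : Fin n}
    (hi : ∀ a, μ a ≠ some i) :
    IsMatch w (augment w μ i).val ∧
      (∀ k, (∃ a, μ a = some k) → ∃ a, (augment w μ i).val a = some k) ∧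
      (∀ k, (∃ a, (augment w μ i).val a = some k) → k = i ∨ ∃ a, μ a = some k) ∧
      (∀ R, Tight w μ R → Tight w (augment w μ i).val R) ∧
      ((∃ a, (augment w μ i).val a = some i) ∨ ∃ R, R i ∧ Tight w (augment w μ i).val R) := by
  obtain ⟨rank, hrank⟩ := searchTree_rank (w := w) μ i
  have hcl := searchTree_closed (w := w) μ i
  set par := (searchTree w μ i).val with hpar
  have hs := foldl_select (fun (r : Option (Fin m)) j =>
      if ((μ j).isNone && (par j).isSome) = true then some j else r)
      (fun j => μ j = none ∧ (par j).isSome)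
      (by
        intro r a
        split_ifs with h
        · right; simpa using h
        · left; rfl)
      (by
        intro r a h
        split_ifs with h'
        · rfl
        · rcases h with h | h
          · simp [h] at h'
          · exact h) (List.finRange m) none
  obtain ⟨free, hfree⟩ : ∃ free, free = (List.finRange m).foldl (fun (r : Option (Fin m)) j =>
      if ((μ j).isNone && (par j).isSome) = true then some j else r) none := ⟨_, rfl⟩
  rw [← hfree] at hs
  have hval : (augment w μ i).val = free.elim μ fun j => (flipPath par m μ j).val := by
    unfold augment
    simp only [Timed.val_bind, foldlM_val, op_val, Timed.val_ite, Timed.val_pure]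
    rw [← hpar, ← hfree]
    rcases free with _ | j <;> rfl
  rcases hf : free with _ | j
  · rw [hf] at hval hs
    rw [hval, Option.elim]
    refine ⟨hμ, fun k h => h, fun k h => Or.inr h, fun R h => h, Or.inr ⟨Reached μ i par,
      Or.inl rfl, ?_⟩⟩
    rintro a ⟨k, hk, hw⟩
    have ha := hcl a k hk hw
    rcases hμa : μ a with _ | c
    · have := hs.2 (Or.inr ⟨a, List.mem_finRange a, hμa, ha⟩)
      cases this
    · exact ⟨c, Or.inr ⟨a, ha, hμa⟩, rfl⟩
  · rw [hf] at hval hs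
    rw [hval, Option.elim]
    have hj : μ j = none ∧ (par j).isSome := by
      rcases hs.1 with h | ⟨a, _, h, ha⟩
      · cases h
      · cases h; exact ha
    have hjr : rank j ≤ m := by
      obtain ⟨k, hk⟩ := Option.isSome_iff_exists.mp hj.2
      exact (hrank j k hk).1
    obtain ⟨r1, r2, r3⟩ := flipPath_spec i par rank
      (fun a k h => ⟨(hrank a k h).2.2.1, (hrank a k h).2.1⟩) m μ j hjr hj.2
      (fun a k h _ => (hrank a k h).2.2.2) (fun a b k _ _ => hμ.inj a b k)
      (fun a b k _ _ => hμ.inj a b k) hi hμ.pos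
    refine ⟨r1, ?_, ?_, ?_, Or.inl ((r2 i).mpr (Or.inl rfl))⟩
    · rintro k ⟨a, ha⟩
      refine (r2 k).mpr (Or.inr ⟨a, ?_, ha⟩)
      rintro rfl
      rw [hj.1] at ha
      cases ha
    · intro k hk
      rcases (r2 k).mp hk with h | ⟨a, _, ha⟩
      · exact Or.inl h
      · exact Or.inr ⟨a, ha⟩
    · intro R hR a ha
      rw [r3 R (fun a h _ => hR a h) ?_ a ha]
      · exact hR a ha
      · intro h
        obtain ⟨k, _, e⟩ := hR j h
        rw [hj.1] at e
        cases e

/-- A tight set containing an unmatched agent is a Hall-type obstruction. Recording it for each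
failed agent replaces a proof of maximality by counting. -/
theorem maxMatching_spec (w : Fin n → Fin m → ℝ) :
    IsMatch w (maxMatching w).val ∧ ∀ i, (∃ a, (maxMatching w).val a = some i) ∨
      ∃ R, R i ∧ Tight w (maxMatching w).val R := by
  have key : ∀ (l : List (Fin n)) (μ : Fin m → Option (Fin n)), l.Nodup → IsMatch w μ →
      (∀ k ∈ l, ∀ a, μ a ≠ some k) →
      (∀ i, i ∉ l → (∃ a, μ a = some i) ∨ ∃ R, R i ∧ Tight w μ R) →
      IsMatch w (l.foldl (fun μ i => (augment w μ i).val) μ) ∧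
      ∀ i, (∃ a, l.foldl (fun μ i => (augment w μ i).val) μ a = some i) ∨
        ∃ R, R i ∧ Tight w (l.foldl (fun μ i => (augment w μ i).val) μ) R := by
    intro l
    induction l with
    | nil => intro μ _ h1 _ h2; exact ⟨h1, fun i => h2 i (by simp)⟩
    | cons k l ih =>
      intro μ hnd hμ hl hd
      rw [List.nodup_cons] at hnd
      obtain ⟨a1, a2, a3, a4, a5⟩ := augment_spec hμ (hl k (by simp))
      rw [List.foldl_cons]
      refine ih _ hnd.2 a1 ?_ ?_
      · intro c hc a ha
        rcases a3 c ⟨a, ha⟩ with h | ⟨b, hb⟩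
        · exact hnd.1 (h ▸ hc)
        · exact hl c (by simp [hc]) b hb
      · intro i hi
        by_cases hik : i = k
        · subst hik; exact a5
        · rcases hd i (by simp [hi, hik]) with h | ⟨R, hR, hT⟩
          · exact Or.inl (a2 i h)
          · exact Or.inr ⟨R, hR, a4 R hT⟩
  have := key (List.finRange n) (fun _ => none) (List.nodup_finRange n) ⟨by simp, by simp⟩
    (by simp) (by simp)
  unfold maxMatching
  simpa only [Timed.val_bind, foldlM_val, tabulate_val, op_val] using this

/-- Consing along the reversed list restores increasing order. -/
theorem foldl_reverse_filter {α : Type} (f : α → Bool) (l : List α) :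
    l.reverse.foldl (fun acc k => if f k = true then k :: acc else acc) [] = l.filter f := by
  rw [List.foldl_reverse]
  induction l with
  | nil => rfl
  | cons a l ih => simp only [List.foldr_cons, ih, List.filter_cons]

/-- The agents of a maximum matching: any of them value at least as many goods as they are, all goods
have an agent among them that values them, and an unmatched agent belongs to a set of agents whose
valued goods are no more than the matched agents in the set. -/
structure IsMatchedSet (w : Fin n → Fin m → ℝ) (A : List (Fin n)) : Prop where
  nodup : A.Nodup
  hall : ∀ (H : Finset (Fin n)) (N : Finset (Fin m)), (∀ k ∈ H, k ∈ A) →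
    (∀ k ∈ H, ∀ j, 0 < w k j → j ∈ N) → H.card ≤ N.card
  cover : ∀ j, (∃ i, 0 < w i j) → ∃ k ∈ A, 0 < w k j
  deficient : ∀ i, i ∉ A → ∃ (R : Finset (Fin n)) (N : Finset (Fin m)), i ∈ R ∧
    (∀ k ∈ R, ∀ j, 0 < w k j → j ∈ N) ∧ N.card ≤ (R.filter (· ∈ A)).card

/-- Hall's inequality for the matched agents comes from their distinct partners. The deficiency
comes from a tight set: the goods valued in it have distinct partners, all of them matched agents of
that set. -/
theorem matchedAgents_spec (w : Fin n → Fin m → ℝ) : IsMatchedSet w (matchedAgents w).val := by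
  classical
  obtain ⟨hμ, hd⟩ := maxMatching_spec w
  set μ := (maxMatching w).val with hμdef
  have hval : (matchedAgents w).val = (List.finRange n).filter fun k =>
      (List.finRange m).foldl (fun b j => b || decide (μ j = some k)) false := by
    rw [← foldl_reverse_filter]
    unfold matchedAgents
    simp only [Timed.val_bind, foldlM_val, op_val, Timed.val_ite, Timed.val_pure, ← hμdef]
  have hmem : ∀ k, k ∈ (matchedAgents w).val ↔ ∃ a, μ a = some k := by
    intro k
    rw [hval, List.mem_filter, foldl_or_eq_true]
    simp
  refine ⟨?_, ?_, ?_, ?_⟩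
  · rw [hval]; exact (List.nodup_finRange n).filter _
  · intro H N hH hN
    rw [← Finset.card_image_of_injective H (Option.some_injective _)]
    refine (Finset.card_le_card ?_).trans (Finset.card_image_le (s := N) (f := μ))
    intro o ho
    obtain ⟨k, hk, rfl⟩ := Finset.mem_image.mp ho
    obtain ⟨a, ha⟩ := (hmem k).mp (hH k hk)
    exact Finset.mem_image.mpr ⟨a, hN k hk a (hμ.pos a k ha), ha⟩
  · rintro j ⟨i, hi⟩
    rcases hd i with h | ⟨R, hR, hT⟩
    · exact ⟨i, (hmem i).mpr h, hi⟩
    · obtain ⟨k, _, hk⟩ := hT j ⟨i, hR, hi⟩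
      exact ⟨k, (hmem k).mpr ⟨j, hk⟩, hμ.pos j k hk⟩
  · intro i hi
    obtain ⟨R, hR, hT⟩ := (hd i).resolve_left fun h => hi ((hmem i).mpr h)
    refine ⟨Finset.univ.filter R, Finset.univ.filter fun j => ∃ k, R k ∧ 0 < w k j,
      by simp [hR], ?_, ?_⟩
    · intro k hk j hj
      simp only [Finset.mem_filter, Finset.mem_univ, true_and] at hk ⊢
      exact ⟨k, hk, hj⟩
    · have hch : ∀ j, ∃ k, (∃ k, R k ∧ 0 < w k j) → R k ∧ μ j = some k := by
        intro j
        by_cases h : ∃ k, R k ∧ 0 < w k j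
        · obtain ⟨k, hk⟩ := hT j h
          exact ⟨k, fun _ => hk⟩
        · exact ⟨i, fun h' => absurd h' h⟩
      choose g hg using hch
      refine Finset.card_le_card_of_injOn g ?_ ?_
      · intro j hj
        simp only [Finset.coe_filter, Finset.mem_univ, true_and, Set.mem_ofPred_eq] at hj
        obtain ⟨h1, h2⟩ := hg j hj
        simp only [Finset.coe_filter, Finset.mem_filter, Finset.mem_univ, true_and,
          Set.mem_ofPred_eq]
        exact ⟨h1, (hmem _).mpr ⟨j, h2⟩⟩
      · intro j hj j' hj' e
        simp only [Finset.coe_filter, Finset.mem_univ, true_and, Set.mem_ofPred_eq] at hj hj'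
        have h1 := (hg j hj).2
        have h2 := (hg j' hj').2
        rw [← e] at h2
        exact hμ.inj j j' _ h1 h2

end

/-! ## What one pass computes -/

/-! ### Loops as conjunctions, disjunctions, maxima and minima. -/

section Loops

variable {α : Type}

theorem foldl_and_iff (step : Bool → α → Bool) (Q : α → Prop)
    (h : ∀ b a, step b a = true ↔ b = true ∧ Q a) (l : List α) (b : Bool) :
    l.foldl step b = true ↔ b = true ∧ ∀ a ∈ l, Q a := by
  induction l generalizing b with
  | nil => simp
  | cons a l ih => simp [ih, h, and_assoc]

theorem foldl_or_iff (step : Bool → α → Bool) (Q : α → Prop)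
    (h : ∀ b a, step b a = true ↔ b = true ∨ Q a) (l : List α) (b : Bool) :
    l.foldl step b = true ↔ b = true ∨ ∃ a ∈ l, Q a := by
  induction l generalizing b with
  | nil => simp
  | cons a l ih => simp [ih, h, or_assoc]

theorem foldl_mem_iff {β : Type} (step : List β → α → List β) (Q : α → β → Prop)
    (h : ∀ acc a q, q ∈ step acc a ↔ q ∈ acc ∨ Q a q) (l : List α) (acc : List β) (q : β) :
    q ∈ l.foldl step acc ↔ q ∈ acc ∨ ∃ a ∈ l, Q a q := by
  induction l generalizing acc with
  | nil => simp
  | cons a l ih => simp [ih, h, or_assoc]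

/-- The value `none` of `g` marks the elements that the loop skips. The third clause allows for the
starting value itself being the maximum. -/
theorem foldl_max_spec (g : α → Option ℝ) (step : ℝ → α → ℝ)
    (hn : ∀ acc a, g a = none → step acc a = acc)
    (hs : ∀ acc a r, g a = some r → step acc a = max acc r) (l : List α) (acc : ℝ) :
    acc ≤ l.foldl step acc ∧ (∀ a ∈ l, ∀ r, g a = some r → r ≤ l.foldl step acc) ∧
      (l.foldl step acc = acc ∨ ∃ a ∈ l, g a = some (l.foldl step acc)) := by
  induction l generalizing acc with
  | nil => simp
  | cons a l ih =>
    obtain ⟨h1, h2, h3⟩ := ih (step acc a)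
    rw [List.foldl_cons]
    rcases hg : g a with _ | r
    · rw [hn acc a hg] at h1 h2 h3 ⊢
      refine ⟨h1, ?_, ?_⟩
      · intro b hb s hs'
        rcases List.mem_cons.mp hb with rfl | hb
        · rw [hg] at hs'; cases hs'
        · exact h2 b hb s hs'
      · rcases h3 with h3 | ⟨b, hb, h3⟩
        · exact Or.inl h3
        · exact Or.inr ⟨b, by simp [hb], h3⟩
    · rw [hs acc a r hg] at h1 h2 h3 ⊢
      refine ⟨(le_max_left _ _).trans h1, ?_, ?_⟩
      · intro b hb s hs'
        rcases List.mem_cons.mp hb with rfl | hb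
        · rw [hg] at hs'; cases hs'
          exact (le_max_right _ _).trans h1
        · exact h2 b hb s hs'
      · rcases h3 with h3 | ⟨b, hb, h3⟩
        · rcases max_choice acc r with h | h
          · exact Or.inl (h3.trans h)
          · exact Or.inr ⟨a, by simp, by rw [hg, h3, h]⟩
        · exact Or.inr ⟨b, by simp [hb], h3⟩

/-- `r` is the minimum of `S`, and `none` stands for the minimum of the empty set. -/
def MinOf (r : Option ℝ) (S : ℝ → Prop) : Prop :=
  (∀ a, r = some a → S a) ∧ ∀ s, S s → ∃ a, r = some a ∧ a ≤ s

theorem minOf_none : MinOf none fun _ => False := by simp [MinOf]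

theorem MinOf.congr {r : Option ℝ} {S T : ℝ → Prop} (h : MinOf r S) (e : ∀ s, S s ↔ T s) :
    MinOf r T := by
  have : S = T := funext fun s => propext (e s)
  rwa [← this]

theorem MinOf.minOpt {r : Option ℝ} {S : ℝ → Prop} (h : MinOf r S) (v : ℝ) :
    MinOf (FairDivision.minOpt r (some v)).val fun s => S s ∨ s = v := by
  rcases r with _ | a
  · simp only [FairDivision.minOpt, op_val]
    refine ⟨by rintro a h; cases h; exact Or.inr rfl, ?_⟩
    rintro s (hs | rfl)
    · obtain ⟨a, ha, _⟩ := h.2 s hs; cases ha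
    · exact ⟨s, rfl, le_rfl⟩
  · simp only [FairDivision.minOpt, op_val, Timed.val_bind, Timed.val_ite, Timed.val_pure,
      decide_eq_true_eq]
    split_ifs with hva
    · refine ⟨by rintro a h; cases h; exact Or.inr rfl, ?_⟩
      rintro s (hs | rfl)
      · obtain ⟨a', ha', hle⟩ := h.2 s hs
        cases ha'
        exact ⟨v, rfl, hva.le.trans hle⟩
      · exact ⟨s, rfl, le_rfl⟩
    · refine ⟨by rintro a' h'; cases h'; exact Or.inl (h.1 a rfl), ?_⟩
      rintro s (hs | rfl)
      · exact h.2 s hs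
      · exact ⟨a, rfl, not_lt.mp hva⟩

theorem MinOf.foldl {step : Option ℝ → α → Option ℝ} {Q : α → ℝ → Prop}
    (hstep : ∀ r S a, MinOf r S → MinOf (step r a) fun s => S s ∨ Q a s) (l : List α)
    {r : Option ℝ} {S : ℝ → Prop} (h : MinOf r S) :
    MinOf (l.foldl step r) fun s => S s ∨ ∃ a ∈ l, Q a s := by
  induction l generalizing r S with
  | nil => simpa using h
  | cons a l ih =>
    rw [List.foldl_cons]
    refine (ih (hstep r S a h)).congr fun s => ?_
    simp [or_assoc]

theorem minOpt_val_le (a b : Option ℝ) :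
    (∀ c, (minOpt a b).val = some c → (a = some c ∨ b = some c) ∧
      (∀ a', a = some a' → c ≤ a') ∧ ∀ b', b = some b' → c ≤ b') ∧
    ((minOpt a b).val = none → a = none ∧ b = none) := by
  rcases a with _ | a <;> rcases b with _ | b
  · simp [minOpt]
  · simp [minOpt]
  · simp [minOpt]
  · simp only [minOpt, op_val, Timed.val_bind, Timed.val_ite, Timed.val_pure, decide_eq_true_eq]
    split_ifs with h
    · refine ⟨?_, by simp⟩
      rintro c hc
      cases hc
      refine ⟨Or.inr rfl, ?_, ?_⟩
      · rintro a' h'; cases h'; exact h.le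
      · rintro a' h'; cases h'; exact le_rfl
    · refine ⟨?_, by simp⟩
      rintro c hc
      cases hc
      refine ⟨Or.inl rfl, ?_, ?_⟩
      · rintro a' h'; cases h'; exact le_rfl
      · rintro a' h'; cases h'; exact not_lt.mp h

end Loops

/-! ### Meaning of the spendings, the pEF1 test, the hierarchy and the factors. -/

section

variable {n m : ℕ}

/-- The price `p(x_k)` of the bundle of agent `k`. -/
def spend (x : Fin m → Fin n) (p : Fin m → ℝ) (k : Fin n) : ℝ := ∑ j ∈ bundle x k, p j

@[simp] theorem mem_bundle {x : Fin m → Fin n} {k : Fin n} {j : Fin m} :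
    j ∈ bundle x k ↔ x j = k := by simp [bundle]

theorem bundle_eq_empty_iff {x : Fin m → Fin n} {k : Fin n} :
    bundle x k = ∅ ↔ ∀ j, x j ≠ k := by
  simp [Finset.eq_empty_iff_forall_notMem]

@[simp] theorem spending_val (x : Fin m → Fin n) (p : Fin m → ℝ) (k : Fin n) :
    (spending x p k).val = spend x p k := by
  have : ∀ (l : List (Fin m)) (s : ℝ),
      l.foldl (fun s j => if decide (x j = k) = true then s + p j else s) s =
        s + (l.map fun j => if x j = k then p j else 0).sum := by
    intro l
    induction l with
    | nil => simp
    | cons a l ih =>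
      intro s
      rw [List.foldl_cons, ih, List.map_cons, List.sum_cons]
      by_cases h : x a = k <;> simp [h, add_assoc]
  unfold spending spend bundle
  simp only [foldlM_val, Timed.val_bind, op_val, Timed.val_ite, Timed.val_pure]
  rw [this, zero_add, Finset.sum_filter, ← List.sum_ofFn, List.ofFn_eq_map]

/-- `δ`-price-envy-freeness up to one good. -/
def PEF1 (δ : ℝ) (A : List (Fin n)) (x : Fin m → Fin n) (p : Fin m → ℝ) : Prop :=
  ∀ i ∈ A, ∀ k ∈ A, bundle x k = ∅ ∨
    ∃ j ∈ bundle x k, spend x p k - p j ≤ (1 + δ) * spend x p i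

theorem isPEF1_val (δ : ℝ) (A : List (Fin n)) (x : Fin m → Fin n) (p : Fin m → ℝ) :
    (isPEF1 δ A x p).val = true ↔ PEF1 δ A x p := by
  -- The first flag records that the bundle is nonempty, the second that a suitable good has been
  -- found.
  have inner : ∀ (k : Fin n) (b : ℝ) (l : List (Fin m)) (r : Bool × Bool),
      ((l.foldl (fun (r : Bool × Bool) j => if decide (x j = k) = true then
        (true, r.2 || decide (spend x p k - p j ≤ b)) else r) r).1 = true ↔
          r.1 = true ∨ ∃ j ∈ l, x j = k) ∧
      ((l.foldl (fun (r : Bool × Bool) j => if decide (x j = k) = true then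
        (true, r.2 || decide (spend x p k - p j ≤ b)) else r) r).2 = true ↔
          r.2 = true ∨ ∃ j ∈ l, x j = k ∧ spend x p k - p j ≤ b) := by
    intro k b l
    induction l with
    | nil => simp
    | cons a l ih =>
      intro r
      rw [List.foldl_cons]
      obtain ⟨h1, h2⟩ := ih (if decide (x a = k) = true then
        (true, r.2 || decide (spend x p k - p a ≤ b)) else r)
      rw [h1, h2]
      by_cases h : x a = k <;> simp [h, or_assoc]
  unfold isPEF1
  simp only [foldlM_val, Timed.val_bind, op_val, Timed.val_ite, Timed.val_pure, spending_val]
  rw [foldl_and_iff _ (fun i => ∀ k ∈ A, bundle x k = ∅ ∨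
    ∃ j ∈ bundle x k, spend x p k - p j ≤ (1 + δ) * spend x p i)]
  · simp [PEF1]
  · intro b i
    rw [foldl_and_iff]
    intro b k
    obtain ⟨h1, h2⟩ := inner k ((1 + δ) * spend x p i) (List.finRange m) (false, false)
    rw [Bool.and_eq_true, Bool.or_eq_true, h2, Bool.not_eq_true', ← Bool.not_eq_true, h1,
      bundle_eq_empty_iff]
    simp

/-- Agent `i` is the first minimizer of `f` in the list `A`. -/
def IsFirstMin (A : List (Fin n)) (f : Fin n → ℝ) (i : Fin n) : Prop :=
  i ∈ A ∧ ∀ k ∈ A, f i < f k ∨ f i = f k ∧ A.idxOf i ≤ A.idxOf k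

theorem IsFirstMin.le {A : List (Fin n)} {f : Fin n → ℝ} {i k : Fin n} (h : IsFirstMin A f i)
    (hk : k ∈ A) : f i ≤ f k := by
  rcases h.2 k hk with h | h
  · exact h.le
  · exact h.1.le

/-- Tie-breaking makes the least spender a function of the configuration, so that it can be tracked
from one pass to the next. -/
theorem IsFirstMin.unique {A : List (Fin n)} {f : Fin n → ℝ} {i i' : Fin n}
    (h : IsFirstMin A f i) (h' : IsFirstMin A f i') : i = i' := by
  have e : f i = f i' := le_antisymm (h.le h'.1) (h'.le h.1)
  have h1 : A.idxOf i ≤ A.idxOf i' := by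
    rcases h.2 i' h'.1 with h | h
    · exact absurd e h.ne
    · exact h.2
  have h2 : A.idxOf i' ≤ A.idxOf i := by
    rcases h'.2 i h.1 with h | h
    · exact absurd e.symm h.ne
    · exact h.2
  exact (List.idxOf_inj h.1).mp (le_antisymm h1 h2)

theorem leastSpender_val (A : List (Fin n)) (x : Fin m → Fin n) (p : Fin m → ℝ) :
    (A = [] ∧ (leastSpender A x p).val = none) ∨
      ∃ i, (leastSpender A x p).val = some (i, spend x p i) ∧ IsFirstMin A (spend x p) i := by
  unfold leastSpender
  rw [foldlM_val]
  induction A using List.reverseRecOn with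
  | nil => simp
  | append_singleton l k ih =>
    right
    rw [List.foldl_append, List.foldl_cons, List.foldl_nil]
    rcases ih with ⟨rfl, ih⟩ | ⟨i, ih, hi⟩
    · rw [ih]
      exact ⟨k, by simp, by simp, by simp⟩
    · rw [ih]
      have hidx : ∀ a ∈ l, (l ++ [k]).idxOf a = l.idxOf a := fun a ha => List.idxOf_append_of_mem ha
      by_cases h : spend x p k < spend x p i
      · refine ⟨k, by simp [h], by simp, ?_⟩
        intro a ha
        rcases List.mem_append.mp ha with ha | ha
        · exact Or.inl (h.trans_le (hi.le ha))
        · right; simp at ha; subst ha; exact ⟨rfl, le_rfl⟩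
      · refine ⟨i, by simp [h], by simp [hi.1], ?_⟩
        intro a ha
        rw [hidx i hi.1]
        by_cases hal : a ∈ l
        · rw [hidx a hal]; exact hi.2 a hal
        · have hak : a = k := by
            rcases List.mem_append.mp ha with ha | ha
            · exact absurd ha hal
            · simpa using ha
          subst hak
          rcases (not_lt.mp h).lt_or_eq with h | h
          · exact Or.inl h
          · refine Or.inr ⟨h, ?_⟩
            rw [List.idxOf_append_of_notMem hal]
            exact (List.idxOf_lt_length_of_mem hi.1).le.trans (Nat.le_add_right _ _)

/-- Good `j` has maximum bang per buck for agent `h`. -/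
def IsMBB (w : Fin n → Fin m → ℝ) (p : Fin m → ℝ) (h : Fin n) (j : Fin m) : Prop :=
  ∀ j', w h j' / p j' ≤ w h j / p j

/-- The maximum loop starts at `0`, which is harmless because all ratios are nonnegative. -/
theorem mbbRatios_spec (w : Fin n → Fin m → ℝ) (p : Fin m → ℝ) (hw : ∀ i j, 0 ≤ w i j)
    (hp : ∀ j, 0 < p j) (h : Fin n) (j : Fin m) :
    (w h j / p j = (mbbRatios w p).val h ↔ IsMBB w p h j) := by
  have key := foldl_max_spec (fun j => some (w h j / p j)) (fun a j => max a (w h j / p j))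
    (by simp) (by intro acc a r hr; cases hr; rfl) (List.finRange m) 0
  have hv : (mbbRatios w p).val h =
      (List.finRange m).foldl (fun a j => max a (w h j / p j)) 0 := by
    simp [mbbRatios]
  rw [hv]
  obtain ⟨h0, h1, h2⟩ := key
  constructor
  · intro e j'
    rw [e]
    exact h1 j' (List.mem_finRange _) _ rfl
  · intro hj
    refine le_antisymm (h1 j (List.mem_finRange _) _ rfl) ?_
    rcases h2 with h2 | ⟨j', _, h2⟩
    · rw [h2]; exact div_nonneg (hw h j) (hp j).le
    · rw [← Option.some.inj h2]; exact hj j'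

theorem mbbTable_val (w : Fin n → Fin m → ℝ) (p : Fin m → ℝ) (hw : ∀ i j, 0 ≤ w i j)
    (hp : ∀ j, 0 < p j) (h : Fin n) (j : Fin m) :
    (mbbTable w p (mbbRatios w p).val).val h j = true ↔ IsMBB w p h j := by
  rw [← mbbRatios_spec w p hw hp]
  simp [mbbTable]

/-- The breadth-first levels of the agents reachable from `i` by the edges `E`. -/
structure IsLevel (E : Fin n → Fin n → Prop) (i : Fin n) (lev : Fin n → Option ℕ) : Prop where
  root : lev i = some 0
  zero : ∀ k, lev k = some 0 → k = i
  pred : ∀ k ℓ, lev k = some (ℓ + 1) → ∃ h, lev h = some ℓ ∧ E h k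
  succ : ∀ h k ℓ, lev h = some ℓ → E h k → ∃ ℓ', ℓ' ≤ ℓ + 1 ∧ lev k = some ℓ'
  lt : ∀ k ℓ, lev k = some ℓ → ℓ < n

/-- An agent at level `ℓ` has predecessors at all lower levels, which are `ℓ + 1` distinct agents.
Hence `n` rounds of the breadth-first search are enough. -/
theorem level_lt {E : Fin n → Fin n → Prop} {lev : Fin n → Option ℕ}
    (pred : ∀ k ℓ, lev k = some (ℓ + 1) → ∃ h, lev h = some ℓ ∧ E h k) (k : Fin n) (ℓ : ℕ)
    (h : lev k = some ℓ) : ℓ < n := by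
  have key : ∀ ℓ k, lev k = some ℓ → ∀ ℓ' ≤ ℓ, ∃ k', lev k' = some ℓ' := by
    intro ℓ
    induction ℓ with
    | zero => intro k hk ℓ' hℓ'; exact ⟨k, by rw [hk, Nat.le_zero.mp hℓ']⟩
    | succ ℓ ih =>
      intro k hk ℓ' hℓ'
      rcases Nat.lt_or_ge ℓ ℓ' with h | h
      · exact ⟨k, by rw [hk]; congr 1; omega⟩
      · obtain ⟨c, hc, _⟩ := pred k ℓ hk
        exact ih c hc ℓ' h
  choose f hf using fun t : Fin (ℓ + 1) => key ℓ k h t (Nat.lt_succ_iff.mp t.2)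
  have hinj : Function.Injective f := by
    intro a b hab
    have h1 := hf a
    rw [hab, hf b] at h1
    exact Fin.ext (Option.some.inj h1).symm
  have := Fintype.card_le_of_injective f hinj
  simpa using this

theorem buildHierarchy_spec (A : List (Fin n)) (x : Fin m → Fin n) (mbb : Fin n → Fin m → Bool)
    (i : Fin n) : IsLevel (fun h k => h ∈ A ∧ ∃ j, x j = k ∧ mbb h j = true) i
      (buildHierarchy A x mbb i).val := by
  set E : Fin n → Fin n → Prop := fun h k => h ∈ A ∧ ∃ j, x j = k ∧ mbb h j = true with hE
  let hitB : (Fin n → Option ℕ) → ℕ → Fin n → Bool := fun lev ℓ k =>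
    (List.finRange m).foldl (fun b j => A.foldl (fun b h =>
      (b || (decide (x j = k) && decide (lev h = some ℓ) && mbb h j))) b) false
  have hhit : ∀ lev ℓ k, hitB lev ℓ k = true ↔ ∃ h, lev h = some ℓ ∧ E h k := by
    intro lev ℓ k
    simp only [hitB]
    rw [foldl_or_iff _ (fun j => ∃ h ∈ A, (x j = k ∧ lev h = some ℓ) ∧ mbb h j = true)]
    · simp only [Bool.false_eq_true, false_or, List.mem_finRange, true_and, hE]
      constructor
      · rintro ⟨j, h, hA, ⟨h1, h2⟩, h3⟩; exact ⟨h, h2, hA, j, h1, h3⟩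
      · rintro ⟨h, h2, hA, j, h1, h3⟩; exact ⟨j, h, hA, ⟨h1, h2⟩, h3⟩
    · intro b j
      rw [foldl_or_iff]
      intro b h
      simp
  let round : (Fin n → Option ℕ) → ℕ → Fin n → Option ℕ := fun lev ℓ k =>
    match lev k with
    | some l => some l
    | none => if hitB lev ℓ k = true then some (ℓ + 1) else none
  have hval : (buildHierarchy A x mbb i).val =
      (List.range n).foldl round fun k => if decide (k = i) = true then some 0 else none := by
    unfold buildHierarchy
    simp only [Timed.val_bind, foldlM_val, tabulate_val, op_val, Timed.val_ite]
    congr 1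
    funext lev ℓ k
    simp only [round]
    rcases lev k with _ | l
    · simp only [foldlM_val, Timed.val_bind, op_val, Timed.val_ite, Timed.val_pure, hitB]
    · rfl
  -- After `r` rounds only the successors of levels below `r` are settled. Since levels stay below
  -- `n`, nothing is left open at `r = n`.
  have key : ∀ r : ℕ,
      let lev := (List.range r).foldl round fun k => if decide (k = i) = true then some 0 else none
      lev i = some 0 ∧ (∀ k, lev k = some 0 → k = i) ∧
      (∀ k ℓ, lev k = some (ℓ + 1) → ∃ h, lev h = some ℓ ∧ E h k) ∧
      (∀ h k ℓ, ℓ < r → lev h = some ℓ → E h k → ∃ ℓ', ℓ' ≤ ℓ + 1 ∧ lev k = some ℓ') ∧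
      (∀ k ℓ, lev k = some ℓ → ℓ ≤ r) := by
    intro r
    induction r with
    | zero => simp
    | succ r ih =>
      rw [List.range_succ, List.foldl_append, List.foldl_cons, List.foldl_nil]
      set lev := (List.range r).foldl round fun k => if decide (k = i) = true then some 0 else none
        with hlev
      obtain ⟨i1, i2, i3, i4, i5⟩ := ih
      have hold : ∀ k ℓ, lev k = some ℓ → round lev r k = some ℓ := by
        intro k ℓ h; simp only [round, h]
      have hnew : ∀ k ℓ, lev k = none → round lev r k = some ℓ →
          ℓ = r + 1 ∧ ∃ h, lev h = some r ∧ E h k := by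
        intro k ℓ h h'
        simp only [round, h] at h'
        split_ifs at h' with hc
        · cases h'; exact ⟨rfl, (hhit _ _ _).mp hc⟩
      have hback : ∀ k ℓ, round lev r k = some ℓ → lev k = some ℓ ∨
          lev k = none ∧ ℓ = r + 1 ∧ ∃ h, lev h = some r ∧ E h k := by
        intro k ℓ h
        rcases hk : lev k with _ | l
        · exact Or.inr ⟨rfl, hnew k ℓ hk h⟩
        · rw [hold k l hk] at h; exact Or.inl h
      refine ⟨hold i 0 i1, ?_, ?_, ?_, ?_⟩
      · intro k hk
        rcases hback k 0 hk with h | ⟨_, h, _⟩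
        · exact i2 k h
        · omega
      · intro k ℓ hk
        rcases hback k _ hk with h | ⟨_, h, c, hc, hEc⟩
        · obtain ⟨c, hc, hEc⟩ := i3 k ℓ h
          exact ⟨c, hold c ℓ hc, hEc⟩
        · have : ℓ = r := by omega
          subst this
          exact ⟨c, hold c ℓ hc, hEc⟩
      · intro h k ℓ hℓ hh hE'
        have hh' : lev h = some ℓ := by
          rcases hback h ℓ hh with h' | ⟨_, h', _⟩
          · exact h'
          · omega
        rcases Nat.lt_or_ge ℓ r with hr | hr
        · obtain ⟨ℓ', h1, h2⟩ := i4 h k ℓ hr hh' hE'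
          exact ⟨ℓ', h1, hold k ℓ' h2⟩
        · have : ℓ = r := by omega
          subst this
          rcases hk : lev k with _ | l
          · refine ⟨ℓ + 1, le_rfl, ?_⟩
            simp only [round, hk]
            rw [if_pos ((hhit _ _ _).mpr ⟨h, hh', hE'⟩)]
          · exact ⟨l, (i5 k l hk).trans (Nat.le_succ _), hold k l hk⟩
      · intro k ℓ hk
        rcases hback k ℓ hk with h | ⟨_, h, _⟩
        · exact (i5 k ℓ h).trans (Nat.le_succ _)
        · omega
  obtain ⟨k1, k2, k3, k4, k5⟩ := key n
  rw [← hval] at k1 k2 k3 k4 k5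
  have hlt : ∀ k ℓ, (buildHierarchy A x mbb i).val k = some ℓ → ℓ < n := level_lt k3
  exact ⟨k1, k2, k3, fun h k ℓ hh => k4 h k ℓ (hlt h ℓ hh) hh, hlt⟩

/-- The steps from an agent of `A` to the owner of one of its MBB goods. -/
def MBBEdge (w : Fin n → Fin m → ℝ) (A : List (Fin n)) (x : Fin m → Fin n) (p : Fin m → ℝ)
    (h k : Fin n) : Prop :=
  h ∈ A ∧ ∃ j, x j = k ∧ IsMBB w p h j

/-- The transfer of good `j` to agent `h` at level `ℓ` is admissible in Phase 2. -/
def IsSwap (w : Fin n → Fin m → ℝ) (A : List (Fin n)) (x : Fin m → Fin n) (p : Fin m → ℝ)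
    (lev : Fin n → Option ℕ) (c : ℝ) (ℓ : ℕ) (h : Fin n) (j : Fin m) : Prop :=
  h ∈ A ∧ lev h = some ℓ ∧ IsMBB w p h j ∧ lev (x j) = some (ℓ + 1) ∧ c < spend x p (x j) - p j

theorem swapsAt_val (w : Fin n → Fin m → ℝ) (ε : ℝ) (A : List (Fin n)) (x : Fin m → Fin n)
    (p : Fin m → ℝ) (mbb : Fin n → Fin m → Bool) (hmbb : ∀ h j, mbb h j = true ↔ IsMBB w p h j)
    (lev : Fin n → Option ℕ) (si : ℝ) (ℓ : ℕ) (h : Fin n) (j : Fin m) :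
    (h, j) ∈ (swapsAt ε A x p mbb lev si ℓ).val ↔
      IsSwap w A x p lev ((1 + ε) * si) ℓ h j := by
  unfold swapsAt
  simp only [Timed.val_bind, foldlM_val, op_val, Timed.val_ite, Timed.val_pure, spending_val]
  rw [foldl_mem_iff _ (fun h (q : Fin n × Fin m) => ∃ j ∈ List.finRange m, q = (h, j) ∧
    lev h = some ℓ ∧ IsMBB w p h j ∧ lev (x j) = some (ℓ + 1) ∧
      (1 + ε) * si < spend x p (x j) - p j)]
  · simp only [List.not_mem_nil, false_or, List.mem_finRange, true_and, Prod.mk.injEq, IsSwap]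
    constructor
    · rintro ⟨a, ha, b, ⟨rfl, rfl⟩, hr⟩; exact ⟨ha, hr⟩
    · rintro ⟨ha, hr⟩; exact ⟨h, ha, j, ⟨rfl, rfl⟩, hr⟩
  · intro acc a q
    rw [foldl_mem_iff]
    intro acc b q
    split_ifs with hc
    · simp only [Bool.and_eq_true, decide_eq_true_eq, hmbb] at hc
      rw [List.mem_cons]
      tauto
    · simp only [Bool.and_eq_true, decide_eq_true_eq, hmbb] at hc
      tauto

/-- A loop that keeps the first nonempty list. -/
theorem foldl_first_nonempty {β : Type} (f : ℕ → List β) (N : ℕ) :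
    ((List.range N).foldl (fun s a => if s.isEmpty = true then f a else s) [] = [] ∧
      ∀ ℓ < N, f ℓ = []) ∨
    ((List.range N).foldl (fun s a => if s.isEmpty = true then f a else s) [] ≠ [] ∧ ∃ ℓ < N,
      (List.range N).foldl (fun s a => if s.isEmpty = true then f a else s) [] = f ℓ ∧
      ∀ ℓ' < ℓ, f ℓ' = []) := by
  induction N with
  | zero => simp
  | succ N ih =>
    rw [List.range_succ, List.foldl_append, List.foldl_cons, List.foldl_nil]
    rcases ih with ⟨h1, h2⟩ | ⟨h1, ℓ, hℓ, h2, h3⟩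
    · rw [h1]
      simp only [List.isEmpty_nil, if_true]
      by_cases h : f N = []
      · left
        refine ⟨h, fun ℓ hℓ => ?_⟩
        rcases Nat.lt_succ_iff_lt_or_eq.mp hℓ with h' | rfl
        · exact h2 ℓ h'
        · exact h
      · exact Or.inr ⟨h, N, Nat.lt_succ_self _, rfl, h2⟩
    · right
      rw [if_neg (by simpa using h1)]
      exact ⟨h1, ℓ, hℓ.trans (Nat.lt_succ_self _), h2, h3⟩

theorem firstSwaps_val (ε : ℝ) (A : List (Fin n)) (x : Fin m → Fin n)
    (p : Fin m → ℝ) (mbb : Fin n → Fin m → Bool) (lev : Fin n → Option ℕ) (si : ℝ) :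
    ((firstSwaps ε A x p mbb lev si).val = [] ∧
      ∀ ℓ < n, (swapsAt ε A x p mbb lev si ℓ).val = []) ∨
    ((firstSwaps ε A x p mbb lev si).val ≠ [] ∧ ∃ ℓ < n,
      (firstSwaps ε A x p mbb lev si).val = (swapsAt ε A x p mbb lev si ℓ).val ∧
      ∀ ℓ' < ℓ, (swapsAt ε A x p mbb lev si ℓ').val = []) := by
  unfold firstSwaps
  simp only [Timed.val_bind, foldlM_val, op_val, Timed.val_ite, Timed.val_pure]
  exact foldl_first_nonempty (fun ℓ => (swapsAt ε A x p mbb lev si ℓ).val) n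

theorem alphaOne_spec (w : Fin n → Fin m → ℝ) (A : List (Fin n)) (x : Fin m → Fin n)
    (p : Fin m → ℝ) (ratio : Fin n → ℝ) (lev : Fin n → Option ℕ) :
    MinOf (alphaOne w A x p ratio lev).val fun s => ∃ h ∈ A, ∃ j, (lev h).isSome ∧
      lev (x j) = none ∧ 0 < w h j ∧ s = ratio h / (w h j / p j) := by
  unfold alphaOne
  simp only [Timed.val_bind, foldlM_val, op_val, Timed.val_ite, Timed.val_pure]
  refine (MinOf.foldl (Q := fun h s => ∃ j ∈ List.finRange m, (lev h).isSome ∧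
      lev (x j) = none ∧ 0 < w h j ∧ s = ratio h / (w h j / p j)) ?_ A minOf_none).congr ?_
  · intro r S h hr
    refine MinOf.foldl ?_ _ hr
    intro r S j hr
    split_ifs with hc
    · simp only [Bool.and_eq_true, decide_eq_true_eq, Option.isNone_iff_eq_none] at hc
      refine (hr.minOpt _).congr fun s => ?_
      tauto
    · simp only [Bool.and_eq_true, decide_eq_true_eq, Option.isNone_iff_eq_none] at hc
      refine hr.congr fun s => ?_
      tauto
  · intro s
    simp

/-- The least value of `p(x_k \ {j})`. -/
theorem leastRest_spec (x : Fin m → Fin n) (p : Fin m → ℝ) (k : Fin n) :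
    MinOf ((List.finRange m).foldl (fun (b : Option ℝ) j => if decide (x j = k) = true then
      (minOpt b (some (spend x p k - p j))).val else b) none)
      fun s => ∃ j, x j = k ∧ s = spend x p k - p j := by
  refine (MinOf.foldl (Q := fun j s => x j = k ∧ s = spend x p k - p j) ?_ _
    minOf_none).congr fun s => by simp
  intro r S j hr
  split_ifs with hc
  · rw [decide_eq_true_eq] at hc
    exact (hr.minOpt _).congr fun s => by tauto
  · rw [decide_eq_true_eq] at hc
    exact hr.congr fun s => by tauto

/-- `top` is the largest price of a bundle outside the hierarchy after the removal of its dearest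
good. -/
structure IsTopRest (A : List (Fin n)) (x : Fin m → Fin n) (p : Fin m → ℝ)
    (lev : Fin n → Option ℕ) (top : ℝ) : Prop where
  nonneg : 0 ≤ top
  upper : ∀ k ∈ A, lev k = none → bundle x k = ∅ ∨ ∃ j ∈ bundle x k, spend x p k - p j ≤ top
  attained : top = 0 ∨ ∃ k ∈ A, lev k = none ∧ (bundle x k).Nonempty ∧
    ∀ j ∈ bundle x k, top ≤ spend x p k - p j

theorem alphaTwo_spec (A : List (Fin n)) (x : Fin m → Fin n) (p : Fin m → ℝ)
    (lev : Fin n → Option ℕ) (si : ℝ) :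
    (si = 0 ∧ (alphaTwo A x p lev si).val = none) ∨
      (si ≠ 0 ∧ ∃ top, IsTopRest A x p lev top ∧
        (alphaTwo A x p lev si).val = some (top / si)) := by
  let rest : Fin n → Option ℝ := fun k => (List.finRange m).foldl
    (fun (b : Option ℝ) j => if decide (x j = k) = true then
      (minOpt b (some (spend x p k - p j))).val else b) none
  obtain ⟨top, htop⟩ : ∃ top, top = A.foldl (fun acc k => if (lev k).isNone = true then
      (match rest k with
        | none => pure acc
        | some r => maxReal acc r : Timed ℝ).val else acc) 0 := ⟨_, rfl⟩
  have hval : (alphaTwo A x p lev si).val =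
      if decide (si = 0) = true then none else some (top / si) := by
    unfold alphaTwo
    simp only [Timed.val_bind, foldlM_val, op_val, Timed.val_ite, Timed.val_pure, spending_val]
    subst htop
    rfl
  have hspec := foldl_max_spec (fun k => if (lev k).isNone = true then rest k else none)
    (fun acc k => if (lev k).isNone = true then
      (match rest k with
        | none => pure acc
        | some r => maxReal acc r : Timed ℝ).val else acc)
    (by
      intro acc a h
      split_ifs at h ⊢ with hl
      · rw [h]; rfl
      · rfl)
    (by
      intro acc a r h
      split_ifs at h ⊢ with hl
      rw [h]; simp) A 0
  rw [← htop] at hspec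
  obtain ⟨h0, h1, h2⟩ := hspec
  rw [hval]
  by_cases hs : si = 0
  · exact Or.inl ⟨hs, by simp [hs]⟩
  · refine Or.inr ⟨hs, top, ⟨h0, ?_, ?_⟩, by simp [hs]⟩
    · intro k hk hl
      by_cases hb : bundle x k = ∅
      · exact Or.inl hb
      · right
        obtain ⟨j, hj⟩ := Finset.nonempty_iff_ne_empty.mpr hb
        have hsp := leastRest_spec x p k
        obtain ⟨a, ha, _⟩ := hsp.2 _ ⟨j, mem_bundle.mp hj, rfl⟩
        obtain ⟨j', hj', e⟩ := hsp.1 a ha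
        refine ⟨j', mem_bundle.mpr hj', ?_⟩
        rw [← e]
        exact h1 k hk a (by rw [hl]; exact ha)
    · rcases h2 with h2 | ⟨k, hk, h2⟩
      · exact Or.inl h2
      · right
        split_ifs at h2 with hl
        have hsp := leastRest_spec x p k
        obtain ⟨j', hj', e⟩ := hsp.1 _ h2
        refine ⟨k, hk, by simpa using hl, ⟨j', mem_bundle.mpr hj'⟩, ?_⟩
        intro j hj
        obtain ⟨a, ha, hle⟩ := hsp.2 _ ⟨j, mem_bundle.mp hj, rfl⟩
        have : some a = some top := ha.symm.trans h2
        rw [← Option.some.inj this]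
        exact hle

/-- `s` is the least spending outside the hierarchy. -/
def IsLeastOutside (A : List (Fin n)) (x : Fin m → Fin n) (p : Fin m → ℝ)
    (lev : Fin n → Option ℕ) (s : ℝ) : Prop :=
  (∃ k ∈ A, lev k = none ∧ s = spend x p k) ∧ ∀ k ∈ A, lev k = none → s ≤ spend x p k

theorem leastOutside_spec (A : List (Fin n)) (x : Fin m → Fin n) (p : Fin m → ℝ)
    (lev : Fin n → Option ℕ) :
    (A.foldl (fun (acc : Option ℝ) k => if (lev k).isNone = true then
        (minOpt acc (some (spend x p k))).val else acc) none = none ∧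
      ∀ k ∈ A, lev k ≠ none) ∨
    ∃ s, A.foldl (fun (acc : Option ℝ) k => if (lev k).isNone = true then
        (minOpt acc (some (spend x p k))).val else acc) none = some s ∧
      IsLeastOutside A x p lev s := by
  have h : MinOf (A.foldl (fun (acc : Option ℝ) k => if (lev k).isNone = true then
        (minOpt acc (some (spend x p k))).val else acc) none)
      fun s => ∃ k ∈ A, lev k = none ∧ s = spend x p k := by
    refine (MinOf.foldl (Q := fun k s => lev k = none ∧ s = spend x p k) ?_ _
      minOf_none).congr fun s => by simp
    intro r S k hr
    split_ifs with hc
    · rw [Option.isNone_iff_eq_none] at hc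
      exact (hr.minOpt _).congr fun s => by tauto
    · rw [Option.isNone_iff_eq_none] at hc
      exact hr.congr fun s => by tauto
  generalize A.foldl (fun (acc : Option ℝ) k => if (lev k).isNone = true then
        (minOpt acc (some (spend x p k))).val else acc) none = r at h ⊢
  rcases r with _ | s
  · left
    refine ⟨rfl, fun k hk hl => ?_⟩
    obtain ⟨a, ha, _⟩ := h.2 _ ⟨k, hk, hl, rfl⟩
    cases ha
  · right
    refine ⟨s, rfl, h.1 s rfl, fun k hk hl => ?_⟩
    obtain ⟨a, ha, hle⟩ := h.2 _ ⟨k, hk, hl, rfl⟩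
    cases ha
    exact hle

theorem alphaThree_spec (ε : ℝ) (A : List (Fin n)) (x : Fin m → Fin n) (p : Fin m → ℝ)
    (lev : Fin n → Option ℕ) (si : ℝ) :
    (si = 0 ∧ (alphaThree ε A x p lev si).val = none) ∨
    (si ≠ 0 ∧ (∀ k ∈ A, lev k ≠ none) ∧ (alphaThree ε A x p lev si).val = none) ∨
    (si ≠ 0 ∧ ∃ s, IsLeastOutside A x p lev s ∧ (alphaThree ε A x p lev si).val =
      some ((1 + ε) ^ sInf {t : ℕ | s / si < (1 + ε) ^ t})) := by
  have hl := leastOutside_spec A x p lev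
  unfold alphaThree
  simp only [Timed.val_bind, foldlM_val, op_val, Timed.val_ite, Timed.val_pure, spending_val]
  generalize A.foldl (fun (acc : Option ℝ) k => if (lev k).isNone = true then
        (minOpt acc (some (spend x p k))).val else acc) none = r at hl ⊢
  by_cases hs : si = 0
  · left; simp [hs]
  · right
    rcases hl with ⟨rfl, hl⟩ | ⟨s, rfl, hl⟩
    · exact Or.inl ⟨hs, hl, by simp [hs]⟩
    · right
      refine ⟨hs, s, hl, ?_⟩
      rw [if_neg (by simpa using hs)]
      rfl

/-- `K` bounds the exponent of the power search, the only part of a pass whose length depends on the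
prices. -/
theorem alphaThree_time_le (ε : ℝ) (A : List (Fin n)) (hA : A.length ≤ n) (x : Fin m → Fin n)
    (p : Fin m → ℝ) (lev : Fin n → Option ℕ) (si : ℝ) (K : ℕ)
    (hK : si ≠ 0 → ∀ s, IsLeastOutside A x p lev s →
      sInf {t : ℕ | s / si < (1 + ε) ^ t} ≤ K) :
    (alphaThree ε A x p lev si).time ≤ n * (m * 4 + 3) + (2 * K + 5) := by
  have hl := leastOutside_spec A x p lev
  unfold alphaThree
  rw [Timed.time_bind]
  refine Nat.add_le_add (foldlM_agents_time_le A hA _ _ _ fun acc k => ?_) ?_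
  · have h1 := spending_time_le x p k
    have h2 := minOpt_time_le acc (some (spending x p k).val)
    simp only [Timed.time_bind, op_time, op_val, Timed.time_ite, Timed.time_pure]
    split_ifs <;> omega
  · simp only [Timed.val_bind, foldlM_val, op_val, Timed.val_ite, Timed.val_pure, spending_val,
      Timed.time_bind, op_time, Timed.time_ite, Timed.time_pure]
    generalize A.foldl (fun (acc : Option ℝ) k => if (lev k).isNone = true then
        (minOpt acc (some (spend x p k))).val else acc) none = r at hl ⊢
    split_ifs with hs
    · omega
    · rw [decide_eq_true_eq] at hs
      rcases hl with ⟨rfl, hl⟩ | ⟨s, rfl, hl⟩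
      · simp only [Timed.time_pure]; omega
      · have := hK hs s hl
        simp only [Timed.time_bind, op_time, Timed.time_pure, powSearch, op_val]
        omega

end

/-! ### The possible outcomes of one pass and its running time. -/

section

variable {n m : ℕ}

/-- The prices after the price-rise by `α`. -/
def raised (x : Fin m → Fin n) (p : Fin m → ℝ) (lev : Fin n → Option ℕ) (α : ℝ) (j : Fin m) : ℝ :=
  if (lev (x j)).isSome = true then α * p j else p j

/-- The least spender and the levels of its hierarchy. -/
structure IsHierarchy (w : Fin n → Fin m → ℝ) (A : List (Fin n)) (x : Fin m → Fin n)
    (p : Fin m → ℝ) (i : Fin n) (lev : Fin n → Option ℕ) : Prop where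
  least : IsFirstMin A (spend x p) i
  level : IsLevel (MBBEdge w A x p) i lev

/-- The factor at which agent `h` gets an MBB edge to good `j` outside the hierarchy. -/
def IsNewEdgeFactor (w : Fin n → Fin m → ℝ) (A : List (Fin n)) (x : Fin m → Fin n) (p : Fin m → ℝ)
    (lev : Fin n → Option ℕ) (s : ℝ) : Prop :=
  ∃ h ∈ A, ∃ j j₁, (lev h).isSome = true ∧ lev (x j) = none ∧ 0 < w h j ∧ IsMBB w p h j₁ ∧
    s = (w h j₁ / p j₁) / (w h j / p j)

/-- The factors `α₁`, `α₂`, `α₃` of Phase 3. -/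
structure IsFactors (w : Fin n → Fin m → ℝ) (ε : ℝ) (A : List (Fin n)) (x : Fin m → Fin n)
    (p : Fin m → ℝ) (i : Fin n) (lev : Fin n → Option ℕ) (a₁ a₂ a₃ : Option ℝ) : Prop where
  one : MinOf a₁ (IsNewEdgeFactor w A x p lev)
  two : (spend x p i = 0 ∧ a₂ = none) ∨
    (spend x p i ≠ 0 ∧ ∃ top, IsTopRest A x p lev top ∧ a₂ = some (top / spend x p i))
  three : (spend x p i = 0 ∧ a₃ = none) ∨ (spend x p i ≠ 0 ∧ (∀ k ∈ A, lev k ≠ none) ∧ a₃ = none) ∨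
    (spend x p i ≠ 0 ∧ ∃ s, IsLeastOutside A x p lev s ∧
      a₃ = some ((1 + ε) ^ sInf {t : ℕ | s / spend x p i < (1 + ε) ^ t}))

/-- `α` is the minimum of the three factors. -/
structure IsMinFactor (a₁ a₂ a₃ : Option ℝ) (α : ℝ) : Prop where
  mem : a₁ = some α ∨ a₂ = some α ∨ a₃ = some α
  le_one : ∀ a, a₁ = some a → α ≤ a
  le_two : ∀ a, a₂ = some a → α ≤ a
  le_three : ∀ a, a₃ = some a → α ≤ a

theorem hierarchy_val (w : Fin n → Fin m → ℝ) (A : List (Fin n)) (x : Fin m → Fin n)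
    (p : Fin m → ℝ) (hw : ∀ i j, 0 ≤ w i j) (hp : ∀ j, 0 < p j) (i : Fin n) :
    IsLevel (MBBEdge w A x p) i
      (buildHierarchy A x (mbbTable w p (mbbRatios w p).val).val i).val := by
  have h := buildHierarchy_spec A x (mbbTable w p (mbbRatios w p).val).val i
  have e : (fun h k => h ∈ A ∧ ∃ j, x j = k ∧
      (mbbTable w p (mbbRatios w p).val).val h j = true) = MBBEdge w A x p := by
    funext h k
    simp only [mbbTable_val w p hw hp, MBBEdge]
  rwa [e] at h

theorem priceRise_cases (w : Fin n → Fin m → ℝ) (ε : ℝ) (A : List (Fin n)) (x : Fin m → Fin n)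
    (p : Fin m → ℝ) (hw : ∀ i j, 0 ≤ w i j) (hp : ∀ j, 0 < p j) (i : Fin n)
    (lev : Fin n → Option ℕ) :
    ∃ a₁ a₂ a₃, IsFactors w ε A x p i lev a₁ a₂ a₃ ∧
      ((a₁ = none ∧ a₂ = none ∧ a₃ = none ∧
        (priceRise w ε A x p (mbbRatios w p).val lev (spend x p i)).val = Action.finish p) ∨
      ∃ α, IsMinFactor a₁ a₂ a₃ α ∧
        ((a₂ = some α ∧ (priceRise w ε A x p (mbbRatios w p).val lev (spend x p i)).val =
          Action.finish (raised x p lev α)) ∨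
        (a₂ ≠ some α ∧ (priceRise w ε A x p (mbbRatios w p).val lev (spend x p i)).val =
          Action.raise (raised x p lev α)))) := by
  refine ⟨(alphaOne w A x p (mbbRatios w p).val lev).val, (alphaTwo A x p lev (spend x p i)).val,
    (alphaThree ε A x p lev (spend x p i)).val, ⟨?_, alphaTwo_spec A x p lev _,
      alphaThree_spec ε A x p lev _⟩, ?_⟩
  · refine (alphaOne_spec w A x p (mbbRatios w p).val lev).congr fun s => ?_
    unfold IsNewEdgeFactor
    constructor
    · rintro ⟨h, hA, j, h1, h2, h3, h4⟩
      have : Nonempty (Fin m) := ⟨j⟩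
      obtain ⟨j₁, hj₁⟩ := Finite.exists_max fun j => w h j / p j
      -- The computed ratio of `h` is expressed through a good `j₁` attaining it, which later makes
      -- `α₁` a quotient of four powers of `1 + ε`.
      exact ⟨h, hA, j, j₁, h1, h2, h3, hj₁, by
        rw [(mbbRatios_spec w p hw hp h j₁).mpr hj₁]; exact h4⟩
    · rintro ⟨h, hA, j, j₁, h1, h2, h3, hj₁, h4⟩
      exact ⟨h, hA, j, h1, h2, h3, by
        rw [← (mbbRatios_spec w p hw hp h j₁).mpr hj₁]; exact h4⟩
  · unfold priceRise
    simp only [Timed.val_bind]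
    generalize (alphaOne w A x p (mbbRatios w p).val lev).val = a₁
    generalize (alphaTwo A x p lev (spend x p i)).val = a₂
    generalize (alphaThree ε A x p lev (spend x p i)).val = a₃
    obtain ⟨h1, h2⟩ := minOpt_val_le a₁ a₂
    obtain ⟨h3, h4⟩ := minOpt_val_le (minOpt a₁ a₂).val a₃
    rcases h : (minOpt (minOpt a₁ a₂).val a₃).val with _ | α
    · left
      obtain ⟨h5, h6⟩ := h4 h
      obtain ⟨h7, h8⟩ := h2 h5
      exact ⟨h7, h8, h6, rfl⟩
    · right
      obtain ⟨h5, h6, h7⟩ := h3 α h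
      refine ⟨α, ?_, ?_⟩
      · rcases h12 : (minOpt a₁ a₂).val with _ | β
        · obtain ⟨rfl, rfl⟩ := h2 h12
          refine ⟨?_, by simp, by simp, h7⟩
          rw [h12] at h5
          simpa using h5
        · obtain ⟨h8, h9, h10⟩ := h1 β h12
          have hαβ := h6 β h12
          refine ⟨?_, fun a ha => hαβ.trans (h9 a ha), fun a ha => hαβ.trans (h10 a ha), h7⟩
          rw [h12] at h5
          rcases h5 with h5 | h5
          · cases h5
            rcases h8 with h8 | h8
            · exact Or.inl h8
            · exact Or.inr (Or.inl h8)
          · exact Or.inr (Or.inr h5)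
      · have hq : (tabulate fun j => do
            let o ← op (x j)
            let lo ← op (lev o)
            let pj ← op (p j)
            if (← op lo.isSome) then op (α * pj) else pure pj).val = raised x p lev α := by
          funext j
          simp only [tabulate_val, Timed.val_bind, op_val, Timed.val_ite, Timed.val_pure, raised]
        by_cases ha : a₂ = some α
        · left
          refine ⟨ha, ?_⟩
          simp only [Timed.val_bind, op_val, Timed.val_ite, Timed.val_pure]
          rw [if_pos (by simpa using ha), hq]
        · right
          refine ⟨ha, ?_⟩
          simp only [Timed.val_bind, op_val, Timed.val_ite, Timed.val_pure]
          rw [if_neg (by simpa using ha), hq]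

theorem pass_cases (w : Fin n → Fin m → ℝ) (ε : ℝ) (A : List (Fin n)) (x : Fin m → Fin n)
    (p : Fin m → ℝ) (hw : ∀ i j, 0 ≤ w i j) (hp : ∀ j, 0 < p j) :
    (PEF1 (3 * ε) A x p ∧ (pass w ε A x p).val = Action.finish p) ∨
    (¬ PEF1 (3 * ε) A x p ∧ ∃ i lev, IsHierarchy w A x p i lev ∧
      ((∃ l ℓ, (pass w ε A x p).val = Action.swap l ∧ l ≠ [] ∧
        (∀ h j, (h, j) ∈ l → IsSwap w A x p lev ((1 + ε) * spend x p i) ℓ h j) ∧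
        ∀ ℓ' < ℓ, ∀ h j, ¬ IsSwap w A x p lev ((1 + ε) * spend x p i) ℓ' h j) ∨
      ((∀ ℓ h j, ¬ IsSwap w A x p lev ((1 + ε) * spend x p i) ℓ h j) ∧
        ∃ a₁ a₂ a₃, IsFactors w ε A x p i lev a₁ a₂ a₃ ∧
          ((a₁ = none ∧ a₂ = none ∧ a₃ = none ∧ (pass w ε A x p).val = Action.finish p) ∨
          ∃ α, IsMinFactor a₁ a₂ a₃ α ∧
            ((a₂ = some α ∧ (pass w ε A x p).val = Action.finish (raised x p lev α)) ∨
            (a₂ ≠ some α ∧ (pass w ε A x p).val = Action.raise (raised x p lev α))))))) := by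
  by_cases hpef : PEF1 (3 * ε) A x p
  · left
    refine ⟨hpef, ?_⟩
    have h := (isPEF1_val (3 * ε) A x p).mpr hpef
    unfold pass
    simp only [Timed.val_bind, op_val]
    rw [h]
    rfl
  · right
    refine ⟨hpef, ?_⟩
    have hd : (isPEF1 (3 * ε) A x p).val = false := by
      rw [← Bool.not_eq_true, isPEF1_val]; exact hpef
    rcases leastSpender_val A x p with ⟨rfl, _⟩ | ⟨i, hi, hmin⟩
    · exact absurd (fun i hi => by simp at hi) hpef
    have hlev := hierarchy_val w A x p hw hp i
    refine ⟨i, _, ⟨hmin, hlev⟩, ?_⟩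
    obtain ⟨lev, hlevdef⟩ : ∃ lev,
      lev = (buildHierarchy A x (mbbTable w p (mbbRatios w p).val).val i).val := ⟨_, rfl⟩
    rw [← hlevdef] at hlev ⊢
    obtain ⟨swaps, hswaps⟩ : ∃ swaps, swaps = (firstSwaps ε A x p
      (mbbTable w p (mbbRatios w p).val).val lev (spend x p i)).val := ⟨_, rfl⟩
    have hval : (pass w ε A x p).val = if swaps.isEmpty = true then
        (priceRise w ε A x p (mbbRatios w p).val lev (spend x p i)).val else Action.swap swaps := by
      unfold pass
      simp only [Timed.val_bind, op_val]
      rw [hd, hi]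
      simp only [Timed.val_bind, op_val, Timed.val_ite, Timed.val_pure]
      rw [← hlevdef, ← hswaps]
    have hmem := swapsAt_val w ε A x p _ (mbbTable_val w p hw hp) lev (spend x p i)
    rcases firstSwaps_val ε A x p (mbbTable w p (mbbRatios w p).val).val lev (spend x p i) with
      ⟨h1, h2⟩ | ⟨h1, ℓ, hℓ, h2, h3⟩
    · right
      rw [hswaps, h1] at hval
      simp only [List.isEmpty_nil, if_true] at hval
      refine ⟨?_, ?_⟩
      · intro ℓ h j hs
        have := (hmem ℓ h j).mpr hs
        rw [h2 ℓ (hlev.lt _ _ hs.2.1)] at this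
        simp at this
      · rw [hval]
        exact priceRise_cases w ε A x p hw hp i lev
    · left
      rw [← hswaps] at h1 h2
      rw [if_neg (by simpa using h1)] at hval
      refine ⟨swaps, ℓ, hval, h1, ?_, ?_⟩
      · intro h j hs
        rw [h2] at hs
        exact (hmem ℓ h j).mp hs
      · intro ℓ' hℓ' h j hs
        have := (hmem ℓ' h j).mpr hs
        rw [h3 ℓ' hℓ'] at this
        simp at this

/-- The time of one pass apart from the search for `α₃`. -/
def passTime (n m : ℕ) : ℕ :=
  1 + (1 + n * (m * 4 + (1 + n * (m * 4 + (m * 6 + 1))))) + n * (m * 4 + 2) + n * (m * 4 + 1) +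
    n * (m * 6 + 1) + (n * 3 + n * (n * (1 + (m * (2 + n * 4) + 2) + 1))) +
    n * (1 + (3 + n * (m * (m * 4 + 11)))) + 1 +
    (n * (m * 11) + (n * (m * 4 + m * 5 + 3) + 2) + (n * (m * 4 + 3) + 5) + (2 + m * 6 + 1))

/-- The bound `K` is demanded only in configurations that reach Phase 3 with positive least
spending, where the invariant can supply it. -/
theorem pass_time_le (w : Fin n → Fin m → ℝ) (ε : ℝ) (A : List (Fin n)) (hA : A.length ≤ n)
    (x : Fin m → Fin n) (p : Fin m → ℝ) (hw : ∀ i j, 0 ≤ w i j) (hp : ∀ j, 0 < p j) (K : ℕ)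
    (hK : ∀ i lev, IsHierarchy w A x p i lev → ¬ PEF1 (3 * ε) A x p →
      (∀ ℓ h j, ¬ IsSwap w A x p lev ((1 + ε) * spend x p i) ℓ h j) → spend x p i ≠ 0 →
      ∀ s, IsLeastOutside A x p lev s →
        sInf {t : ℕ | s / spend x p i < (1 + ε) ^ t} ≤ K) :
    (pass w ε A x p).time ≤ passTime n m + 2 * K := by
  have t1 := isPEF1_time_le A x p hA (3 * ε)
  have t2 := leastSpender_time_le A x p hA
  unfold pass passTime
  rw [Timed.time_bind, Timed.time_bind, Timed.time_bind]
  simp only [op_val, op_time]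
  split
  · rw [Timed.time_pure]; omega
  · rw [Timed.time_pure]; omega
  · next i si hd hi =>
    rcases leastSpender_val A x p with ⟨_, hn⟩ | ⟨i', hi', hmin⟩
    · rw [hn] at hi; cases hi
    rw [hi'] at hi
    cases hi
    have hpef : ¬ PEF1 (3 * ε) A x p := by
      rw [← isPEF1_val, hd]; simp
    have t3 := mbbRatios_time_le w p
    have t4 := mbbTable_time_le w p (mbbRatios w p).val
    have t5 := buildHierarchy_time_le A x hA (mbbTable w p (mbbRatios w p).val).val i
    have hlev := hierarchy_val w A x p hw hp i
    simp only [Timed.time_bind, op_time]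
    generalize (buildHierarchy A x (mbbTable w p (mbbRatios w p).val).val i).val = lev at hlev ⊢
    have t6 := firstSwaps_time_le ε A x p hA (mbbTable w p (mbbRatios w p).val).val lev
      (spend x p i)
    simp only [op_val, Timed.time_ite, Timed.time_pure]
    split_ifs with hs
    · have t7 := priceRise_time_le w ε A x p hA (mbbRatios w p).val lev (spend x p i)
      have hno : ∀ ℓ h j, ¬ IsSwap w A x p lev ((1 + ε) * spend x p i) ℓ h j := by
        intro ℓ h j hsw
        have hmem := (swapsAt_val w ε A x p _ (mbbTable_val w p hw hp) lev
          (spend x p i) ℓ h j).mpr hsw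
        rcases firstSwaps_val ε A x p (mbbTable w p (mbbRatios w p).val).val lev (spend x p i) with
          ⟨_, h2⟩ | ⟨h1, _⟩
        · rw [h2 ℓ (hlev.lt _ _ hsw.2.1)] at hmem
          simp at hmem
        · exact h1 (by simpa using hs)
      have t8 := alphaThree_time_le ε A hA x p lev (spend x p i) K
        (hK i lev ⟨hmin, hlev⟩ hpef hno)
      omega
    · omega

end

/-! ## The invariant of the main loop -/

section

variable {n m : ℕ}

/-- An input of the main loop: the values are `0` or powers of `1 + ε` with exponents at most
`N`. -/
structure IsInput (w : Fin n → Fin m → ℝ) (ε : ℝ) (A : List (Fin n)) (N : ℕ) : Prop where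
  eps_pos : 0 < ε
  eps_le : ε ≤ 1
  values : ∀ i j, w i j = 0 ∨ ∃ e : ℕ, e ≤ N ∧ w i j = (1 + ε) ^ e
  matched : IsMatchedSet w A
  covered : ∀ j, ∃ k ∈ A, 0 < w k j
  goods : (m : ℝ) ≤ (1 + ε) ^ N

theorem IsInput.nonneg {w : Fin n → Fin m → ℝ} {ε : ℝ} {A : List (Fin n)} {N : ℕ}
    (h : IsInput w ε A N) (i : Fin n) (j : Fin m) : 0 ≤ w i j := by
  have := h.eps_pos
  rcases h.values i j with e | ⟨e, _, he⟩
  · exact e.ge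
  · rw [he]; positivity

/-- This makes a tame agent harmless for the `3ε`-pEF1 test; it is where `ε ≤ 1` enters the choice
of `3ε`. -/
theorem IsInput.sq_le {w : Fin n → Fin m → ℝ} {ε : ℝ} {A : List (Fin n)} {N : ℕ}
    (h : IsInput w ε A N) : (1 + ε) ^ 2 ≤ 1 + 3 * ε := by
  nlinarith [h.eps_pos, h.eps_le]

/-- All prices of goods of agent `k` are at most `V`. -/
def Fresh (V : ℝ) (x : Fin m → Fin n) (p : Fin m → ℝ) (k : Fin n) : Prop :=
  ∀ j, x j = k → p j ≤ V

/-- The spending of agent `k`, up to one good, is at most `b`. -/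
def Tame (x : Fin m → Fin n) (p : Fin m → ℝ) (b : ℝ) (k : Fin n) : Prop :=
  bundle x k = ∅ ∨ ∃ j ∈ bundle x k, spend x p k - p j ≤ b

theorem Tame.mono {x : Fin m → Fin n} {p : Fin m → ℝ} {b b' : ℝ} {k : Fin n}
    (h : Tame x p b k) (hb : b ≤ b') : Tame x p b' k := by
  rcases h with h | ⟨j, hj, h⟩
  · exact Or.inl h
  · exact Or.inr ⟨j, hj, h.trans hb⟩

theorem tame_of_spend_le {x : Fin m → Fin n} {p : Fin m → ℝ} {b : ℝ} {k : Fin n}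
    (hp : ∀ j, 0 < p j) (h : spend x p k ≤ b) : Tame x p b k := by
  by_cases hb : bundle x k = ∅
  · exact Or.inl hb
  · obtain ⟨j, hj⟩ := Finset.nonempty_iff_ne_empty.mpr hb
    exact Or.inr ⟨j, hj, by linarith [hp j]⟩

/-- Agent `k` is fresh or tame, relative to the least spending `s`. -/
def Ok (V ε : ℝ) (x : Fin m → Fin n) (p : Fin m → ℝ) (s : ℝ) (k : Fin n) : Prop :=
  Fresh V x p k ∨ Tame x p ((1 + ε) ^ 2 * s) k

/-- Agent `h` at level `a + 1` has received a good and will pass one on to level `a`. -/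
structure Pending (w : Fin n → Fin m → ℝ) (ε : ℝ) (A : List (Fin n)) (V : ℝ) (x : Fin m → Fin n)
    (p : Fin m → ℝ) (i : Fin n) (lev : Fin n → Option ℕ) (h : Fin n) (a : ℕ) : Prop where
  least_le : spend x p i ≤ m * V
  level : lev h = some (a + 1)
  others : ∀ k ∈ A, k ≠ h → Ok V ε x p (spend x p i) k
  available : ∃ u j, IsSwap w A x p lev ((1 + ε) * spend x p i) a u j
  unique : ∀ r ≤ a, ∀ u j, IsSwap w A x p lev ((1 + ε) * spend x p i) r u j → x j = h
  restore : ∀ u j, u ∈ A → lev u = some a → IsMBB w p u j → x j = h →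
    ∃ j', j' ≠ j ∧ x j' = h ∧ spend x p h - p j - p j' ≤ (1 + ε) * spend x p i

/-- The invariant of the main loop. -/
structure Inv (w : Fin n → Fin m → ℝ) (ε : ℝ) (A : List (Fin n)) (N : ℕ) (x : Fin m → Fin n)
    (p : Fin m → ℝ) : Prop where
  own : ∀ j, x j ∈ A
  price : ∀ j, ∃ z : ℕ, p j = (1 + ε) ^ z
  mbb : ∀ j, IsMBB w p (x j) j
  status : ∀ i lev, IsHierarchy w A x p i lev →
    (∀ k ∈ A, Ok ((1 + ε) ^ N) ε x p (spend x p i) k) ∨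
      ∃ h a, Pending w ε A ((1 + ε) ^ N) x p i lev h a

/-! ### Spendings -/

theorem spend_nonneg {p : Fin m → ℝ} (hp : ∀ j, 0 < p j) (x : Fin m → Fin n) (k : Fin n) :
    0 ≤ spend x p k := Finset.sum_nonneg fun j _ => (hp j).le

theorem le_spend {p : Fin m → ℝ} (hp : ∀ j, 0 < p j) {x : Fin m → Fin n} {k : Fin n} {j : Fin m}
    (h : x j = k) : p j ≤ spend x p k :=
  Finset.single_le_sum (f := p) (fun j _ => (hp j).le) (mem_bundle.mpr h)

theorem add_le_spend {p : Fin m → ℝ} (hp : ∀ j, 0 < p j) {x : Fin m → Fin n} {k : Fin n}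
    {j j' : Fin m} (h : x j = k) (h' : x j' = k) (hne : j ≠ j') : p j + p j' ≤ spend x p k := by
  have : ∑ a ∈ {j, j'}, p a ≤ spend x p k := by
    refine Finset.sum_le_sum_of_subset_of_nonneg ?_ fun j _ _ => (hp j).le
    intro a ha
    simp only [Finset.mem_insert, Finset.mem_singleton] at ha
    rcases ha with rfl | rfl
    · exact mem_bundle.mpr h
    · exact mem_bundle.mpr h'
  rwa [Finset.sum_pair hne] at this

theorem spend_eq_zero_iff {p : Fin m → ℝ} (hp : ∀ j, 0 < p j) {x : Fin m → Fin n} {k : Fin n} :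
    spend x p k = 0 ↔ bundle x k = ∅ := by
  constructor
  · intro h
    rw [bundle_eq_empty_iff]
    intro j hj
    have := le_spend hp hj
    linarith [hp j]
  · intro h; simp [spend, h]

theorem Fresh.spend_le {V : ℝ} (hV : 0 ≤ V) {x : Fin m → Fin n} {p : Fin m → ℝ} {k : Fin n}
    (h : Fresh V x p k) : spend x p k ≤ m * V := by
  have h1 : spend x p k ≤ ∑ _j ∈ bundle x k, V :=
    Finset.sum_le_sum fun j hj => h j (mem_bundle.mp hj)
  rw [Finset.sum_const, nsmul_eq_mul] at h1
  refine h1.trans (mul_le_mul_of_nonneg_right ?_ hV)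
  have : (bundle x k).card ≤ m := by simpa using Finset.card_le_univ (bundle x k)
  exact_mod_cast this

section Update

variable {x : Fin m → Fin n} {j : Fin m} {h : Fin n}

theorem bundle_update_of_ne {k : Fin n} (hk : k ≠ h) (hk' : k ≠ x j) :
    bundle (Function.update x j h) k = bundle x k := by
  ext a
  rw [mem_bundle, mem_bundle]
  by_cases ha : a = j
  · subst ha
    rw [Function.update_self]
    exact ⟨fun e => absurd e.symm hk, fun e => absurd e.symm hk'⟩
  · rw [Function.update_of_ne ha]

theorem bundle_update_receiver (hne : h ≠ x j) :
    bundle (Function.update x j h) h = insert j (bundle x h) := by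
  ext a
  rw [mem_bundle, Finset.mem_insert, mem_bundle]
  by_cases ha : a = j
  · subst ha; simp
  · rw [Function.update_of_ne ha]; simp [ha]

theorem bundle_update_giver (hne : h ≠ x j) :
    bundle (Function.update x j h) (x j) = (bundle x (x j)).erase j := by
  ext a
  rw [mem_bundle, Finset.mem_erase, mem_bundle]
  by_cases ha : a = j
  · subst ha; simp [hne]
  · rw [Function.update_of_ne ha]; simp [ha]

theorem spend_update_of_ne (p : Fin m → ℝ) {k : Fin n} (hk : k ≠ h) (hk' : k ≠ x j) :
    spend (Function.update x j h) p k = spend x p k := by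
  rw [spend, bundle_update_of_ne hk hk', spend]

theorem spend_update_receiver (p : Fin m → ℝ) (hne : h ≠ x j) :
    spend (Function.update x j h) p h = spend x p h + p j := by
  rw [spend, bundle_update_receiver hne, Finset.sum_insert, add_comm, spend]
  rw [mem_bundle]; exact hne.symm

theorem spend_update_giver (p : Fin m → ℝ) (hne : h ≠ x j) :
    spend (Function.update x j h) p (x j) = spend x p (x j) - p j := by
  rw [spend, bundle_update_giver hne, Finset.sum_erase_eq_sub, spend]
  rw [mem_bundle]

end Update

/-! ### Swaps -/

section Swap

variable {w : Fin n → Fin m → ℝ} {A : List (Fin n)} {x : Fin m → Fin n} {p : Fin m → ℝ}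
  {lev lev' : Fin n → Option ℕ} {i h : Fin n} {j : Fin m} {ℓ : ℕ} {c : ℝ}

theorem IsSwap.ne (hs : IsSwap w A x p lev c ℓ h j) : h ≠ x j := by
  intro e
  have h1 := hs.2.1
  rw [e, hs.2.2.2.1] at h1
  have := Option.some.inj h1
  omega

/-- A swap does not lower the levels. -/
theorem IsSwap.level_le (hs : IsSwap w A x p lev c ℓ h j) (hl : IsLevel (MBBEdge w A x p) i lev)
    (hl' : IsLevel (MBBEdge w A (Function.update x j h) p) i lev') (k : Fin n) (r : ℕ)
    (hk : lev' k = some r) : ∃ r₀, r₀ ≤ r ∧ lev k = some r₀ := by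
  induction r generalizing k with
  | zero => exact ⟨0, le_rfl, by rw [hl'.zero k hk]; exact hl.root⟩
  | succ r ih =>
    obtain ⟨u, hu, huA, a, ha, hmbb⟩ := hl'.pred k r hk
    obtain ⟨r₀, hr₀, hu₀⟩ := ih u hu
    obtain ⟨r₁, hr₁, hx⟩ := hl.succ u (x a) r₀ hu₀ ⟨huA, a, rfl, hmbb⟩
    -- The only edges created lead to the new owner `h` of `j`. An agent with such an edge formerly
    -- reached level `ℓ + 1` by it, so it was at level at least `ℓ`, and the new edge gives no
    -- shortcut to `h`.
    by_cases haj : a = j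
    · subst haj
      rw [Function.update_self] at ha
      rw [hs.2.2.2.1] at hx
      have := Option.some.inj hx
      exact ⟨ℓ, by omega, by rw [← ha]; exact hs.2.1⟩
    · rw [Function.update_of_ne haj] at ha
      exact ⟨r₁, by omega, by rw [← ha]; exact hx⟩

/-- A swap keeps the levels up to that of the receiver. -/
theorem IsSwap.level_eq (hs : IsSwap w A x p lev c ℓ h j) (hl : IsLevel (MBBEdge w A x p) i lev)
    (hl' : IsLevel (MBBEdge w A (Function.update x j h) p) i lev') (k : Fin n) (r : ℕ)
    (hr : r ≤ ℓ) (hk : lev k = some r) : lev' k = some r := by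
  induction r generalizing k with
  | zero => rw [hl.zero k hk]; exact hl'.root
  | succ r ih =>
    obtain ⟨u, hu, huA, a, ha, hmbb⟩ := hl.pred k r hk
    -- Shortest paths to levels up to `ℓ` do not use `j`, whose former owner is at level `ℓ + 1`.
    have haj : a ≠ j := by
      rintro rfl
      have h4 := hs.2.2.2.1
      rw [ha, hk] at h4
      have := Option.some.inj h4
      omega
    obtain ⟨r', hr', hk'⟩ := hl'.succ u k r (ih u (by omega) hu)
      ⟨huA, a, by rw [Function.update_of_ne haj]; exact ha, hmbb⟩
    obtain ⟨r₀, hr₀, hk₀⟩ := hs.level_le hl hl' k r' hk'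
    rw [hk] at hk₀
    have := Option.some.inj hk₀
    rw [hk']
    congr 1
    omega

theorem IsSwap.level_eq' (hs : IsSwap w A x p lev c ℓ h j) (hl : IsLevel (MBBEdge w A x p) i lev)
    (hl' : IsLevel (MBBEdge w A (Function.update x j h) p) i lev') (k : Fin n) (r : ℕ)
    (hr : r ≤ ℓ) (hk : lev' k = some r) : lev k = some r := by
  obtain ⟨r₀, hr₀, hk₀⟩ := hs.level_le hl hl' k r hk
  have := hs.level_eq hl hl' k r₀ (hr₀.trans hr) hk₀
  rw [hk₀, ← this, hk]

/-- The giver keeps more than `c`, hence at least the least spending, and nobody else loses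
anything. -/
theorem IsSwap.le_spend (hp : ∀ j, 0 < p j) (hs : IsSwap w A x p lev c ℓ h j)
    (hi : IsFirstMin A (spend x p) i) (hc : spend x p i ≤ c) (k : Fin n) (hk : k ∈ A) :
    spend x p i ≤ spend (Function.update x j h) p k := by
  by_cases hkh : k = h
  · rw [hkh, spend_update_receiver p hs.ne]
    have := hi.le hs.1
    linarith [hp j]
  · by_cases hkx : k = x j
    · rw [hkx, spend_update_giver p hs.ne]
      exact hc.trans hs.2.2.2.2.le
    · rw [spend_update_of_ne p hkh hkx]
      exact hi.le hk

/-- The least spender gives nothing away. -/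
theorem IsSwap.giver_ne (hp : ∀ j, 0 < p j) (hs : IsSwap w A x p lev c ℓ h j)
    (hc : spend x p i ≤ c) : i ≠ x j := by
  intro e
  have := hs.2.2.2.2
  rw [← e] at this
  linarith [hp j]

/-- Giver and receiver both end strictly above the least spending, so they cannot interfere with the
tie-breaking rule. -/
theorem IsSwap.firstMin (hp : ∀ j, 0 < p j) (hs : IsSwap w A x p lev c ℓ h j)
    (hi : IsFirstMin A (spend x p) i) (hc : spend x p i ≤ c) (hhi : h ≠ i) :
    spend (Function.update x j h) p i = spend x p i ∧
      IsFirstMin A (spend (Function.update x j h) p) i := by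
  have e := spend_update_of_ne p hhi.symm (hs.giver_ne hp hc)
  refine ⟨e, hi.1, fun k hk => ?_⟩
  rw [e]
  by_cases hkh : k = h
  · left
    rw [hkh, spend_update_receiver p hs.ne]
    have := hi.le hs.1
    linarith [hp j]
  · by_cases hkx : k = x j
    · left
      rw [hkx, spend_update_giver p hs.ne]
      exact hc.trans_lt hs.2.2.2.2
    · rw [spend_update_of_ne p hkh hkx]
      exact hi.2 k hk

/-- If the good given away is the one whose removal made the bundle small, then what remains is
already small. -/
theorem Tame.giver (hp : ∀ j, 0 < p j) {b : ℝ} (hne : h ≠ x j) (ht : Tame x p b (x j)) :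
    Tame (Function.update x j h) p b (x j) := by
  rcases ht with ht | ⟨a, ha, ht⟩
  · rw [bundle_eq_empty_iff] at ht
    exact absurd rfl (ht j)
  · by_cases haj : a = j
    · subst haj
      exact tame_of_spend_le hp (by rw [spend_update_giver p hne]; exact ht)
    · right
      refine ⟨a, by rw [bundle_update_giver hne]; simp [haj, mem_bundle.mp ha], ?_⟩
      rw [spend_update_giver p hne]
      linarith [hp j]

theorem Fresh.giver {V : ℝ} (hne : h ≠ x j) (hf : Fresh V x p (x j)) :
    Fresh V (Function.update x j h) p (x j) := by
  intro a ha
  by_cases haj : a = j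
  · subst haj; rw [Function.update_self] at ha; exact absurd ha hne
  · rw [Function.update_of_ne haj] at ha; exact hf a ha

theorem Ok.of_bundle_eq {V ε s : ℝ} {x' : Fin m → Fin n} {k : Fin n}
    (hb : bundle x' k = bundle x k) (ho : Ok V ε x p s k) : Ok V ε x' p s k := by
  rcases ho with ho | ho
  · left
    intro a ha
    rw [← mem_bundle, hb, mem_bundle] at ha
    exact ho a ha
  · right
    unfold Tame spend at *
    rwa [hb]

theorem Ok.mono {V ε s s' : ℝ} {k : Fin n} (ho : Ok V ε x p s k) (hs : s ≤ s') :
    Ok V ε x p s' k := by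
  rcases ho with ho | ho
  · exact Or.inl ho
  · exact Or.inr (ho.mono (mul_le_mul_of_nonneg_left hs (sq_nonneg _)))

end Swap

/-! ### The invariant survives a transfer. -/

section

variable {w : Fin n → Fin m → ℝ} {ε : ℝ} {A : List (Fin n)} {N : ℕ} {x : Fin m → Fin n}
  {p : Fin m → ℝ} {lev : Fin n → Option ℕ} {i : Fin n}

theorem Inv.price_pos (hI : IsInput w ε A N) (hv : Inv w ε A N x p) (j : Fin m) : 0 < p j := by
  obtain ⟨z, hz⟩ := hv.price j
  have := hI.eps_pos
  rw [hz]; positivity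

theorem Inv.one_le_price (hI : IsInput w ε A N) (hv : Inv w ε A N x p) (j : Fin m) :
    1 ≤ p j := by
  obtain ⟨z, hz⟩ := hv.price j
  rw [hz]
  exact one_le_pow₀ (by linarith [hI.eps_pos])

/-- If no agent is pending and the main loop goes on, then a fresh agent is envied. -/
theorem exists_fresh_violator (hI : IsInput w ε A N) (hp : ∀ j, 0 < p j)
    (hi : IsFirstMin A (spend x p) i) (hpef : ¬ PEF1 (3 * ε) A x p)
    (hok : ∀ k ∈ A, Ok ((1 + ε) ^ N) ε x p (spend x p i) k) :
    ∃ k ∈ A, Fresh ((1 + ε) ^ N) x p k ∧ (bundle x k).Nonempty ∧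
      ∀ j ∈ bundle x k, (1 + 3 * ε) * spend x p i < spend x p k - p j := by
  unfold PEF1 at hpef
  push Not at hpef
  obtain ⟨i₁, hi₁, k, hk, hne, hall⟩ := hpef
  have he := hI.eps_pos
  have hall' : ∀ j ∈ bundle x k, (1 + 3 * ε) * spend x p i < spend x p k - p j := fun j hj =>
    lt_of_le_of_lt (mul_le_mul_of_nonneg_left (hi.le hi₁) (by linarith)) (hall j hj)
  refine ⟨k, hk, ?_, hne, hall'⟩
  refine (hok k hk).resolve_right ?_
  rintro (h | ⟨j, hj, h⟩)
  · exact hne.ne_empty h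
  · have h1 := hall' j hj
    have h2 := mul_le_mul_of_nonneg_right hI.sq_le (spend_nonneg hp x i)
    linarith

/-- With no pending agent, a pEF1 violator is fresh and its bundle bounds the least spending. With a
pending agent no violator needs to be fresh, so the bound is carried along in `Pending` from the
moment before the chain of transfers began. -/
theorem Inv.least_le (hI : IsInput w ε A N) (hv : Inv w ε A N x p)
    (hH : IsHierarchy w A x p i lev) (hpef : ¬ PEF1 (3 * ε) A x p) :
    spend x p i ≤ m * (1 + ε) ^ N := by
  have he := hI.eps_pos
  have hp := hv.price_pos hI
  rcases hv.status i lev hH with hok | ⟨h, a, hpend⟩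
  · obtain ⟨k, hk, hf, ⟨j, hj⟩, hall⟩ := exists_fresh_violator hI hp hH.least hpef hok
    have h1 := hf.spend_le (by positivity)
    have h2 := hall j hj
    have h3 := mul_nonneg he.le (spend_nonneg hp x i)
    linarith [hp j]
  · exact hpend.least_le

/-- A transfer can harm only its receiver `h`. If `h` is the least spender, its bundle without the
new good is its old one, so it is tame. If another receiver is no longer fresh or tame, it becomes
pending: the edge leading to it from the level below now offers a transfer, all transfers down there
must take from `h`, and any of them restores `h` because no transfer was available below level `ℓ`
before. A previously pending agent is the giver of the present transfer. -/
theorem Inv.swap {h : Fin n} {j : Fin m} {ℓ : ℕ} (hI : IsInput w ε A N) (hv : Inv w ε A N x p)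
    (hH : IsHierarchy w A x p i lev) (hpef : ¬ PEF1 (3 * ε) A x p)
    (hs : IsSwap w A x p lev ((1 + ε) * spend x p i) ℓ h j)
    (hbelow : ∀ ℓ' < ℓ, ∀ h j, ¬ IsSwap w A x p lev ((1 + ε) * spend x p i) ℓ' h j) :
    Inv w ε A N (Function.update x j h) p := by
  have he := hI.eps_pos
  have hp := hv.price_pos hI
  have hle := hv.least_le hI hH hpef
  have hs0 := spend_nonneg hp x i
  have hc : spend x p i ≤ (1 + ε) * spend x p i := by nlinarith
  have hc2 : (1 + ε) * spend x p i ≤ (1 + ε) ^ 2 * spend x p i := by nlinarith [mul_nonneg he.le hs0]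
  have hne := hs.ne
  -- all agents other than the receiver are fresh or tame afterwards
  have hothers : ∀ k ∈ A, k ≠ h → Ok ((1 + ε) ^ N) ε (Function.update x j h) p (spend x p i) k := by
    intro k hk hkh
    rcases hv.status i lev hH with hok | ⟨h₀, a, hpend⟩
    · by_cases hkx : k = x j
      · rw [hkx]
        rcases hok (x j) (hv.own j) with ho | ho
        · exact Or.inl (ho.giver hne)
        · exact Or.inr (ho.giver hp hne)
      · exact (hok k hk).of_bundle_eq (bundle_update_of_ne hkh hkx)
    · obtain ⟨u, j₀, hu⟩ := hpend.available
      -- Minimality of `ℓ` puts the transfer at level at most `a`; uniqueness makes the pending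
      -- agent its giver, and then its level forces `ℓ = a`.
      have hla : ℓ ≤ a := not_lt.mp fun hlt => hbelow a hlt u j₀ hu
      have hxj := hpend.unique ℓ hla h j hs
      by_cases hkx : k = x j
      · rw [hkx]
        have hlv := hpend.level
        rw [← hxj, hs.2.2.2.1] at hlv
        have hla' : ℓ = a := by have := Option.some.inj hlv; omega
        obtain ⟨j', hj', hxj', hr⟩ := hpend.restore h j hs.1 (by rw [← hla']; exact hs.2.1)
          hs.2.2.1 hxj
        right
        refine Or.inr ⟨j', ?_, ?_⟩
        · rw [bundle_update_giver hne, Finset.mem_erase, mem_bundle]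
          exact ⟨hj', hxj'.trans hxj.symm⟩
        · rw [spend_update_giver p hne, hxj]
          exact hr.trans hc2
      · exact (hpend.others k hk (fun e => hkx (e.trans hxj.symm))).of_bundle_eq
          (bundle_update_of_ne hkh hkx)
  refine ⟨?_, hv.price, ?_, ?_⟩
  · intro a
    by_cases ha : a = j
    · subst ha; rw [Function.update_self]; exact hs.1
    · rw [Function.update_of_ne ha]; exact hv.own a
  · intro a
    by_cases ha : a = j
    · subst ha; rw [Function.update_self]; exact hs.2.2.1
    · rw [Function.update_of_ne ha]; exact hv.mbb a
  · intro i' lev' hH'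
    by_cases hhi : h = i
    · left
      subst hhi
      have hmono := hs.le_spend hp hH.least hc i' hH'.least.1
      intro k hk
      by_cases hkh : k = h
      · right
        right
        refine ⟨j, by rw [mem_bundle, hkh, Function.update_self], ?_⟩
        rw [hkh, spend_update_receiver p hne]
        have := mul_le_mul_of_nonneg_left hmono (sq_nonneg (1 + ε))
        linarith
      · exact (hothers k hk hkh).mono hmono
    · obtain ⟨e, hmin⟩ := hs.firstMin hp hH.least hc hhi
      have hii : i' = i := hH'.least.unique hmin
      subst hii
      rw [e]
      by_cases hokh : Ok ((1 + ε) ^ N) ε (Function.update x j h) p (spend x p i') h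
      · left
        intro k hk
        by_cases hkh : k = h
        · rw [hkh]; exact hokh
        · exact hothers k hk hkh
      · right
        -- The receiver is not the root, so its level is positive and a level below it exists for
        -- passing a good on.
        obtain ⟨a, rfl⟩ : ∃ a, ℓ = a + 1 := by
          rcases ℓ with _ | a
          · exact absurd (hH.level.zero h hs.2.1) hhi
          · exact ⟨a, rfl⟩
        have hlh := hs.level_eq hH.level hH'.level h (a + 1) le_rfl hs.2.1
        refine ⟨h, a, ⟨by rw [e]; exact hle, hlh, by rw [e]; exact hothers, ?_, ?_, ?_⟩⟩
        · obtain ⟨u, hu, huA, b, hb, hmbb⟩ := hH'.level.pred h a hlh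
          refine ⟨u, b, huA, hu, hmbb, by rw [hb]; exact hlh, ?_⟩
          rw [e, hb]
          by_contra hcon
          exact hokh (Or.inr (Or.inr ⟨b, mem_bundle.mpr hb, (not_lt.mp hcon).trans hc2⟩))
        -- A transfer at level at most `a` that does not take from `h` involves only levels up to
        -- `ℓ` and an unchanged spending. It would have been available before, against the
        -- minimality of `ℓ`.
        · intro r hr u b hsw
          by_contra hbh
          have hbj : b ≠ j := by
            rintro rfl
            rw [Function.update_self] at hbh
            exact hbh rfl
          obtain ⟨h1, h2, h3, h4, h5⟩ := hsw
          rw [Function.update_of_ne hbj] at h4 h5 hbh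
          have h2' := hs.level_eq' hH.level hH'.level u r (by omega) h2
          have h4' := hs.level_eq' hH.level hH'.level (x b) (r + 1) (by omega) h4
          have hbx : x b ≠ x j := by
            intro e'
            rw [e', hs.2.2.2.1] at h4'
            have := Option.some.inj h4'
            omega
          rw [spend_update_of_ne p hbh hbx, e] at h5
          exact hbelow r (by omega) u b ⟨h1, h2', h3, h4', h5⟩
        · intro u b huA hu hmbb hb
          have hu' := hs.level_eq' hH.level hH'.level u a (by omega) hu
          have hbj : b ≠ j := by
            rintro rfl
            obtain ⟨r, hr, hx⟩ := hH.level.succ u (x b) a hu' ⟨huA, b, rfl, hmbb⟩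
            rw [hs.2.2.2.1] at hx
            have := Option.some.inj hx
            omega
          rw [Function.update_of_ne hbj] at hb
          -- Removing `b` and the new good `j` leaves the old bundle of `h` without `b`. Its price
          -- is at most `(1 + ε)` times the least spending, since otherwise `b` could have been
          -- transferred below level `ℓ`.
          refine ⟨j, hbj.symm, Function.update_self _ _ _, ?_⟩
          rw [spend_update_receiver p hne, e]
          by_contra hcon
          refine hbelow a (by omega) u b ⟨huA, hu', hmbb, by rw [hb]; exact hs.2.1, ?_⟩
          rw [hb]
          linarith

end

end

/-! ## Price-rises -/

section

variable {n m : ℕ} {w : Fin n → Fin m → ℝ} {ε : ℝ} {A : List (Fin n)} {N : ℕ} {x : Fin m → Fin n}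
  {p : Fin m → ℝ} {lev : Fin n → Option ℕ} {i : Fin n} {a₁ a₂ a₃ : Option ℝ} {α : ℝ}

/-- No transfer of Phase 2 is possible. -/
def NoSwap (w : Fin n → Fin m → ℝ) (ε : ℝ) (A : List (Fin n)) (x : Fin m → Fin n) (p : Fin m → ℝ)
    (i : Fin n) (lev : Fin n → Option ℕ) : Prop :=
  ∀ ℓ h j, ¬ IsSwap w A x p lev ((1 + ε) * spend x p i) ℓ h j

theorem spend_raised (k : Fin n) :
    spend x (raised x p lev α) k =
      if (lev k).isSome = true then α * spend x p k else spend x p k := by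
  unfold spend
  split_ifs with h
  · rw [Finset.mul_sum]
    refine Finset.sum_congr rfl fun j hj => ?_
    rw [raised, mem_bundle.mp hj, if_pos h]
  · refine Finset.sum_congr rfl fun j hj => ?_
    rw [raised, mem_bundle.mp hj, if_neg h]

theorem IsHierarchy.mem (hH : IsHierarchy w A x p i lev) (own : ∀ j, x j ∈ A) (k : Fin n)
    (hk : (lev k).isSome = true) : k ∈ A := by
  obtain ⟨r, hr⟩ := Option.isSome_iff_exists.mp hk
  rcases r with _ | r
  · rw [hH.level.zero k hr]; exact hH.least.1
  · obtain ⟨u, _, _, j, hj, _⟩ := hH.level.pred k r hr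
    rw [← hj]; exact own j

theorem IsHierarchy.owner (hH : IsHierarchy w A x p i lev) (own : ∀ j, x j ∈ A) {h : Fin n}
    {j : Fin m} (hh : (lev h).isSome = true) (hj : IsMBB w p h j) :
    (lev (x j)).isSome = true := by
  obtain ⟨r, hr⟩ := Option.isSome_iff_exists.mp hh
  obtain ⟨r', _, h'⟩ := hH.level.succ h (x j) r hr ⟨hH.mem own h hh, j, rfl, hj⟩
  rw [h']; rfl

/-- Some good of an agent in the hierarchy, other than the least spender, can be removed. -/
theorem NoSwap.exists_good (hno : NoSwap w ε A x p i lev) (hH : IsHierarchy w A x p i lev)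
    {k : Fin n} (hk : (lev k).isSome = true) (hki : k ≠ i) :
    ∃ j ∈ bundle x k, spend x p k - p j ≤ (1 + ε) * spend x p i := by
  obtain ⟨r, hr⟩ := Option.isSome_iff_exists.mp hk
  rcases r with _ | r
  · exact absurd (hH.level.zero k hr) hki
  · obtain ⟨u, hu, huA, j, hj, hmbb⟩ := hH.level.pred k r hr
    refine ⟨j, mem_bundle.mpr hj, not_lt.mp fun hlt => hno r u j ?_⟩
    exact ⟨huA, hu, hmbb, by rw [hj]; exact hr, by rw [hj]; exact hlt⟩

/-- The good on the edge that discovered the agent works as the removed one; the root needs no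
removal. -/
theorem NoSwap.tame (hI : IsInput w ε A N) (hp : ∀ j, 0 < p j) (hno : NoSwap w ε A x p i lev)
    (hH : IsHierarchy w A x p i lev) {k : Fin n} (hk : (lev k).isSome = true) :
    Tame x p ((1 + ε) * spend x p i) k := by
  by_cases hki : k = i
  · rw [hki]
    exact tame_of_spend_le hp (by nlinarith [mul_nonneg hI.eps_pos.le (spend_nonneg hp x i)])
  · exact Or.inr (hno.exists_good hH hk hki)

/-- The configurations in which a price-rise happens. -/
structure IsRise (w : Fin n → Fin m → ℝ) (ε : ℝ) (A : List (Fin n)) (N : ℕ) (x : Fin m → Fin n)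
    (p : Fin m → ℝ) (i : Fin n) (lev : Fin n → Option ℕ) : Prop where
  input : IsInput w ε A N
  inv : Inv w ε A N x p
  hier : IsHierarchy w A x p i lev
  notPEF1 : ¬ PEF1 (3 * ε) A x p
  noSwap : NoSwap w ε A x p i lev

namespace IsRise

variable (hR : IsRise w ε A N x p i lev)

include hR

theorem pos (j : Fin m) : 0 < p j := hR.inv.price_pos hR.input j

theorem spend_nn (k : Fin n) : 0 ≤ spend x p k := spend_nonneg hR.pos x k

theorem ok : ∀ k ∈ A, Ok ((1 + ε) ^ N) ε x p (spend x p i) k := by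
  rcases hR.inv.status i lev hR.hier with hok | ⟨h, a, hpend⟩
  · exact hok
  · obtain ⟨u, j, hu⟩ := hpend.available
    exact absurd hu (hR.noSwap a u j)

/-- Agents of the hierarchy are price-envied by a factor at most `1 + ε`, so a violator of `3ε`-pEF1
lies outside it. Its freshness bounds the search for `α₃`, and its mere existence makes `α₂ > 1`. -/
theorem violator : ∃ k ∈ A, lev k = none ∧ Fresh ((1 + ε) ^ N) x p k ∧ (bundle x k).Nonempty ∧
    ∀ j ∈ bundle x k, (1 + 3 * ε) * spend x p i < spend x p k - p j := by
  obtain ⟨k, hk, hf, hne, hall⟩ := exists_fresh_violator hR.input hR.pos hR.hier.least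
    hR.notPEF1 hR.ok
  refine ⟨k, hk, ?_, hf, hne, hall⟩
  by_contra hl
  have he := hR.input.eps_pos
  rcases hR.noSwap.tame hR.input hR.pos hR.hier (Option.isSome_iff_ne_none.mpr hl) with h | h
  · exact hne.ne_empty h
  · obtain ⟨j, hj, h⟩ := h
    have := hall j hj
    nlinarith [mul_nonneg he.le (hR.spend_nn i)]

theorem one_le_least (hs : spend x p i ≠ 0) : 1 ≤ spend x p i := by
  have : bundle x i ≠ ∅ := fun h => hs ((spend_eq_zero_iff hR.pos).mpr h)
  obtain ⟨j, hj⟩ := Finset.nonempty_iff_ne_empty.mpr this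
  exact (hR.inv.one_le_price hR.input j).trans (le_spend hR.pos (mem_bundle.mp hj))

/-- The search for `α₃` is short. -/
theorem search_le (hs : spend x p i ≠ 0) (s : ℝ) (hl : IsLeastOutside A x p lev s) :
    sInf {t : ℕ | s / spend x p i < (1 + ε) ^ t} ≤ 2 * N + 1 := by
  have he := hR.input.eps_pos
  refine Nat.sInf_le ?_
  rw [Set.mem_ofPred_eq, div_lt_iff₀ (lt_of_lt_of_le one_pos (hR.one_le_least hs))]
  -- The least spending outside is at most that of a fresh agent, hence at most `(1 + ε) ^ (2 * N)`,
  -- and the divisor is at least `1`. The test is strict, which costs one more power.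
  obtain ⟨k, hk, hlk, hf, -, -⟩ := hR.violator
  have h1 := hl.2 k hk hlk
  have h2 := hf.spend_le (by positivity)
  have h3 : (m : ℝ) * (1 + ε) ^ N ≤ (1 + ε) ^ N * (1 + ε) ^ N :=
    mul_le_mul_of_nonneg_right hR.input.goods (by positivity)
  have h4 : (1 + ε) ^ N * (1 + ε) ^ N < (1 + ε) ^ (2 * N + 1) := by
    rw [← pow_add]
    exact pow_lt_pow_right₀ (by linarith) (by omega)
  have h5 : (1 + ε) ^ (2 * N + 1) ≤ (1 + ε) ^ (2 * N + 1) * spend x p i :=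
    le_mul_of_one_le_right (by positivity) (hR.one_le_least hs)
  linarith

/-- If the factor were at most `1`, the outside good would already have maximum bang per buck and
its owner would be in the hierarchy. -/
theorem lt_of_newEdge {s : ℝ} (hs : IsNewEdgeFactor w A x p lev s) : 1 < s := by
  obtain ⟨h, hA, j, j₁, h1, h2, h3, h4, rfl⟩ := hs
  have hp := hR.pos
  rw [one_lt_div (div_pos h3 (hp j))]
  by_contra hle
  rw [not_lt] at hle
  have := hR.hier.owner hR.inv.own h1 fun j' => (h4 j').trans hle
  rw [h2] at this
  cases this

variable (hF : IsFactors w ε A x p i lev a₁ a₂ a₃)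

include hF

/-- At least one of the factors is finite. -/
theorem factors_ne_none : ¬ (a₁ = none ∧ a₂ = none ∧ a₃ = none) := by
  classical
  rintro ⟨rfl, rfl, rfl⟩
  have hs : spend x p i = 0 := by
    rcases hF.two with h | ⟨_, _, _, h⟩
    · exact h.1
    · cases h
  have hp := hR.pos
  -- Without a finite `α₁`, all goods valued in the hierarchy are owned in it. Hall's condition then
  -- gives it at least as many goods as agents.
  have hall := hR.input.matched.hall (Finset.univ.filter fun k => (lev k).isSome = true)
    (Finset.univ.filter fun j => (lev (x j)).isSome = true)
    (fun k hk => hR.hier.mem hR.inv.own k (Finset.mem_filter.mp hk).2)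
    (by
      intro k hk j hj
      rw [Finset.mem_filter] at hk ⊢
      refine ⟨Finset.mem_univ _, ?_⟩
      by_contra hl
      rw [Bool.not_eq_true, Option.isSome_eq_false_iff, Option.isNone_iff_eq_none] at hl
      have : Nonempty (Fin m) := ⟨j⟩
      obtain ⟨j₁, hj₁⟩ := Finite.exists_max fun j => w k j / p j
      obtain ⟨a, ha, _⟩ := hF.one.2 _ ⟨k, hR.hier.mem hR.inv.own k hk.2, j, j₁, hk.2, hl, hj,
        hj₁, rfl⟩
      cases ha)
  have hi : i ∈ Finset.univ.filter fun k => (lev k).isSome = true := by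
    simp [hR.hier.level.root]
  have hb := (spend_eq_zero_iff hp).mp hs
  rw [bundle_eq_empty_iff] at hb
  -- When the least spending is zero and no transfer is possible, every other agent of the hierarchy
  -- owns a single good and `i` owns none. So there are fewer goods than agents, a contradiction.
  have hlt : (Finset.univ.filter fun j => (lev (x j)).isSome = true).card ≤
      ((Finset.univ.filter fun k => (lev k).isSome = true).erase i).card := by
    refine Finset.card_le_card_of_injOn x ?_ ?_
    · intro j hj
      rw [Finset.mem_coe, Finset.mem_filter] at hj
      rw [Finset.mem_coe, Finset.mem_erase, Finset.mem_filter]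
      exact ⟨hb j, Finset.mem_univ _, hj.2⟩
    · intro j hj j' hj' e
      rw [Finset.mem_coe, Finset.mem_filter] at hj
      obtain ⟨a, ha, hle⟩ := hR.noSwap.exists_good hR.hier hj.2 (hb j)
      rw [hs, mul_zero] at hle
      have hone : ∀ c, x c = x j → c = a := by
        intro c hc
        by_contra hne
        have := add_le_spend hp hc (mem_bundle.mp ha) hne
        linarith [hp c]
      exact (hone j rfl).trans (hone j' e.symm).symm
  rw [Finset.card_erase_of_mem hi] at hlt
  have := Finset.card_pos.mpr ⟨i, hi⟩
  omega

variable (hα : IsMinFactor a₁ a₂ a₃ α)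

include hα

/-- For `α₂` the pEF1 violator outside the hierarchy decides; for `α₃` the strict inequality in its
definition, as no one outside spends less than `i`. -/
theorem one_lt : 1 < α := by
  have he := hR.input.eps_pos
  rcases hα.mem with h | h | h
  · exact hR.lt_of_newEdge (hF.one.1 α h)
  · rcases hF.two with ⟨_, h'⟩ | ⟨hs, top, htop, h'⟩
    · rw [h] at h'; cases h'
    · rw [h] at h'
      cases h'
      have hs1 := hR.one_le_least hs
      rw [one_lt_div (by linarith)]
      obtain ⟨k, hk, hlk, -, hne, hall⟩ := hR.violator
      rcases htop.upper k hk hlk with hb | ⟨j, hj, hle⟩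
      · exact absurd hb hne.ne_empty
      · have := hall j hj
        nlinarith
  · rcases hF.three with ⟨_, h'⟩ | ⟨_, _, h'⟩ | ⟨hs, s, hl, h'⟩
    · rw [h] at h'; cases h'
    · rw [h] at h'; cases h'
    · rw [h] at h'
      cases h'
      have hs1 := hR.one_le_least hs
      have hmem : sInf {t : ℕ | s / spend x p i < (1 + ε) ^ t} ∈
          {t : ℕ | s / spend x p i < (1 + ε) ^ t} := by
        apply Nat.sInf_mem
        obtain ⟨t, ht⟩ := pow_unbounded_of_one_lt (s / spend x p i) (by linarith : 1 < 1 + ε)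
        exact ⟨t, ht⟩
      rw [Set.mem_ofPred_eq] at hmem
      refine lt_of_le_of_lt ?_ hmem
      rw [one_le_div (by linarith)]
      obtain ⟨⟨k, hk, _, rfl⟩, _⟩ := hl
      exact hR.hier.least.le hk

theorem raised_pos (j : Fin m) : 0 < raised x p lev α j := by
  have := hR.one_lt hF hα
  unfold raised
  split_ifs
  · exact mul_pos (by linarith) (hR.pos j)
  · exact hR.pos j

/-- The factor `α₃` keeps the least spending within `1 + ε` of that of the raised one. -/
theorem mul_least_le (k : Fin n) (hk : k ∈ A) :
    α * spend x p i ≤ (1 + ε) * spend x (raised x p lev α) k := by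
  have he := hR.input.eps_pos
  have h1 := hR.one_lt hF hα
  have hk0 := hR.spend_nn k
  rw [spend_raised]
  split_ifs with hl
  · have h2 := mul_le_mul_of_nonneg_left (hR.hier.least.le hk) (by linarith : 0 ≤ α)
    have h3 : 0 ≤ α * spend x p k := mul_nonneg (by linarith) hk0
    nlinarith
  · rw [Bool.not_eq_true, Option.isSome_eq_false_iff, Option.isNone_iff_eq_none] at hl
    rcases hF.three with ⟨hs, _⟩ | ⟨_, h', _⟩ | ⟨hs, s, hls, h'⟩
    · rw [hs, mul_zero]; positivity
    · exact absurd hl (h' k hk)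
    · have hs1 := hR.one_le_least hs
      have hle := hα.le_three _ h'
      set T := sInf {t : ℕ | s / spend x p i < (1 + ε) ^ t} with hT
      have hT1 : s / spend x p i < (1 + ε) ^ T := by
        have : T ∈ {t : ℕ | s / spend x p i < (1 + ε) ^ t} := by
          apply Nat.sInf_mem
          obtain ⟨t, ht⟩ := pow_unbounded_of_one_lt (s / spend x p i) (by linarith : 1 < 1 + ε)
          exact ⟨t, ht⟩
        exact this
      have hratio : 1 ≤ s / spend x p i := by
        rw [one_le_div (by linarith)]
        obtain ⟨⟨k, hk, _, rfl⟩, _⟩ := hls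
        exact hR.hier.least.le hk
      -- The exponent is positive because the power `1` does not strictly exceed a ratio that is at
      -- least `1`. Hence the preceding power does not exceed the ratio, and `α₃` overshoots by at
      -- most one factor `1 + ε`.
      obtain ⟨T', hT'⟩ : ∃ T', T = T' + 1 := by
        rcases hT0 : T with _ | T'
        · rw [hT0, pow_zero] at hT1
          linarith
        · exact ⟨T', rfl⟩
      have hT2 : (1 + ε) ^ T' ≤ s / spend x p i := by
        have : T' ∉ {t : ℕ | s / spend x p i < (1 + ε) ^ t} :=
          Nat.notMem_of_lt_sInf (by omega)
        exact not_lt.mp this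
      rw [le_div_iff₀ (by linarith)] at hT2
      calc α * spend x p i ≤ (1 + ε) ^ T * spend x p i :=
            mul_le_mul_of_nonneg_right hle (by linarith)
        _ = (1 + ε) * ((1 + ε) ^ T' * spend x p i) := by rw [hT']; ring
        _ ≤ (1 + ε) * spend x p k :=
            mul_le_mul_of_nonneg_left (hT2.trans (hls.2 k hk hl)) (by linarith)

theorem le_spend_raised (k : Fin n) : spend x p k ≤ spend x (raised x p lev α) k := by
  have h1 := hR.one_lt hF hα
  rw [spend_raised]
  split_ifs
  · exact le_mul_of_one_le_left (hR.spend_nn k) h1.le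
  · exact le_rfl

/-- Raised bang per buck ratios. -/
theorem isMBB_raised_of_level {h : Fin n} {j : Fin m} (hh : (lev h).isSome = true)
    (hj : IsMBB w p h j) : IsMBB w (raised x p lev α) h j := by
  have h1 := hR.one_lt hF hα
  have h0 : 0 < α := by linarith
  intro j'
  have hl := hR.hier.owner hR.inv.own hh hj
  unfold raised
  rw [if_pos hl]
  split_ifs with hl'
  · rw [mul_comm α, mul_comm α, ← div_div, ← div_div]
    exact div_le_div_of_nonneg_right (hj j') h0.le
  · rw [Bool.not_eq_true, Option.isSome_eq_false_iff, Option.isNone_iff_eq_none] at hl'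
    rw [mul_comm α, ← div_div, le_div_iff₀ h0]
    rcases (hR.input.nonneg h j').eq_or_lt with hw | hw
    · rw [← hw, zero_div, zero_mul]
      exact div_nonneg (hR.input.nonneg h j) (hR.pos j).le
    · obtain ⟨a, ha, hle⟩ := hF.one.2 _ ⟨h, hR.hier.mem hR.inv.own h hh, j', j, hh, hl', hw,
        hj, rfl⟩
      have h3 := (hα.le_one a ha).trans hle
      rw [le_div_iff₀ (div_pos hw (hR.pos j'))] at h3
      linarith

/-- The price of `j` is unchanged and the others can only rise. -/
theorem isMBB_raised_of_none {h : Fin n} {j : Fin m} (hl : lev (x j) = none)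
    (hj : IsMBB w p h j) : IsMBB w (raised x p lev α) h j := by
  have h1 := hR.one_lt hF hα
  intro j'
  have e : raised x p lev α j = p j := by simp [raised, hl]
  rw [e]
  refine le_trans ?_ (hj j')
  unfold raised
  split_ifs
  · refine div_le_div_of_nonneg_left (hR.input.nonneg h j') (hR.pos j') ?_
    exact le_mul_of_one_le_left (hR.pos j').le h1.le
  · exact le_rfl

theorem mbb_raised (j : Fin m) : IsMBB w (raised x p lev α) (x j) j := by
  rcases hl : lev (x j) with _ | r
  · exact hR.isMBB_raised_of_none hF hα hl (hR.inv.mbb j)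
  · exact hR.isMBB_raised_of_level hF hα (by rw [hl]; rfl) (hR.inv.mbb j)

theorem tame_raised {k : Fin n} (hk : (lev k).isSome = true) :
    Tame x (raised x p lev α) ((1 + ε) * (α * spend x p i)) k := by
  have h1 := hR.one_lt hF hα
  rcases hR.noSwap.tame hR.input hR.pos hR.hier hk with h | ⟨j, hj, h⟩
  · exact Or.inl h
  · refine Or.inr ⟨j, hj, ?_⟩
    rw [spend_raised, if_pos hk, raised, mem_bundle.mp hj, if_pos hk, ← mul_sub]
    calc α * (spend x p k - p j) ≤ α * ((1 + ε) * spend x p i) :=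
          mul_le_mul_of_nonneg_left h (by linarith)
      _ = _ := by ring

/-- This explains the square in `Ok`: one factor `1 + ε` comes from the absence of transfers, the
other from the rounding of `α₃`, by which the raised least spending may overtake an agent outside.
-/
theorem tame_raised_sq {k i' : Fin n} (hk : (lev k).isSome = true) (hi' : i' ∈ A) :
    Tame x (raised x p lev α) ((1 + ε) ^ 2 * spend x (raised x p lev α) i') k := by
  refine (hR.tame_raised hF hα hk).mono ?_
  rw [pow_two, mul_assoc]
  exact mul_le_mul_of_nonneg_left (hR.mul_least_le hF hα i' hi') (by linarith [hR.input.eps_pos])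

/-- If the factor is `α₂`, then the algorithm may stop. -/
theorem pef1_raised (h₂ : a₂ = some α) : PEF1 (3 * ε) A x (raised x p lev α) := by
  have he := hR.input.eps_pos
  intro i' hi' k hk
  have hnn := spend_nonneg (hR.raised_pos hF hα) x i'
  have hsq := mul_le_mul_of_nonneg_right hR.input.sq_le hnn
  rcases hl : lev k with _ | r
  · rcases hF.two with ⟨_, h'⟩ | ⟨hs, top, htop, h'⟩
    · rw [h₂] at h'; cases h'
    · rw [h₂] at h'
      have hα' := Option.some.inj h'
      have hs1 := hR.one_le_least hs
      rcases htop.upper k hk hl with hb | ⟨j, hj, hle⟩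
      · exact Or.inl hb
      · refine Or.inr ⟨j, hj, ?_⟩
        have h3 := hR.mul_least_le hF hα i' hi'
        -- With `α = α₂`, the product of `α` and the least spending is the largest price of an
        -- outside bundle up to one good.
        rw [hα', div_mul_cancel₀ _ hs, ← hα'] at h3
        rw [spend_raised, hl]
        simp only [Option.isSome_none, Bool.false_eq_true, if_false]
        have e : raised x p lev α j = p j := by simp [raised, mem_bundle.mp hj, hl]
        rw [e]
        nlinarith
  · exact (hR.tame_raised_sq hF hα (by rw [hl]; rfl) hi').mono hsq

/-- If the factor is not `α₂`, then it is a positive power of `1 + ε`. -/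
theorem factor_eq_pow (h₂ : a₂ ≠ some α) : ∃ t : ℕ, 1 ≤ t ∧ α = (1 + ε) ^ t := by
  have he := hR.input.eps_pos
  have hb : (1 : ℝ) < 1 + ε := by linarith
  have h1 := hR.one_lt hF hα
  -- `α₁` is a quotient of values and prices that are all powers of `1 + ε`, and `α₃` is a power by
  -- construction. The exponent is positive because `α > 1`.
  have key : ∃ z : ℤ, α = (1 + ε) ^ z := by
    rcases hα.mem with h | h | h
    · obtain ⟨u, _, j, j₁, _, _, h3, h4, e⟩ := hF.one.1 α h
      have hpos : 0 < w u j₁ := by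
        by_contra hw
        have := h4 j
        have h5 : w u j₁ / p j₁ ≤ 0 :=
          div_nonpos_of_nonpos_of_nonneg (not_lt.mp hw) (hR.pos j₁).le
        have h6 := div_pos h3 (hR.pos j)
        linarith
      obtain ⟨e₁, _, he₁⟩ := (hR.input.values u j).resolve_left h3.ne'
      obtain ⟨e₂, _, he₂⟩ := (hR.input.values u j₁).resolve_left hpos.ne'
      obtain ⟨z₁, hz₁⟩ := hR.inv.price j
      obtain ⟨z₂, hz₂⟩ := hR.inv.price j₁
      refine ⟨((e₂ : ℤ) - z₂) - ((e₁ : ℤ) - z₁), ?_⟩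
      have hb0 : (1 + ε) ≠ 0 := by linarith
      rw [e, he₁, he₂, hz₁, hz₂, zpow_sub₀ hb0, zpow_sub₀ hb0, zpow_sub₀ hb0]
      simp only [zpow_natCast]
    · exact absurd h h₂
    · rcases hF.three with ⟨_, h'⟩ | ⟨_, _, h'⟩ | ⟨hs, s, hls, h'⟩
      · rw [h] at h'; cases h'
      · rw [h] at h'; cases h'
      · rw [h] at h'
        exact ⟨_, (Option.some.inj h').trans (zpow_natCast _ _).symm⟩
  obtain ⟨z, hz⟩ := key
  have hz0 : 0 < z := by
    rw [hz] at h1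
    exact (one_lt_zpow_iff_right₀ hb).mp h1
  refine ⟨z.toNat, by omega, ?_⟩
  rw [hz, ← zpow_natCast, Int.toNat_of_nonneg hz0.le]

/-- Outside the hierarchy bundles and prices are the same and the least spending has not dropped, so
fresh agents stay fresh and tame ones tame. Inside, freshness may be lost, but every agent is tame.
-/
theorem inv_raised (h₂ : a₂ ≠ some α) : Inv w ε A N x (raised x p lev α) := by
  obtain ⟨t, ht, hαt⟩ := hR.factor_eq_pow hF hα h₂
  refine ⟨hR.inv.own, ?_, hR.mbb_raised hF hα, ?_⟩
  · intro j
    obtain ⟨z, hz⟩ := hR.inv.price j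
    unfold raised
    split_ifs
    · exact ⟨t + z, by rw [hαt, hz, pow_add]⟩
    · exact ⟨z, hz⟩
  · intro i' lev' hH'
    left
    intro k hk
    rcases hl : lev k with _ | r
    · have hp' : ∀ j, x j = k → raised x p lev α j = p j := by
        intro j hj; simp [raised, hj, hl]
      have hsk : spend x (raised x p lev α) k = spend x p k := by
        rw [spend_raised, hl]; simp
      have hle : spend x p i ≤ spend x (raised x p lev α) i' :=
        (hR.hier.least.le hH'.least.1).trans (hR.le_spend_raised hF hα i')
      rcases (hR.ok k hk).mono hle with h | h
      · left
        intro j hj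
        rw [hp' j hj]; exact h j hj
      · right
        rcases h with h | ⟨j, hj, h⟩
        · exact Or.inl h
        · exact Or.inr ⟨j, hj, by rw [hsk, hp' j (mem_bundle.mp hj)]; exact h⟩
    · exact Or.inr (hR.tame_raised_sq hF hα (by rw [hl]; rfl) hH'.least.1)

end IsRise

end

/-! ## The potential of the main loop -/

section

variable {n m : ℕ}

/-- The level of an agent, where agents outside the hierarchy have level `n`. -/
def levelNat (lev : Fin n → Option ℕ) (k : Fin n) : ℕ := (lev k).getD n

/-- The potential for the transfers with a fixed least spender. -/
def levelPotential (x : Fin m → Fin n) (lev : Fin n → Option ℕ) : ℕ :=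
  (n * n - ∑ k, levelNat lev k) * (m * n + 1) + ∑ j, levelNat lev (x j)

/-- An upper bound for `levelPotential`. -/
def levelBound (n m : ℕ) : ℕ := n * n * (m * n + 1) + m * n

/-- The logarithm of a spending to the base `1 + ε`, rounded down. -/
def scale (ε s : ℝ) : ℕ := ⌊Real.logb (1 + ε) s⌋₊

/-- The number of goods that the agents with spending less than `b` may still receive. -/
def poorPotential (x : Fin m → Fin n) (p : Fin m → ℝ) (b : ℝ) : ℕ :=
  ∑ k, if spend x p k < b then m + 1 - (bundle x k).card else 0

/-- The potential when the least spending is positive. -/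
def posPotential (ε : ℝ) (N : ℕ) (x : Fin m → Fin n) (p : Fin m → ℝ) (s : ℝ)
    (lev : Fin n → Option ℕ) : ℕ :=
  ((2 * N + 1 - scale ε s) * (n * (m + 1) + 1) + poorPotential x p ((1 + ε) ^ (scale ε s + 1))) *
    (levelBound n m + 1) + levelPotential x lev

/-- An upper bound for `posPotential`. -/
def posBound (n m N : ℕ) : ℕ := (2 * N + 2) * (n * (m + 1) + 1) * (levelBound n m + 1)

open Classical in
/-- The potential when the least spending is zero. -/
def zeroPotential (w : Fin n → Fin m → ℝ) (ε : ℝ) (A : List (Fin n)) (N : ℕ) (x : Fin m → Fin n)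
    (p : Fin m → ℝ) (i : Fin n) (lev : Fin n → Option ℕ) : ℕ :=
  posBound n m N +
    (Finset.univ.filter fun k => bundle x k = ∅).card * (levelBound n m + n + 3) +
    if NoSwap w ε A x p i lev then
      levelBound n m + 1 + (n - (Finset.univ.filter fun k => (lev k).isSome = true).card)
    else levelPotential x lev

open Classical in
/-- The potential of the main loop. -/
def potential (w : Fin n → Fin m → ℝ) (ε : ℝ) (A : List (Fin n)) (N : ℕ) (x : Fin m → Fin n)
    (p : Fin m → ℝ) (i : Fin n) (lev : Fin n → Option ℕ) : ℕ :=
  if spend x p i = 0 then zeroPotential w ε A N x p i lev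
  else posPotential ε N x p (spend x p i) lev

/-- An upper bound for `potential`. -/
def potentialBound (n m N : ℕ) : ℕ :=
  posBound n m N + n * (levelBound n m + n + 3) + (levelBound n m + 1 + n)

theorem levelNat_le {E : Fin n → Fin n → Prop} {i : Fin n} {lev : Fin n → Option ℕ}
    (hl : IsLevel E i lev) (k : Fin n) : levelNat lev k ≤ n := by
  unfold levelNat
  rcases h : lev k with _ | r
  · exact le_rfl
  · exact (hl.lt k r h).le

theorem sum_levelNat_le {E : Fin n → Fin n → Prop} {i : Fin n} {lev : Fin n → Option ℕ}
    (hl : IsLevel E i lev) : ∑ k, levelNat lev k ≤ n * n := by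
  have := Finset.sum_le_card_nsmul Finset.univ (levelNat lev) n fun k _ => levelNat_le hl k
  simpa using this

theorem sum_levelNat_owner_le {E : Fin n → Fin n → Prop} {i : Fin n} {lev : Fin n → Option ℕ}
    (hl : IsLevel E i lev) (x : Fin m → Fin n) : ∑ j, levelNat lev (x j) ≤ m * n := by
  have := Finset.sum_le_card_nsmul Finset.univ (fun j => levelNat lev (x j)) n
    fun j _ => levelNat_le hl (x j)
  simpa using this

theorem levelPotential_le {E : Fin n → Fin n → Prop} {i : Fin n} {lev : Fin n → Option ℕ}
    (hl : IsLevel E i lev) (x : Fin m → Fin n) : levelPotential x lev ≤ levelBound n m :=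
  Nat.add_le_add (Nat.mul_le_mul_right _ (Nat.sub_le _ _)) (sum_levelNat_owner_le hl x)

theorem poorPotential_le (x : Fin m → Fin n) (p : Fin m → ℝ) (b : ℝ) :
    poorPotential x p b ≤ n * (m + 1) := by
  have := Finset.sum_le_card_nsmul Finset.univ
    (fun k : Fin n => if spend x p k < b then m + 1 - (bundle x k).card else 0) (m + 1)
    fun k _ => by split_ifs <;> omega
  simpa [poorPotential] using this

/-- The weights exceed the ranges of the lower entries, so `posPotential` encodes a lexicographic
triple. The strict bound lets a zero least spending always count for more than a positive one. -/
theorem posPotential_lt {E : Fin n → Fin n → Prop} {i : Fin n} {lev : Fin n → Option ℕ}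
    (hl : IsLevel E i lev) (ε : ℝ) (N : ℕ) (x : Fin m → Fin n) (p : Fin m → ℝ) (s : ℝ) :
    posPotential ε N x p s lev < posBound n m N := by
  have h1 := levelPotential_le hl x
  have h2 := poorPotential_le x p ((1 + ε) ^ (scale ε s + 1))
  have h3 : (2 * N + 1 - scale ε s) * (n * (m + 1) + 1) ≤ (2 * N + 1) * (n * (m + 1) + 1) :=
    Nat.mul_le_mul_right _ (Nat.sub_le _ _)
  unfold posPotential posBound
  have h4 : (2 * N + 1 - scale ε s) * (n * (m + 1) + 1) +
      poorPotential x p ((1 + ε) ^ (scale ε s + 1)) + 1 ≤ (2 * N + 2) * (n * (m + 1) + 1) := by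
    have : (2 * N + 2) * (n * (m + 1) + 1) =
      (2 * N + 1) * (n * (m + 1) + 1) + (n * (m + 1) + 1) := by ring
    omega
  have h5 := Nat.mul_le_mul_right (levelBound n m + 1) h4
  rw [Nat.succ_mul] at h5
  omega

/-- Apart from the empty bundles, at most `levelBound n m + 1 + n` is contributed, less than the
weight `levelBound n m + n + 3` of one empty bundle. -/
theorem zeroPotential_le {w : Fin n → Fin m → ℝ} {ε : ℝ} {A : List (Fin n)} {N : ℕ}
    {x : Fin m → Fin n} {p : Fin m → ℝ} {i : Fin n} {lev : Fin n → Option ℕ}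
    (hl : IsLevel (MBBEdge w A x p) i lev) :
    zeroPotential w ε A N x p i lev ≤ posBound n m N +
      (Finset.univ.filter fun k => bundle x k = ∅).card * (levelBound n m + n + 3) +
      (levelBound n m + 1 + n) := by
  have h1 := levelPotential_le hl x
  unfold zeroPotential
  split_ifs <;> omega

theorem potential_le {w : Fin n → Fin m → ℝ} {ε : ℝ} {A : List (Fin n)} {N : ℕ}
    {x : Fin m → Fin n} {p : Fin m → ℝ} {i : Fin n} {lev : Fin n → Option ℕ}
    (hl : IsLevel (MBBEdge w A x p) i lev) :
    potential w ε A N x p i lev ≤ potentialBound n m N := by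
  unfold potential potentialBound
  split_ifs
  · refine (zeroPotential_le hl).trans ?_
    have : (Finset.univ.filter fun k : Fin n => bundle x k = ∅).card ≤ n := by
      simpa using Finset.card_le_univ (Finset.univ.filter fun k : Fin n => bundle x k = ∅)
    have := Nat.mul_le_mul_right (levelBound n m + n + 3) this
    omega
  · have := posPotential_lt hl ε N x p (spend x p i)
    omega

/-! ### Scales -/

theorem pow_scale_le {ε s : ℝ} (he : 0 < ε) (hs : 1 ≤ s) : (1 + ε) ^ scale ε s ≤ s := by
  have hb : 1 < 1 + ε := by linarith
  rw [← Real.rpow_natCast, ← Real.le_logb_iff_rpow_le hb (by linarith)]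
  exact Nat.floor_le (Real.logb_nonneg hb hs)

theorem lt_pow_scale {ε s : ℝ} (he : 0 < ε) (hs : 1 ≤ s) : s < (1 + ε) ^ (scale ε s + 1) := by
  have hb : 1 < 1 + ε := by linarith
  rw [← Real.rpow_natCast, ← Real.logb_lt_iff_lt_rpow hb (by linarith)]
  push_cast
  exact Nat.lt_floor_add_one _

theorem scale_mono {ε s s' : ℝ} (he : 0 < ε) (hs : 1 ≤ s) (h : s ≤ s') :
    scale ε s ≤ scale ε s' := by
  have h1 := pow_scale_le he hs
  have h2 := lt_pow_scale he (hs.trans h)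
  have := (pow_lt_pow_iff_right₀ (by linarith : 1 < 1 + ε)).mp (h1.trans_lt (h.trans_lt h2))
  omega

theorem scale_le {ε s : ℝ} {K : ℕ} (he : 0 < ε) (hs : 1 ≤ s) (h : s ≤ (1 + ε) ^ K) :
    scale ε s ≤ K :=
  (pow_le_pow_iff_right₀ (by linarith : 1 < 1 + ε)).mp ((pow_scale_le he hs).trans h)

/-- How the potential for a positive least spending decreases. -/
theorem posPotential_decr {E' : Fin n → Fin n → Prop} {i' : Fin n} {ε : ℝ} {N : ℕ}
    {x x' : Fin m → Fin n} {p p' : Fin m → ℝ}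
    {s s' : ℝ} {lev lev' : Fin n → Option ℕ} (he : 0 < ε) (hs : 1 ≤ s) (hss : s ≤ s')
    (hN : scale ε s ≤ 2 * N) (hl' : IsLevel E' i' lev')
    (h : poorPotential x' p' ((1 + ε) ^ (scale ε s + 1)) <
        poorPotential x p ((1 + ε) ^ (scale ε s + 1)) ∨
      poorPotential x' p' ((1 + ε) ^ (scale ε s + 1)) ≤
        poorPotential x p ((1 + ε) ^ (scale ε s + 1)) ∧
      levelPotential x' lev' < levelPotential x lev) :
    posPotential ε N x' p' s' lev' < posPotential ε N x p s lev := by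
  have h1 := levelPotential_le hl' x'
  have hsc := scale_mono he hs hss
  unfold posPotential
  -- If the scale goes up, the lower entries may take any value. The threshold `(1 + ε) ^ (scale +
  -- 1)` changes only with the scale, so otherwise the hypotheses compare the right quantities.
  rcases hsc.lt_or_eq with hlt | heq
  · have h2 := poorPotential_le x' p' ((1 + ε) ^ (scale ε s' + 1))
    have h3 : 2 * N + 1 - scale ε s' + 1 ≤ 2 * N + 1 - scale ε s := by omega
    have h4 := Nat.mul_le_mul_right (n * (m + 1) + 1) h3
    rw [Nat.succ_mul] at h4
    have h5 : (2 * N + 1 - scale ε s') * (n * (m + 1) + 1) +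
        poorPotential x' p' ((1 + ε) ^ (scale ε s' + 1)) + 1 ≤
      (2 * N + 1 - scale ε s) * (n * (m + 1) + 1) +
        poorPotential x p ((1 + ε) ^ (scale ε s + 1)) := by omega
    have h6 := Nat.mul_le_mul_right (levelBound n m + 1) h5
    rw [Nat.succ_mul] at h6
    omega
  · rw [← heq]
    rcases h with h | ⟨h, h'⟩
    · have h5 : (2 * N + 1 - scale ε s) * (n * (m + 1) + 1) +
          poorPotential x' p' ((1 + ε) ^ (scale ε s + 1)) + 1 ≤
        (2 * N + 1 - scale ε s) * (n * (m + 1) + 1) +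
          poorPotential x p ((1 + ε) ^ (scale ε s + 1)) := by omega
      have h6 := Nat.mul_le_mul_right (levelBound n m + 1) h5
      rw [Nat.succ_mul] at h6
      omega
    · have h6 := Nat.mul_le_mul_right (levelBound n m + 1)
        (Nat.add_le_add_left h ((2 * N + 1 - scale ε s) * (n * (m + 1) + 1)))
      omega

/-! ### Decrease of the potential under transfers. -/

section Swap

variable {w : Fin n → Fin m → ℝ} {ε : ℝ} {A : List (Fin n)} {N : ℕ} {x : Fin m → Fin n}
  {p : Fin m → ℝ} {lev lev' : Fin n → Option ℕ} {i i' h : Fin n} {j : Fin m} {ℓ : ℕ} {c : ℝ}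

/-- With the same least spender, levels can only rise. A rise outweighs any change in the second
sum, which is at most `m * n`; if no level changes, `j` moves from an owner at level `ℓ + 1` to one
at level `ℓ`. -/
theorem levelPotential_swap (hs : IsSwap w A x p lev c ℓ h j)
    (hl : IsLevel (MBBEdge w A x p) i lev)
    (hl' : IsLevel (MBBEdge w A (Function.update x j h) p) i lev') :
    levelPotential (Function.update x j h) lev' < levelPotential x lev := by
  have hle : ∀ k ∈ Finset.univ, levelNat lev k ≤ levelNat lev' k := by
    intro k _
    rcases hk : lev' k with _ | r
    · have := levelNat_le hl k
      unfold levelNat at this ⊢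
      rwa [hk]
    · obtain ⟨r₀, hr₀, hk₀⟩ := hs.level_le hl hl' k r hk
      unfold levelNat
      rw [hk, hk₀]
      exact hr₀
  have hS := Finset.sum_le_sum hle
  have hS' := sum_levelNat_le hl'
  have hQ := sum_levelNat_owner_le hl' (Function.update x j h)
  unfold levelPotential
  rcases hS.lt_or_eq with hlt | heq
  · have h3 : n * n - ∑ k, levelNat lev' k + 1 ≤ n * n - ∑ k, levelNat lev k := by omega
    have h4 := Nat.mul_le_mul_right (m * n + 1) h3
    rw [Nat.succ_mul] at h4
    omega
  · have hfun : levelNat lev' = levelNat lev := by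
      funext k
      exact ((Finset.sum_eq_sum_iff_of_le hle).mp heq k (Finset.mem_univ k)).symm
    rw [hfun]
    refine Nat.add_lt_add_left ?_ _
    refine Finset.sum_lt_sum (fun a _ => ?_) ⟨j, Finset.mem_univ j, ?_⟩
    · by_cases ha : a = j
      · subst ha
        rw [Function.update_self]
        simp [levelNat, hs.2.1, hs.2.2.2.1]
      · rw [Function.update_of_ne ha]
    · rw [Function.update_self]
      simp [levelNat, hs.2.1, hs.2.2.2.1]

theorem card_bundle_le (x : Fin m → Fin n) (k : Fin n) : (bundle x k).card ≤ m := by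
  simpa using Finset.card_le_univ (bundle x k)

/-- The giver keeps more than `c ≥ b`, so nobody becomes poor, while a poor receiver uses up one of
the goods it could still get. -/
theorem poorPotential_swap {b : ℝ} (hp : ∀ j, 0 < p j) (hs : IsSwap w A x p lev c ℓ h j)
    (hb : b ≤ c) :
    poorPotential (Function.update x j h) p b ≤ poorPotential x p b ∧
      (spend x p h < b → poorPotential (Function.update x j h) p b < poorPotential x p b) := by
  have hcard : (bundle (Function.update x j h) h).card = (bundle x h).card + 1 := by
    rw [bundle_update_receiver hs.ne, Finset.card_insert_of_notMem]
    rw [mem_bundle]; exact hs.ne.symm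
  have hspend := spend_update_receiver p hs.ne
  have hterm : ∀ k ∈ Finset.univ,
      (if spend (Function.update x j h) p k < b then
        m + 1 - (bundle (Function.update x j h) k).card else 0) ≤
      if spend x p k < b then m + 1 - (bundle x k).card else 0 := by
    intro k _
    by_cases hkh : k = h
    · rw [hkh, hspend, hcard]
      have := hp j
      split_ifs with h1 h2
      · omega
      · exfalso; linarith
      · exact Nat.zero_le _
      · exact le_rfl
    · by_cases hkx : k = x j
      · have := hs.2.2.2.2
        rw [hkx, spend_update_giver p hs.ne, if_neg (by linarith)]
        exact Nat.zero_le _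
      · rw [spend_update_of_ne p hkh hkx, bundle_update_of_ne hkh hkx]
  refine ⟨Finset.sum_le_sum hterm, fun hpoor => Finset.sum_lt_sum hterm
    ⟨h, Finset.mem_univ h, ?_⟩⟩
  have := card_bundle_le x h
  rw [hcard, if_pos hpoor]
  split_ifs <;> omega

theorem Inv.scale_le (hI : IsInput w ε A N) (hv : Inv w ε A N x p)
    (hH : IsHierarchy w A x p i lev) (hpef : ¬ PEF1 (3 * ε) A x p) (h1 : 1 ≤ spend x p i) :
    scale ε (spend x p i) ≤ 2 * N := by
  have he := hI.eps_pos
  refine FairDivision.scale_le he h1 ((hv.least_le hI hH hpef).trans ?_)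
  rw [two_mul, pow_add]
  exact mul_le_mul_of_nonneg_right hI.goods (by positivity)

theorem Inv.one_le_least (hI : IsInput w ε A N) (hv : Inv w ε A N x p)
    (hs : spend x p i ≠ 0) : 1 ≤ spend x p i := by
  have : bundle x i ≠ ∅ := fun h => hs ((spend_eq_zero_iff (hv.price_pos hI)).mpr h)
  obtain ⟨j, hj⟩ := Finset.nonempty_iff_ne_empty.mpr this
  exact (hv.one_le_price hI j).trans (le_spend (hv.price_pos hI) (mem_bundle.mp hj))

/-- A transfer to the least spender fills an empty bundle or serves a poor agent. Any other transfer
keeps the least spender and lowers the level potential. -/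
theorem potential_swap (hI : IsInput w ε A N) (hv : Inv w ε A N x p)
    (hH : IsHierarchy w A x p i lev) (hpef : ¬ PEF1 (3 * ε) A x p)
    (hs : IsSwap w A x p lev ((1 + ε) * spend x p i) ℓ h j)
    (hH' : IsHierarchy w A (Function.update x j h) p i' lev') :
    potential w ε A N (Function.update x j h) p i' lev' < potential w ε A N x p i lev := by
  have he := hI.eps_pos
  have hp := hv.price_pos hI
  have hs0 := spend_nonneg hp x i
  have hc : spend x p i ≤ (1 + ε) * spend x p i := by nlinarith
  have hle := hs.le_spend hp hH.least hc i' hH'.least.1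
  have hii : h ≠ i → i' = i ∧ spend (Function.update x j h) p i = spend x p i := fun hhi => by
    obtain ⟨e, hmin⟩ := hs.firstMin hp hH.least hc hhi
    exact ⟨hH'.least.unique hmin, e⟩
  have hlevel : h ≠ i → levelPotential (Function.update x j h) lev' < levelPotential x lev :=
    fun hhi => levelPotential_swap hs hH.level (by
      have := hH'.level
      rwa [(hii hhi).1] at this)
  by_cases hzero : spend x p i = 0
  · have hpos : potential w ε A N x p i lev = zeroPotential w ε A N x p i lev := by
      rw [potential, if_pos hzero]
    have hav : ¬ NoSwap w ε A x p i lev := fun hno => hno ℓ h j hs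
    have hold : zeroPotential w ε A N x p i lev = posBound n m N +
        (Finset.univ.filter fun k => bundle x k = ∅).card * (levelBound n m + n + 3) +
        levelPotential x lev := by rw [zeroPotential, if_neg hav]
    rw [hpos, hold]
    -- no new agent becomes empty
    have hsub : (Finset.univ.filter fun k => bundle (Function.update x j h) k = ∅) ⊆
        (Finset.univ.filter fun k => bundle x k = ∅).erase h := by
      intro k hk
      rw [Finset.mem_filter] at hk
      rw [Finset.mem_erase, Finset.mem_filter]
      have hkh : k ≠ h := by
        rintro rfl
        rw [bundle_update_receiver hs.ne] at hk
        exact Finset.insert_ne_empty _ _ hk.2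
      refine ⟨hkh, Finset.mem_univ _, ?_⟩
      by_cases hkx : k = x j
      · exfalso
        have h1 := (spend_eq_zero_iff hp).mpr hk.2
        rw [hkx, spend_update_giver p hs.ne] at h1
        have h2 := hs.2.2.2.2
        rw [hzero, mul_zero] at h2
        linarith
      · rw [← bundle_update_of_ne hkh hkx]; exact hk.2
    -- A bundle is filled and none is emptied; this pays for whatever the new hierarchy contributes,
    -- whether or not the least spending stays zero.
    by_cases hhi : h = i
    · subst hhi
      have hmem : h ∈ Finset.univ.filter fun k => bundle x k = ∅ := by
        rw [Finset.mem_filter]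
        exact ⟨Finset.mem_univ _, (spend_eq_zero_iff hp).mp hzero⟩
      have hcard := Finset.card_le_card hsub
      have hcpos := Finset.card_pos.mpr ⟨h, hmem⟩
      rw [Finset.card_erase_of_mem hmem] at hcard
      have hcard' : (Finset.univ.filter fun k => bundle (Function.update x j h) k = ∅).card + 1 ≤
        (Finset.univ.filter fun k => bundle x k = ∅).card := by omega
      have hmul := Nat.mul_le_mul_right (levelBound n m + n + 3) hcard'
      rw [Nat.succ_mul] at hmul
      unfold potential
      split_ifs
      · have := zeroPotential_le (ε := ε) (N := N) hH'.level
        omega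
      · have := posPotential_lt hH'.level ε N (Function.update x j h) p
          (spend (Function.update x j h) p i')
        omega
    · obtain ⟨rfl, e⟩ := hii hhi
      rw [potential, if_pos (e.trans hzero)]
      -- The receiver now owns at least two goods, and with zero least spending any nonempty rest is
      -- a violation. The good on its discovery edge can thus be passed on, and the chain of
      -- transfers does not stop before reaching the root.
      have hav' : ¬ NoSwap w ε A (Function.update x j h) p i' lev' := by
        intro hno
        obtain ⟨a, rfl⟩ : ∃ a, ℓ = a + 1 := by
          rcases ℓ with _ | a
          · exact absurd (hH.level.zero h hs.2.1) hhi
          · exact ⟨a, rfl⟩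
        have hlh := hs.level_eq hH.level hH'.level h (a + 1) le_rfl hs.2.1
        obtain ⟨u, hu, huA, b, hb, hmbb⟩ := hH.level.pred h a hs.2.1
        have hbj : b ≠ j := by
          rintro rfl
          exact hs.ne hb.symm
        refine hno a u b ⟨huA, hs.level_eq hH.level hH'.level u a (by omega) hu, hmbb, ?_, ?_⟩
        · rw [Function.update_of_ne hbj, hb]; exact hlh
        · rw [Function.update_of_ne hbj, hb, e, hzero, mul_zero, spend_update_receiver p hs.ne]
          have := le_spend hp hb
          linarith [hp j]
      rw [zeroPotential, if_neg hav']
      have hcard : (Finset.univ.filter fun k => bundle (Function.update x j h) k = ∅).card ≤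
          (Finset.univ.filter fun k => bundle x k = ∅).card :=
        Finset.card_le_card (hsub.trans (Finset.erase_subset _ _))
      have hmul := Nat.mul_le_mul_right (levelBound n m + n + 3) hcard
      have := hlevel hhi
      omega
  · have h1 := hv.one_le_least hI hzero
    have hzero' : spend (Function.update x j h) p i' ≠ 0 := by
      intro h0; rw [h0] at hle; linarith
    rw [potential, if_neg hzero', potential, if_neg hzero]
    -- The threshold of poverty is at most the amount that every giver is left with.
    have hb : (1 + ε) ^ (scale ε (spend x p i) + 1) ≤ (1 + ε) * spend x p i := by
      rw [pow_succ']
      exact mul_le_mul_of_nonneg_left (pow_scale_le he h1) (by linarith)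
    obtain ⟨h2, h3⟩ := poorPotential_swap hp hs hb
    refine posPotential_decr he h1 hle (hv.scale_le hI hH hpef h1) hH'.level ?_
    by_cases hhi : h = i
    · left
      refine h3 ?_
      rw [hhi]
      exact lt_pow_scale he h1
    · exact Or.inr ⟨h2, hlevel hhi⟩

end Swap

/-! ### Decrease of the potential under price-rises. -/

section Rise

variable {w : Fin n → Fin m → ℝ} {ε : ℝ} {A : List (Fin n)} {N : ℕ} {x : Fin m → Fin n}
  {p : Fin m → ℝ} {lev lev' : Fin n → Option ℕ} {i i' : Fin n} {a₁ a₂ a₃ : Option ℝ} {α : ℝ}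

/-- With zero least spending only `α₁` is finite, so the hierarchy gains an agent, and possibly a
transfer becomes available. With positive least spending the factor is at least `1 + ε`, which lifts
`i` over the poverty threshold. -/
theorem IsRise.potential_raised (hR : IsRise w ε A N x p i lev)
    (hF : IsFactors w ε A x p i lev a₁ a₂ a₃) (hα : IsMinFactor a₁ a₂ a₃ α) (h₂ : a₂ ≠ some α)
    (hH' : IsHierarchy w A x (raised x p lev α) i' lev') :
    potential w ε A N x (raised x p lev α) i' lev' < potential w ε A N x p i lev := by
  have he := hR.input.eps_pos
  have hp := hR.pos
  have h1 := hR.one_lt hF hα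
  have hroot : (lev i).isSome = true := by rw [hR.hier.level.root]; rfl
  by_cases hzero : spend x p i = 0
  · have hz' : spend x (raised x p lev α) i = 0 := by
      rw [spend_raised, if_pos hroot, hzero, mul_zero]
    -- Zero spendings stay zero and positive ones positive, so the first zero spender does not
    -- change.
    have hmin : IsFirstMin A (spend x (raised x p lev α)) i := by
      refine ⟨hR.hier.least.1, fun k hk => ?_⟩
      rw [hz']
      rcases hR.hier.least.2 k hk with h | ⟨h, h'⟩
      · left
        rw [hzero] at h
        exact h.trans_le (hR.le_spend_raised hF hα k)
      · right
        refine ⟨?_, h'⟩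
        rw [spend_raised, ← h, hzero]
        simp
    obtain rfl := hH'.least.unique hmin
    have hnew : IsNewEdgeFactor w A x p lev α := by
      rcases hα.mem with h | h | h
      · exact hF.one.1 α h
      · exact absurd h h₂
      · rcases hF.three with ⟨_, h'⟩ | ⟨h', _⟩ | ⟨h', _⟩
        · rw [h] at h'; cases h'
        · exact absurd hzero h'
        · exact absurd hzero h'
    -- Edges leaving agents of the hierarchy survive the price-rise, so nobody drops out of it.
    have hkeep : ∀ r k, lev k = some r → (lev' k).isSome = true := by
      intro r
      induction r with
      | zero => intro k hk; rw [hR.hier.level.zero k hk, hH'.level.root]; rfl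
      | succ r ih =>
        intro k hk
        obtain ⟨u, hu, huA, b, hb, hmbb⟩ := hR.hier.level.pred k r hk
        rw [← hb]
        exact hH'.owner hR.inv.own (ih u hu)
          (hR.isMBB_raised_of_level hF hα (by rw [hu]; rfl) hmbb)
    obtain ⟨u, huA, j, j₁, hu, hj, hw, hj₁, e⟩ := hnew
    have hpj := hp j
    have hpj₁ := hp j₁
    have hmbb : IsMBB w (raised x p lev α) u j := by
      intro j'
      refine (hR.isMBB_raised_of_level hF hα hu hj₁ j').trans ?_
      have hl₁ := hR.hier.owner hR.inv.own hu hj₁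
      rw [raised, raised, if_pos hl₁, hj, mul_comm α, ← div_div, div_le_iff₀ (by linarith)]
      simp only [Option.isSome_none, Bool.false_eq_true, if_false]
      -- At `α = α₁` the lowered ratio of `j₁` exactly meets the unchanged ratio of `j`.
      rw [e, mul_div_cancel₀ _ (div_pos hw hpj).ne']
    have hlt : (Finset.univ.filter fun k => (lev k).isSome = true).card <
        (Finset.univ.filter fun k => (lev' k).isSome = true).card := by
      refine Finset.card_lt_card ?_
      rw [Finset.ssubset_iff_of_subset]
      · obtain ⟨r, hr⟩ := Option.isSome_iff_exists.mp hu
        refine ⟨x j, ?_, ?_⟩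
        · rw [Finset.mem_filter]
          exact ⟨Finset.mem_univ _, hH'.owner hR.inv.own (hkeep r u hr) hmbb⟩
        · rw [Finset.mem_filter, hj]; simp
      · intro k hk
        rw [Finset.mem_filter] at hk ⊢
        obtain ⟨r, hr⟩ := Option.isSome_iff_exists.mp hk.2
        exact ⟨Finset.mem_univ _, hkeep r k hr⟩
    have hle : (Finset.univ.filter fun k => (lev' k).isSome = true).card ≤ n := by
      simpa using Finset.card_le_univ (Finset.univ.filter fun k => (lev' k).isSome = true)
    have hlp := levelPotential_le hH'.level x
    rw [potential, if_pos hz', potential, if_pos hzero, zeroPotential, zeroPotential,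
      if_pos (show NoSwap w ε A x p i' lev from hR.noSwap)]
    split_ifs <;> omega
  · have hs1 := hR.one_le_least hzero
    have hle : spend x p i ≤ spend x (raised x p lev α) i' :=
      (hR.hier.least.le hH'.least.1).trans (hR.le_spend_raised hF hα i')
    have hzero' : spend x (raised x p lev α) i' ≠ 0 := by
      intro h0; rw [h0] at hle; linarith
    rw [potential, if_neg hzero', potential, if_neg hzero]
    refine posPotential_decr he hs1 hle
      (hR.inv.scale_le hR.input hR.hier hR.notPEF1 hs1) hH'.level (Or.inl ?_)
    refine Finset.sum_lt_sum (fun k _ => ?_) ⟨i, Finset.mem_univ i, ?_⟩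
    · have := hR.le_spend_raised hF hα k
      split_ifs with h3 h4
      · exact le_rfl
      · exfalso; linarith
      · exact Nat.zero_le _
      · exact le_rfl
    -- The summand of `i` was at least `1`, thanks to `m + 1` in place of `m`, and now vanishes.
    · rw [if_pos (lt_pow_scale he hs1), if_neg]
      · have := card_bundle_le x i
        omega
      · rw [not_lt, spend_raised, if_pos hroot, pow_succ']
        obtain ⟨t, ht, hαt⟩ := hR.factor_eq_pow hF hα h₂
        have h5 : 1 + ε ≤ α := by
          rw [hαt]
          exact le_self_pow₀ (by linarith) (by omega)
        exact mul_le_mul h5 (pow_scale_le he hs1) (by positivity) (by linarith)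

end Rise

end

/-! ## Fairness and efficiency of the returned allocation -/

section

variable {n m : ℕ} {w u : Fin n → Fin m → ℝ} {ε : ℝ} {A : List (Fin n)} {N : ℕ}
  {x : Fin m → Fin n} {q : Fin m → ℝ}

/-- What holds for the returned allocation and the final prices. -/
structure IsFinal (w : Fin n → Fin m → ℝ) (ε : ℝ) (A : List (Fin n)) (x : Fin m → Fin n)
    (q : Fin m → ℝ) : Prop where
  own : ∀ j, x j ∈ A
  pos : ∀ j, 0 < q j
  mbb : ∀ j, IsMBB w q (x j) j
  pef1 : PEF1 (3 * ε) A x q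

/-- `a` is the maximum bang per buck of `i`. It is positive because a matched agent values some
good, by Hall's condition for a single agent. -/
theorem IsFinal.ratio (hI : IsInput w ε A N) (hx : IsFinal w ε A x q) (i : Fin n) (hi : i ∈ A) :
    ∃ a, 0 < a ∧ (∀ j, w i j ≤ a * q j) ∧ ∀ j, x j = i → w i j = a * q j := by
  obtain ⟨j₀, hj₀⟩ : ∃ j, 0 < w i j := by
    by_contra hno
    push Not at hno
    have := hI.matched.hall {i} ∅ (by simpa using hi) (by
      intro k hk j hj
      rw [Finset.mem_singleton] at hk
      subst hk
      exact absurd hj (hno j).not_gt)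
    simp at this
  have : Nonempty (Fin m) := ⟨j₀⟩
  obtain ⟨j₁, hj₁⟩ := Finite.exists_max fun j => w i j / q j
  refine ⟨w i j₁ / q j₁, (div_pos hj₀ (hx.pos j₀)).trans_le (hj₁ j₀), fun j => ?_, fun j hj => ?_⟩
  · have := hj₁ j
    rwa [div_le_iff₀ (hx.pos j)] at this
  · have h1 := hj₁ j
    have h2 := hx.mbb j j₁
    rw [hj] at h2
    rw [← le_antisymm h1 h2, div_mul_cancel₀ _ (hx.pos j).ne']

theorem value_le_mul_spend {a : ℝ} {i : Fin n} (h : ∀ j, w i j ≤ a * q j)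
    (hu : ∀ i j, u i j ≤ w i j) (S : Finset (Fin m)) : value u i S ≤ a * ∑ j ∈ S, q j := by
  rw [Finset.mul_sum]
  exact Finset.sum_le_sum fun j _ => (hu i j).trans (h j)

theorem mul_spend_le_value {a : ℝ} {i : Fin n} (h : ∀ j, x j = i → w i j = a * q j)
    (hw : ∀ i j, w i j ≤ (1 + ε) * u i j) :
    a * spend x q i ≤ (1 + ε) * value u i (bundle x i) := by
  rw [spend, value, Finset.mul_sum, Finset.mul_sum]
  refine Finset.sum_le_sum fun j hj => ?_
  rw [← h j (mem_bundle.mp hj)]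
  exact hw i j

/-- An agent outside the matching values at most one good of every bundle. -/
theorem IsFinal.unmatched (hI : IsInput w ε A N) (hx : IsFinal w ε A x q) {i : Fin n} (hi : i ∉ A)
    {j j' : Fin m} (hj : 0 < w i j) (hj' : 0 < w i j') (he : x j = x j') : j = j' := by
  classical
  by_contra hne
  obtain ⟨R, S, hiR, hS, hcard⟩ := hI.matched.deficient i hi
  have hjS := hS i hiR j hj
  have hjS' := hS i hiR j' hj'
  -- `j` and `j'` have the same owner, so the goods valued in the deficient set `R` have fewer
  -- owners than there are goods.
  have himage : (S.image x).card < S.card := by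
    refine lt_of_le_of_lt ?_ (Finset.card_erase_lt_of_mem hjS)
    refine (Finset.card_le_card ?_).trans (Finset.card_image_le (s := S.erase j) (f := x))
    intro k hk
    obtain ⟨a, ha, rfl⟩ := Finset.mem_image.mp hk
    rw [Finset.mem_image]
    by_cases haj : a = j
    · exact ⟨j', Finset.mem_erase.mpr ⟨fun e => hne e.symm, hjS'⟩, by rw [haj, he]⟩
    · exact ⟨a, Finset.mem_erase.mpr ⟨haj, ha⟩, rfl⟩
  -- Some matched agent of `R` owns none of these goods. As a matched agent owns only goods it
  -- values, its bundle is empty, and price-envy-freeness then allows no bundle with two goods.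
  obtain ⟨h, hhR, hhS⟩ := Finset.exists_mem_notMem_of_card_lt_card (himage.trans_le hcard)
  rw [Finset.mem_filter] at hhR
  obtain ⟨a, ha, _, hown⟩ := hx.ratio hI h hhR.2
  have hempty : bundle x h = ∅ := by
    rw [bundle_eq_empty_iff]
    intro b hb
    refine hhS (Finset.mem_image.mpr ⟨b, hS h hhR.1 b ?_, hb⟩)
    rw [hown b hb]
    exact mul_pos ha (hx.pos b)
  have hzero := (spend_eq_zero_iff hx.pos).mpr hempty
  rcases hx.pef1 h hhR.2 (x j) (hx.own j) with hb | ⟨b, hb, hle⟩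
  · exact bundle_eq_empty_iff.mp hb j rfl
  · rw [hzero, mul_zero] at hle
    have hone : ∀ c, x c = x j → c = b := by
      intro c hc
      by_contra hcb
      have := add_le_spend hx.pos hc (mem_bundle.mp hb) hcb
      linarith [hx.pos c]
    exact hne ((hone j rfl).trans (hone j' he.symm).symm)

/-- For a matched agent the price-envy bound is multiplied by its bang per buck, and `(1 + 3ε)(1 +
ε) ≤ 1 + 7ε` as `ε ≤ 1`. For an unmatched agent the one good it values in the bundle is removed. -/
theorem IsFinal.approxEF1 (hI : IsInput w ε A N) (hx : IsFinal w ε A x q)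
    (hu : ∀ i j, u i j ≤ w i j) (hw : ∀ i j, w i j ≤ (1 + ε) * u i j) :
    ApproxEF1 (7 * ε) u x := by
  have he := hI.eps_pos
  have hu0 : ∀ i j, 0 ≤ u i j := fun i j => by
    have := (hI.nonneg i j).trans (hw i j)
    exact nonneg_of_mul_nonneg_right this (by linarith)
  intro i k
  by_cases hb : bundle x k = ∅
  · exact Or.inl hb
  right
  obtain ⟨j₀, hj₀⟩ := Finset.nonempty_iff_ne_empty.mpr hb
  have hk : k ∈ A := by rw [← mem_bundle.mp hj₀]; exact hx.own j₀
  have hval : 0 ≤ value u i (bundle x i) := Finset.sum_nonneg fun j _ => hu0 i j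
  by_cases hi : i ∈ A
  · obtain ⟨a, ha, h1, h2⟩ := hx.ratio hI i hi
    obtain ⟨j, hj, hle⟩ := (hx.pef1 i hi k hk).resolve_left hb
    refine ⟨j, hj, ?_⟩
    have hdiff : ∑ b ∈ bundle x k \ {j}, q b = spend x q k - q j := by
      rw [Finset.sdiff_singleton_eq_erase, Finset.sum_erase_eq_sub hj, spend]
    calc value u i (bundle x k \ {j}) ≤ a * (spend x q k - q j) := by
          rw [← hdiff]; exact value_le_mul_spend h1 hu _
      _ ≤ a * ((1 + 3 * ε) * spend x q i) := mul_le_mul_of_nonneg_left hle ha.le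
      _ = (1 + 3 * ε) * (a * spend x q i) := by ring
      _ ≤ (1 + 3 * ε) * ((1 + ε) * value u i (bundle x i)) :=
          mul_le_mul_of_nonneg_left (mul_spend_le_value h2 hw) (by linarith)
      _ = ((1 + 3 * ε) * (1 + ε)) * value u i (bundle x i) := by ring
      _ ≤ (1 + 7 * ε) * value u i (bundle x i) := by
          refine mul_le_mul_of_nonneg_right ?_ hval
          nlinarith [hI.eps_le]
  · obtain ⟨j, hj, hrest⟩ : ∃ j ∈ bundle x k, ∀ b ∈ bundle x k, b ≠ j → ¬ 0 < w i b := by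
      by_cases hex : ∃ j ∈ bundle x k, 0 < w i j
      · obtain ⟨j, hj, hpos⟩ := hex
        refine ⟨j, hj, fun b hb' hne hb'' => hne ?_⟩
        exact hx.unmatched hI hi hb'' hpos ((mem_bundle.mp hb').trans (mem_bundle.mp hj).symm)
      · push Not at hex
        exact ⟨j₀, hj₀, fun b hb' _ => (hex b hb').not_gt⟩
    refine ⟨j, hj, ?_⟩
    have hzero : value u i (bundle x k \ {j}) ≤ 0 := by
      refine Finset.sum_nonpos fun b hb' => ?_
      rw [Finset.mem_sdiff, Finset.mem_singleton] at hb'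
      exact (hu i b).trans (not_lt.mp (hrest b hb'.1 hb'.2))
    exact hzero.trans (mul_nonneg (by linarith) hval)

theorem sum_spend (x : Fin m → Fin n) (q : Fin m → ℝ) : ∑ k, spend x q k = ∑ j, q j :=
  Finset.sum_fiberwise Finset.univ x q

/-- The factor `1 + ε` of the domination absorbs the rounding, so every agent would spend at least
as much in `y` and some agent more, while both allocations cost the total price. Unmatched agents
spend nothing in `x`. -/
theorem IsFinal.approxPO (hI : IsInput w ε A N) (hx : IsFinal w ε A x q)
    (hu : ∀ i j, u i j ≤ w i j) (hw : ∀ i j, w i j ≤ (1 + ε) * u i j) :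
    ApproxPO ε u x := by
  rintro ⟨y, hy, i, hyi⟩
  have hlt : ∑ k, spend x q k < ∑ k, spend y q k := by
    refine Finset.sum_lt_sum (fun k _ => ?_) ⟨i, Finset.mem_univ i, ?_⟩
    · by_cases hk : k ∈ A
      · obtain ⟨a, ha, h1, h2⟩ := hx.ratio hI k hk
        refine le_of_mul_le_mul_left ?_ ha
        exact (mul_spend_le_value h2 hw).trans ((hy k).trans (value_le_mul_spend h1 hu _))
      · have : bundle x k = ∅ := bundle_eq_empty_iff.mpr fun j hj => hk (hj ▸ hx.own j)
        rw [(spend_eq_zero_iff hx.pos).mpr this]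
        exact spend_nonneg hx.pos y k
    · by_cases hi : i ∈ A
      · obtain ⟨a, ha, h1, h2⟩ := hx.ratio hI i hi
        refine lt_of_mul_lt_mul_left ?_ ha.le
        exact (mul_spend_le_value h2 hw).trans_lt (hyi.trans_le (value_le_mul_spend h1 hu _))
      · have hb : bundle x i = ∅ := bundle_eq_empty_iff.mpr fun j hj => hi (hj ▸ hx.own j)
        rw [(spend_eq_zero_iff hx.pos).mpr hb]
        refine (spend_nonneg hx.pos y i).lt_of_ne' fun h0 => ?_
        rw [hb, (spend_eq_zero_iff hx.pos).mp h0] at hyi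
        simp [value] at hyi
  rw [sum_spend, sum_spend] at hlt
  exact lt_irrefl _ hlt

end

/-! ## The main loop -/

section

variable {n m : ℕ} {ε : ℝ} {N : ℕ}

/-- The time of one pass. -/
def stepTime (n m N : ℕ) : ℕ := passTime n m + 2 * (2 * N + 1) + 1

theorem maximizers_mem (w : Fin n → Fin m → ℝ) (A : List (Fin n)) (j : Fin m) (k : Fin n)
    (hk : k ∈ (maximizers w A j).val) : k ∈ A ∧ ∀ k' ∈ A, w k' j ≤ w k j := by
  have hspec := foldl_max_spec (fun k => some (w k j)) (fun a k => max a (w k j)) (by simp)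
    (by intro acc a r hr; cases hr; rfl) A 0
  unfold maximizers at hk
  simp only [Timed.val_bind, foldlM_val, op_val, Timed.val_ite, Timed.val_pure, maxReal_val] at hk
  rw [foldl_mem_iff _ (fun k q => q = k ∧ w k j = A.foldl (fun a k => max a (w k j)) 0)] at hk
  · simp only [List.not_mem_nil, false_or] at hk
    obtain ⟨a, ha, rfl, e⟩ := hk
    refine ⟨ha, fun k' hk' => ?_⟩
    rw [e]
    exact hspec.2.1 k' hk' _ rfl
  · intro acc a q
    split_ifs with h
    · rw [decide_eq_true_eq] at h
      rw [List.mem_cons]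
      tauto
    · rw [decide_eq_true_eq] at h
      tauto

theorem exists_maximizer (w : Fin n → Fin m → ℝ) (A : List (Fin n)) (j : Fin m)
    (h : ∃ k ∈ A, 0 < w k j) : ∃ k, k ∈ (maximizers w A j).val := by
  have hspec := foldl_max_spec (fun k => some (w k j)) (fun a k => max a (w k j)) (by simp)
    (by intro acc a r hr; cases hr; rfl) A 0
  obtain ⟨k, hk, hpos⟩ := h
  obtain ⟨_, h1, h2⟩ := hspec
  obtain ⟨a, ha, e⟩ := h2.resolve_left fun h0 => by
    have := h1 k hk _ rfl
    linarith
  refine ⟨a, ?_⟩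
  unfold maximizers
  simp only [Timed.val_bind, foldlM_val, op_val, Timed.val_ite, Timed.val_pure, maxReal_val]
  rw [foldl_mem_iff _ (fun k q => q = k ∧ w k j = A.foldl (fun a k => max a (w k j)) 0)]
  · exact Or.inr ⟨a, ha, rfl, Option.some.inj e⟩
  · intro acc a q
    split_ifs with h
    · rw [decide_eq_true_eq] at h
      rw [List.mem_cons]
      tauto
    · rw [decide_eq_true_eq] at h
      tauto

/-- All ratios of agents in `A` are at most `1`, with equality for owned goods, and all agents are
fresh. -/
theorem inv_init {w : Fin n → Fin m → ℝ} {A : List (Fin n)} (hI : IsInput w ε A N)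
    {x : Fin m → Fin n} (hx : ∀ j, x j ∈ (maximizers w A j).val) :
    Inv w ε A N x fun j => w (x j) j := by
  have hown : ∀ j, x j ∈ A := fun j => (maximizers_mem w A j _ (hx j)).1
  have hmax : ∀ j, ∀ k ∈ A, w k j ≤ w (x j) j := fun j => (maximizers_mem w A j _ (hx j)).2
  have hpos : ∀ j, 0 < w (x j) j := by
    intro j
    obtain ⟨k, hk, h⟩ := hI.covered j
    exact h.trans_le (hmax j k hk)
  refine ⟨hown, fun j => ?_, fun j j' => ?_, fun i lev _ => Or.inl fun k _ => Or.inl fun j _ => ?_⟩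
  · obtain ⟨e, _, he⟩ := (hI.values (x j) j).resolve_left (hpos j).ne'
    exact ⟨e, he⟩
  · rw [div_self (hpos j).ne', div_le_one (hpos j')]
    exact hmax j' _ (hown j)
  · obtain ⟨e, hle, he⟩ := (hI.values (x j) j).resolve_left (hpos j).ne'
    show w (x j) j ≤ (1 + ε) ^ N
    rw [he]
    exact pow_le_pow_right₀ (by linarith [hI.eps_pos]) hle

theorem Inv.pass_time_le {w : Fin n → Fin m → ℝ} {A : List (Fin n)} {x : Fin m → Fin n}
    {p : Fin m → ℝ} (hI : IsInput w ε A N) (hv : Inv w ε A N x p) :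
    (pass w ε A x p).time + 1 ≤ stepTime n m N := by
  have hA : A.length ≤ n := by simpa using hI.matched.nodup.length_le_card
  have := FairDivision.pass_time_le w ε A hA x p hI.nonneg (hv.price_pos hI) (2 * N + 1)
    (fun i lev hH hpef hno hs s hl => (IsRise.mk hI hv hH hpef hno).search_le hs s hl)
  unfold stepTime
  omega

/-- What is known after time `t`, if the main loop starts at time `T`. -/
def Reach (w : Fin n → Fin m → ℝ) (ε : ℝ) (A : List (Fin n)) (N T : ℕ) (t : ℕ) :
    Config n m → Prop
  | Config.running x p => Inv w ε A N x p ∧ t ≤ T + potentialBound n m N * stepTime n m N ∧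
      ∀ i lev, IsHierarchy w A x p i lev →
        t + potential w ε A N x p i lev * stepTime n m N ≤
          T + potentialBound n m N * stepTime n m N
  | Config.halted x q => IsFinal w ε A x q ∧
      t ≤ T + potentialBound n m N * stepTime n m N + stepTime n m N

/-- Each continuing pass pays for its time with one unit of potential. The last pass may start at
potential zero, hence the extra `stepTime` in the halted case. -/
theorem Reach.step {w : Fin n → Fin m → ℝ} {A : List (Fin n)} (hI : IsInput w ε A N) {T t t' : ℕ}
    {c c' : Config n m} (hc : Reach w ε A N T t c) (hs : Step w ε A c c' t') :
    Reach w ε A N T (t + t') c' := by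
  -- the bound after a step that lowers the potential
  have decr : ∀ {Φ Φ' S : ℕ}, Φ' < Φ → t' ≤ stepTime n m N → t + Φ * stepTime n m N ≤ S →
      t + t' + Φ' * stepTime n m N ≤ S := by
    intro Φ Φ' S h1 h2 h3
    have := Nat.mul_le_mul_right (stepTime n m N) h1
    rw [Nat.succ_mul] at this
    omega
  rcases hs with ⟨x, p, q, h⟩ | ⟨x, p, l, k, j, h, hl⟩ | ⟨x, p, q, h⟩
  · obtain ⟨hv, ht, hpot⟩ := hc
    have htime := hv.pass_time_le hI
    refine ⟨?_, by omega⟩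
    rcases pass_cases w ε A x p hI.nonneg (hv.price_pos hI) with
      ⟨hpef, e⟩ | ⟨hpef, i, lev, hH, ⟨l, ℓ, e, _⟩ | ⟨hno, a₁, a₂, a₃, hF, hcase⟩⟩
    · rw [e] at h
      cases h
      exact ⟨hv.own, hv.price_pos hI, hv.mbb, hpef⟩
    · rw [e] at h; cases h
    · have hR : IsRise w ε A N x p i lev := ⟨hI, hv, hH, hpef, hno⟩
      rcases hcase with ⟨h1, h2, h3, e⟩ | ⟨α, hα, ⟨h2, e⟩ | ⟨h2, e⟩⟩
      · exact absurd ⟨h1, h2, h3⟩ (hR.factors_ne_none hF)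
      · rw [e] at h
        cases h
        exact ⟨hv.own, hR.raised_pos hF hα, hR.mbb_raised hF hα, hR.pef1_raised hF hα h2⟩
      · rw [e] at h; cases h
  · obtain ⟨hv, ht, hpot⟩ := hc
    have htime := hv.pass_time_le hI
    rcases pass_cases w ε A x p hI.nonneg (hv.price_pos hI) with
      ⟨hpef, e⟩ | ⟨hpef, i, lev, hH, ⟨l', ℓ, e, _, hmem, hbelow⟩ | ⟨hno, a₁, a₂, a₃, hF, hcase⟩⟩
    · rw [e] at h; cases h
    · rw [e] at h
      cases h
      have hsw := hmem k j hl
      have hB := hpot i lev hH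
      refine ⟨hv.swap hI hH hpef hsw hbelow, ?_, fun i' lev' hH' =>
        decr (potential_swap hI hv hH hpef hsw hH') htime hB⟩
      -- The bound on the elapsed time itself follows by dropping the new potential; the old one is
      -- positive because it has just decreased.
      have h0 : 0 < potential w ε A N x p i lev := by
        have hv' := hv.swap hI hH hpef hsw hbelow
        obtain ⟨i', -, hi'⟩ := (leastSpender_val A (Function.update x j k) p).resolve_left
          fun h => by have := hv.own j; rw [h.1] at this; simp at this
        exact (Nat.zero_le _).trans_lt (potential_swap hI hv hH hpef hsw
          ⟨hi', hierarchy_val w A _ p hI.nonneg (hv.price_pos hI) i'⟩)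
      have := decr h0 htime hB
      omega
    · rcases hcase with ⟨h1, h2, h3, e⟩ | ⟨α, hα, ⟨h2, e⟩ | ⟨h2, e⟩⟩ <;>
        (rw [e] at h; cases h)
  · obtain ⟨hv, ht, hpot⟩ := hc
    have htime := hv.pass_time_le hI
    rcases pass_cases w ε A x p hI.nonneg (hv.price_pos hI) with
      ⟨hpef, e⟩ | ⟨hpef, i, lev, hH, ⟨l', ℓ, e, _⟩ | ⟨hno, a₁, a₂, a₃, hF, hcase⟩⟩
    · rw [e] at h; cases h
    · rw [e] at h; cases h
    · have hR : IsRise w ε A N x p i lev := ⟨hI, hv, hH, hpef, hno⟩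
      rcases hcase with ⟨h1, h2, h3, e⟩ | ⟨α, hα, ⟨h2, e⟩ | ⟨h2, e⟩⟩
      · rw [e] at h; cases h
      · rw [e] at h; cases h
      · rw [e] at h
        cases h
        have hB := hpot i lev hH
        have htime' : (pass w ε A x p).time ≤ stepTime n m N := by omega
        refine ⟨hR.inv_raised hF hα h2, ?_, fun i' lev' hH' =>
          decr (hR.potential_raised hF hα h2 hH') htime' hB⟩
        have h0 : 0 < potential w ε A N x p i lev := by
          obtain ⟨i', -, hi'⟩ := (leastSpender_val A x (raised x p lev α)).resolve_left
            fun h => by have := hH.least.1; rw [h.1] at this; simp at this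
          exact (Nat.zero_le _).trans_lt (hR.potential_raised hF hα h2
            ⟨hi', hierarchy_val w A x _ hI.nonneg (hR.raised_pos hF hα) i'⟩)
        have := decr h0 htime' hB
        omega

end

/-! ## Executions of the algorithm -/

section

variable {n m : ℕ} {ε : ℝ} {N : ℕ}

/-- The time at which the main loop starts, on an input that is obtained in time `R`. -/
def startTime (n m R : ℕ) : ℕ :=
  R + ((m * 2 +
      n * ((m * 2 + m * (m * (1 + n * (4 * m + 5) + 1))) + (m * 4 + m * (m * 3 + 2)))) +
      n * (m * 3 + 2)) + m * (n * 2 + n * 3 + 1) + m + m * 3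

/-- An upper bound for the time of the algorithm, on an input that is obtained in time `R`. -/
def totalTime (n m N R : ℕ) : ℕ :=
  startTime n m R + potentialBound n m N * stepTime n m N + stepTime n m N

theorem exec_reach {input : Timed (Fin n → Fin m → ℝ)}
    (hI : IsInput input.val ε (matchedAgents input.val).val N) {R : ℕ} (hR : input.time ≤ R)
    {c : Config n m} {t : ℕ} (hc : Exec ε input c t) :
    Reach input.val ε (matchedAgents input.val).val N (startTime n m R) t c := by
  induction hc with
  | start x h =>
    have hv := inv_init hI h
    have h1 := setup_time_le input (by simpa using hI.matched.nodup.length_le_card)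
    have h2 := matchedAgents_time_le input.val
    have h3 := initPrices_time input.val x
    have hstart : (setup input).time + m + (initPrices input.val x).time ≤ startTime n m R := by
      unfold startTime
      omega
    refine ⟨hv, hstart.trans (Nat.le_add_right _ _), fun i lev hH => ?_⟩
    exact Nat.add_le_add hstart (Nat.mul_le_mul_right _ (potential_le hH.level))
  | step c c' t t' _ hs ih => exact ih.step hI hs

theorem exec_no_deadlock {w : Fin n → Fin m → ℝ} {A : List (Fin n)} (hI : IsInput w ε A N)
    {x : Fin m → Fin n} {p : Fin m → ℝ} (hv : Inv w ε A N x p) :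
    ∃ c' t', Step w ε A (Config.running x p) c' t' := by
  rcases pass_cases w ε A x p hI.nonneg (hv.price_pos hI) with
    ⟨-, e⟩ | ⟨-, i, lev, -, ⟨l, ℓ, e, hne, -⟩ | ⟨-, a₁, a₂, a₃, -, ⟨-, -, -, e⟩ |
      ⟨α, -, ⟨-, e⟩ | ⟨-, e⟩⟩⟩⟩
  · exact ⟨_, _, Step.finish x p _ e⟩
  · obtain ⟨⟨k, j⟩, hl⟩ := List.exists_mem_of_ne_nil l hne
    exact ⟨_, _, Step.swap x p l k j e hl⟩
  · exact ⟨_, _, Step.finish x p _ e⟩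
  · exact ⟨_, _, Step.finish x p _ e⟩
  · exact ⟨_, _, Step.raise x p _ e⟩

theorem algFinds_of_isInput {input : Timed (Fin n → Fin m → ℝ)}
    (hI : IsInput input.val ε (matchedAgents input.val).val N) {R : ℕ} (hR : input.time ≤ R)
    {u : Fin n → Fin m → ℝ} (hu : ∀ i j, u i j ≤ input.val i j)
    (hw : ∀ i j, input.val i j ≤ (1 + ε) * u i j) :
    AlgFinds ε input (totalTime n m N R) fun x => ApproxEF1 (7 * ε) u x ∧ ApproxPO ε u x := by
  refine ⟨?_, fun c t hc => ?_, fun x p t hc => ?_, fun x q t hc => ?_⟩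
  · choose x hx using fun j => exists_maximizer input.val _ j (hI.covered j)
    exact ⟨_, _, Exec.start x hx⟩
  · have h := exec_reach hI hR hc
    unfold totalTime
    cases c with
    | running x p => exact_mod_cast h.2.1.trans (Nat.le_add_right _ _)
    | halted x q => exact_mod_cast h.2
  · exact exec_no_deadlock hI (exec_reach hI hR hc).1
  · have h := (exec_reach hI hR hc).1
    exact ⟨h.approxEF1 hI hu hw, h.approxPO hI hu hw⟩

theorem AlgFinds.mono {input : Timed (Fin n → Fin m → ℝ)} {T T' : ℝ}
    {good good' : (Fin m → Fin n) → Prop} (h : AlgFinds ε input T good) (hT : T ≤ T')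
    (hg : ∀ x, good x → good' x) : AlgFinds ε input T' good' :=
  ⟨h.1, fun c t hc => (h.2.1 c t hc).trans hT, h.2.2.1, fun x p t hc => hg x (h.2.2.2 x p t hc)⟩

/-! ## Rounded instances -/

/-- The least exponent `s` with `a ≤ (1 + ε) ^ s`. -/
def roundExponent (ε a : ℝ) : ℕ := sInf {s : ℕ | a ≤ (1 + ε) ^ s}

theorem le_pow_roundExponent (he : 0 < ε) (a : ℝ) : a ≤ (1 + ε) ^ roundExponent ε a := by
  have hne : {s : ℕ | a ≤ (1 + ε) ^ s}.Nonempty := by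
    obtain ⟨s, hs⟩ := pow_unbounded_of_one_lt a (by linarith : 1 < 1 + ε)
    exact ⟨s, hs.le⟩
  exact Nat.sInf_mem hne

theorem roundExponent_le {a : ℝ} {s : ℕ} (h : a ≤ (1 + ε) ^ s) : roundExponent ε a ≤ s :=
  Nat.sInf_le h

theorem pow_roundExponent_le (he : 0 < ε) {a : ℝ} (ha : 1 ≤ a) :
    (1 + ε) ^ roundExponent ε a ≤ (1 + ε) * a := by
  rcases h : roundExponent ε a with _ | s
  · rw [pow_zero]
    nlinarith
  · have : ¬ a ≤ (1 + ε) ^ s := fun hs => by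
      have := roundExponent_le hs
      omega
    rw [pow_succ']
    exact mul_le_mul_of_nonneg_left (not_le.mp this).le (by linarith)

/-- For values at least `1` the logarithm is nonnegative, so a search through natural exponents
finds the integer ceiling. -/
theorem ceil_logb_eq (he : 0 < ε) {a : ℝ} (ha : 1 ≤ a) :
    ⌈Real.logb (1 + ε) a⌉ = (roundExponent ε a : ℤ) := by
  have hb : 1 < 1 + ε := by linarith
  have ha0 : 0 < a := by linarith
  have key : ∀ s : ℕ, Real.logb (1 + ε) a ≤ s ↔ a ≤ (1 + ε) ^ s := by
    intro s
    rw [Real.logb_le_iff_le_rpow hb ha0, Real.rpow_natCast]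
  apply le_antisymm
  · rw [Int.ceil_le]
    exact_mod_cast (key _).mpr (le_pow_roundExponent he a)
  · have h0 : 0 ≤ ⌈Real.logb (1 + ε) a⌉ := Int.ceil_nonneg (Real.logb_nonneg hb ha)
    obtain ⟨s, hs⟩ := Int.eq_ofNat_of_zero_le h0
    rw [hs]
    refine Int.ofNat_le.mpr (roundExponent_le ((key s).mp ?_))
    have := Int.le_ceil (Real.logb (1 + ε) a)
    rw [hs] at this
    exact_mod_cast this

theorem rounded_eq (he : 0 < ε) (v : Fin n → Fin m → ℕ) (i : Fin n) (j : Fin m) :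
    rounded ε v i j = if 0 < v i j then (1 + ε) ^ roundExponent ε (v i j) else 0 := by
  unfold rounded
  split_ifs with h
  · rw [ceil_logb_eq he (by exact_mod_cast h), zpow_natCast]
  · rfl

theorem le_rounded (he : 0 < ε) (v : Fin n → Fin m → ℕ) (i : Fin n) (j : Fin m) :
    realVal v i j ≤ rounded ε v i j := by
  rw [rounded_eq he, realVal]
  split_ifs with h
  · exact le_pow_roundExponent he _
  · exact_mod_cast not_lt.mp h

theorem rounded_le (he : 0 < ε) (v : Fin n → Fin m → ℕ) (i : Fin n) (j : Fin m) :
    rounded ε v i j ≤ (1 + ε) * realVal v i j := by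
  rw [rounded_eq he, realVal]
  split_ifs with h
  · exact pow_roundExponent_le he (by exact_mod_cast h)
  · positivity

theorem le_vmax (v : Fin n → Fin m → ℕ) (i : Fin n) (j : Fin m) : v i j ≤ vmax v :=
  (Finset.le_sup (f := fun j => v i j) (Finset.mem_univ j)).trans
    (Finset.le_sup (f := fun i => Finset.univ.sup fun j => v i j) (Finset.mem_univ i))

/-- A single `N` serves both purposes: it bounds the exponents of the values and the logarithm of
the number of goods. -/
theorem isInput_rounded (he : 0 < ε) (he' : ε ≤ 1) (v : Fin n → Fin m → ℕ)
    (hv : ∀ j, ∃ i, 0 < v i j) (hN : (vmax v : ℝ) ≤ (1 + ε) ^ N) (hm : (m : ℝ) ≤ (1 + ε) ^ N) :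
    IsInput (rounded ε v) ε (matchedAgents (rounded ε v)).val N where
  eps_pos := he
  eps_le := he'
  values i j := by
    rw [rounded_eq he]
    split_ifs with h
    · have : (v i j : ℝ) ≤ vmax v := by exact_mod_cast le_vmax v i j
      exact Or.inr ⟨_, roundExponent_le (this.trans hN), rfl⟩
    · exact Or.inl rfl
  matched := matchedAgents_spec _
  covered j := by
    refine (matchedAgents_spec _).cover j ?_
    obtain ⟨i, hi⟩ := hv j
    exact ⟨i, lt_of_lt_of_le (Nat.cast_pos.mpr hi) (le_rounded he v i j)⟩
  goods := hm

theorem roundInstance_val (he : 0 < ε) (v : Fin n → Fin m → ℕ) :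
    (roundInstance ε v).val = rounded ε v := by
  funext i j
  rw [rounded_eq he]
  simp only [roundInstance, Timed.val_bind, op_val, tabulate_val, Timed.val_ite, realVal,
    Nat.cast_pos, decide_eq_true_eq, powSearch, roundExponent]

theorem roundInstance_time_le (v : Fin n → Fin m → ℕ) (hN : (vmax v : ℝ) ≤ (1 + ε) ^ N) :
    (roundInstance ε v).time ≤ 1 + n * (m * (2 * N + 4) + 1) := by
  unfold roundInstance
  rw [Timed.time_bind]
  refine Nat.add_le_add le_rfl ?_
  refine (tabulate_time_le _ (m * (2 * N + 4)) fun i => ?_).trans (by simp)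
  refine (tabulate_time_le _ (2 * N + 3) fun j => ?_).trans (by simp)
  have : (v i j : ℝ) ≤ vmax v := by exact_mod_cast le_vmax v i j
  have hle : sInf {s : ℕ | realVal v i j ≤ (1 + ε) ^ s} ≤ N := roundExponent_le (this.trans hN)
  simp only [Timed.time_bind, op_time, op_val, Timed.time_ite, powSearch]
  split_ifs <;> omega

end

/-! ## Polynomial bounds -/

/-- `f` is bounded by a polynomial. -/
def PolyBound (f : ℕ → ℕ) : Prop := ∃ C d : ℕ, ∀ L, f L ≤ C * (L + 1) ^ d

theorem PolyBound.const (c : ℕ) : PolyBound fun _ => c := ⟨c, 0, fun _ => by simp⟩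

theorem PolyBound.id : PolyBound fun L => L := ⟨1, 1, fun L => by simp⟩

theorem PolyBound.add {f g : ℕ → ℕ} (hf : PolyBound f) (hg : PolyBound g) :
    PolyBound fun L => f L + g L := by
  obtain ⟨C, d, hf⟩ := hf
  obtain ⟨C', d', hg⟩ := hg
  refine ⟨C + C', d + d', fun L => ?_⟩
  have h1 : (L + 1) ^ d ≤ (L + 1) ^ (d + d') := Nat.pow_le_pow_right (by omega) (by omega)
  have h2 : (L + 1) ^ d' ≤ (L + 1) ^ (d + d') := Nat.pow_le_pow_right (by omega) (by omega)
  rw [add_mul]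
  exact Nat.add_le_add ((hf L).trans (Nat.mul_le_mul_left _ h1))
    ((hg L).trans (Nat.mul_le_mul_left _ h2))

theorem PolyBound.mul {f g : ℕ → ℕ} (hf : PolyBound f) (hg : PolyBound g) :
    PolyBound fun L => f L * g L := by
  obtain ⟨C, d, hf⟩ := hf
  obtain ⟨C', d', hg⟩ := hg
  refine ⟨C * C', d + d', fun L => ?_⟩
  rw [pow_add, mul_mul_mul_comm]
  exact Nat.mul_le_mul (hf L) (hg L)

/-- An upper bound for the time to round an instance. -/
def roundTime (n m N : ℕ) : ℕ := 1 + n * (m * (2 * N + 4) + 1)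

theorem polyBound_totalTime : PolyBound fun L => totalTime L L L (roundTime L L L) := by
  unfold totalTime roundTime startTime potentialBound stepTime posBound levelBound passTime
  repeat' first
    | exact PolyBound.id
    | exact PolyBound.const _
    | apply PolyBound.add
    | apply PolyBound.mul

/-- Reduces the bound to one variable; the bounding expressions contain no truncated subtraction, so
they are monotone. -/
theorem totalTime_mono {n m N L : ℕ} (hn : n ≤ L) (hm : m ≤ L) (hN : N ≤ L) :
    totalTime n m N (roundTime n m N) ≤ totalTime L L L (roundTime L L L) := by
  unfold totalTime roundTime startTime potentialBound stepTime posBound levelBound passTime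
  gcongr

/-! ### Bounds in terms of `m + n + 1/ε + ln v_max`. -/

section

variable {n m : ℕ} {ε : ℝ}

/-- The size of an instance together with the required precision. -/
def size (ε : ℝ) (v : Fin n → Fin m → ℕ) : ℝ := m + n + 1 / ε + Real.log (vmax v) + 1

theorem log_vmax_nonneg (v : Fin n → Fin m → ℕ) : 0 ≤ Real.log (vmax v) :=
  Real.log_natCast_nonneg _

/-- `log (1 + ε) ≥ ε / (1 + ε / 2) ≥ ε / 2`, so `L log (1 + ε) ≥ K · (K ε) ≥ K`: one factor `K` pays
for `1/ε`, the other for the logarithm of `a`. -/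
theorem natCast_le_pow (he : 0 < ε) (he' : ε ≤ 1) {a L : ℕ} {K : ℝ} (ha : Real.log a ≤ K)
    (hK : 1 / ε ≤ K) (hL : 2 * K ^ 2 ≤ L) : (a : ℝ) ≤ (1 + ε) ^ L := by
  rcases Nat.eq_zero_or_pos a with rfl | hpos
  · rw [Nat.cast_zero]; positivity
  have ha0 : (0 : ℝ) < a := by exact_mod_cast hpos
  rw [← Real.log_le_log_iff ha0 (by positivity), Real.log_pow]
  refine ha.trans ?_
  have hlog : ε / 2 ≤ Real.log (1 + ε) := by
    refine le_trans ?_ (Real.le_log_one_add_of_nonneg he.le)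
    rw [div_le_div_iff₀ (by norm_num) (by linarith)]
    nlinarith
  have hK0 : 0 < K := (by positivity : 0 < 1 / ε).trans_le hK
  have hKe : 1 ≤ K * ε := by rwa [div_le_iff₀ he] at hK
  calc K ≤ K * (K * ε) := le_mul_of_one_le_right hK0.le hKe
    _ = (2 * K ^ 2) * (ε / 2) := by ring
    _ ≤ L * Real.log (1 + ε) := mul_le_mul hL hlog (by positivity) (by positivity)

theorem exists_size_bound {C d : ℕ}
    (hC : ∀ L, totalTime L L L (roundTime L L L) ≤ C * (L + 1) ^ d)
    (he : 0 < ε) (he' : ε ≤ 1) (v : Fin n → Fin m → ℕ) :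
    ∃ N : ℕ, (vmax v : ℝ) ≤ (1 + ε) ^ N ∧ (m : ℝ) ≤ (1 + ε) ^ N ∧
      (totalTime n m N (roundTime n m N) : ℝ) ≤ C * (4 * size ε v ^ 2) ^ d := by
  have h0 := log_vmax_nonneg v
  have hε : 0 < 1 / ε := by positivity
  have hm0 : (0 : ℝ) ≤ m := Nat.cast_nonneg _
  have hn0 : (0 : ℝ) ≤ n := Nat.cast_nonneg _
  set K := size ε v with hK
  have hK1 : 1 ≤ K := by rw [hK, size]; linarith
  have hsq : K ≤ 2 * K ^ 2 := by nlinarith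
  have hL := Nat.le_ceil (2 * K ^ 2)
  refine ⟨⌈2 * K ^ 2⌉₊, ?_, ?_, ?_⟩
  · exact natCast_le_pow he he' (by rw [hK, size]; linarith) (by rw [hK, size]; linarith) hL
  · refine natCast_le_pow he he' ((Real.log_le_self hm0).trans ?_) (by rw [hK, size]; linarith) hL
    rw [hK, size]; linarith
  · have hn : n ≤ ⌈2 * K ^ 2⌉₊ := by
      have : (n : ℝ) ≤ K := by rw [hK, size]; linarith
      exact_mod_cast (this.trans hsq).trans hL
    have hm : m ≤ ⌈2 * K ^ 2⌉₊ := by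
      have : (m : ℝ) ≤ K := by rw [hK, size]; linarith
      exact_mod_cast (this.trans hsq).trans hL
    have h1 : (totalTime n m ⌈2 * K ^ 2⌉₊ (roundTime n m ⌈2 * K ^ 2⌉₊) : ℝ) ≤
        C * ((⌈2 * K ^ 2⌉₊ : ℝ) + 1) ^ d := by
      exact_mod_cast (totalTime_mono hn hm le_rfl).trans (hC _)
    refine h1.trans ?_
    have h2 := Nat.ceil_lt_add_one (by positivity : 0 ≤ 2 * K ^ 2)
    -- The left side is less than `2 * K ^ 2 + 2`, and `K ≥ 1` owing to the summand `1` in `size`.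
    have h3 : (⌈2 * K ^ 2⌉₊ : ℝ) + 1 ≤ 4 * K ^ 2 := by nlinarith
    gcongr

/-- Capping the precision at `1` adds at most `1` to the size, which the constant summand of `7 *
size ε v` absorbs. -/
theorem size_min_le (he : 0 < ε) (v : Fin n → Fin m → ℕ) :
    size (min (ε / 7) 1) v ≤ 7 * size ε v := by
  have h0 := log_vmax_nonneg v
  have hε : 0 < 1 / ε := by positivity
  have hm0 : (0 : ℝ) ≤ m := Nat.cast_nonneg _
  have hn0 : (0 : ℝ) ≤ n := Nat.cast_nonneg _
  have : 1 / min (ε / 7) 1 ≤ 7 * (1 / ε) + 1 := by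
    rcases min_choice (ε / 7) 1 with h | h <;> rw [h]
    · rw [one_div_div]
      have : 7 / ε = 7 * (1 / ε) := by ring
      linarith
    · linarith
  unfold size
  linarith

theorem size_nonneg (he : 0 < ε) (v : Fin n → Fin m → ℕ) : 0 ≤ size ε v := by
  have := log_vmax_nonneg v
  unfold size
  positivity

/-- A polynomial bound in terms of the size of an instance. -/
def sizePolynomial (C d : ℕ) (a : ℝ) : MvPolynomial (Fin 4) ℝ :=
  MvPolynomial.C (C : ℝ) * (4 * (MvPolynomial.C a * (MvPolynomial.X 0 + MvPolynomial.X 1 +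
    MvPolynomial.X 2 + MvPolynomial.X 3 + 1)) ^ 2) ^ d

theorem boundAt_sizePolynomial (C d : ℕ) (a ε : ℝ) (v : Fin n → Fin m → ℕ) :
    boundAt (sizePolynomial C d a) ε v = C * (4 * (a * size ε v) ^ 2) ^ d := by
  simp [boundAt, sizePolynomial, size]

theorem ApproxEF1.mono {δ δ' : ℝ} (h : δ ≤ δ') {v : Fin n → Fin m → ℕ} {x : Fin m → Fin n}
    (hx : ApproxEF1 δ (realVal v) x) : ApproxEF1 δ' (realVal v) x := by
  intro i k
  refine (hx i k).imp_right fun ⟨j, hj, hle⟩ => ⟨j, hj, hle.trans ?_⟩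
  have : 0 ≤ value (realVal v) i (bundle x i) := Finset.sum_nonneg fun j _ => Nat.cast_nonneg _
  exact mul_le_mul_of_nonneg_right (by linarith) this

theorem ApproxPO.mono {δ δ' : ℝ} (h : δ ≤ δ') {v : Fin n → Fin m → ℕ} {x : Fin m → Fin n}
    (hx : ApproxPO δ (realVal v) x) : ApproxPO δ' (realVal v) x := by
  rintro ⟨y, hy, i, hi⟩
  have hle : ∀ k, (1 + δ) * value (realVal v) k (bundle x k) ≤
      (1 + δ') * value (realVal v) k (bundle x k) := fun k =>
    mul_le_mul_of_nonneg_right (by linarith) (Finset.sum_nonneg fun j _ => Nat.cast_nonneg _)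
  exact hx ⟨y, fun k => (hle k).trans (hy k), i, (hle i).trans_lt hi⟩

end

end FairDivision
end

theorem mainTheorem5 :
    (∃ P : MvPolynomial (Fin 4) ℝ,
      ∀ (n m : ℕ) (v : Fin n → Fin m → ℕ) (ε : ℝ),
        (∀ j, ∃ i, 0 < v i j) → 0 < ε → ε ≤ 1 →
        FairDivision.AlgFinds ε (pure (FairDivision.rounded ε v)) (FairDivision.boundAt P ε v)
          (fun x => FairDivision.ApproxEF1 (7 * ε) (FairDivision.realVal v) x ∧
            FairDivision.ApproxPO ε (FairDivision.realVal v) x)) ∧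
    (∃ Q : MvPolynomial (Fin 4) ℝ,
      ∀ (n m : ℕ) (v : Fin n → Fin m → ℕ) (ε : ℝ),
        (∀ j, ∃ i, 0 < v i j) → 0 < ε →
        FairDivision.AlgFinds (min (ε / 7) 1) (FairDivision.roundInstance (min (ε / 7) 1) v)
          (FairDivision.boundAt Q ε v)
          (fun x => FairDivision.ApproxEF1 ε (FairDivision.realVal v) x ∧
            FairDivision.ApproxPO ε (FairDivision.realVal v) x)) := by
  obtain ⟨C, d, hC⟩ := FairDivision.polyBound_totalTime
  refine ⟨⟨FairDivision.sizePolynomial C d 1, fun n m v ε hv he he' => ?_⟩,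
    ⟨FairDivision.sizePolynomial C d 7, fun n m v ε hv he => ?_⟩⟩
  · obtain ⟨N, hN, hm, ht⟩ := FairDivision.exists_size_bound hC he he' v
    refine (FairDivision.algFinds_of_isInput (FairDivision.isInput_rounded he he' v hv hN hm)
      (Nat.zero_le (FairDivision.roundTime n m N)) (FairDivision.le_rounded he v) (FairDivision.rounded_le he v)).mono ?_
      fun x hx => hx
    rw [FairDivision.boundAt_sizePolynomial, one_mul]
    exact ht
  · have hδ : 0 < min (ε / 7) 1 := by positivity
    -- With `δ = min (ε / 7) 1`, both `7δ ≤ ε` and `δ ≤ ε` hold, as the two guarantees require.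
    have hδ' : min (ε / 7) 1 ≤ ε / 7 := min_le_left _ _
    have hval := FairDivision.roundInstance_val hδ v
    obtain ⟨N, hN, hm, ht⟩ := FairDivision.exists_size_bound hC hδ (min_le_right _ _) v
    have hI := FairDivision.isInput_rounded hδ (min_le_right _ _) v hv hN hm
    rw [← hval] at hI
    refine (FairDivision.algFinds_of_isInput hI (FairDivision.roundInstance_time_le v hN)
      (u := FairDivision.realVal v) (by rw [hval]; exact FairDivision.le_rounded hδ v)
      (by rw [hval]; exact FairDivision.rounded_le hδ v)).mono ?_
      fun x hx => ⟨hx.1.mono (by linarith), hx.2.mono (by linarith)⟩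
    rw [FairDivision.boundAt_sizePolynomial]
    refine ht.trans ?_
    have h1 := FairDivision.size_min_le he v
    have h2 := FairDivision.size_nonneg hδ v
    gcongr
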